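/- Let $X$ be a Hausdorff locally compact topological space (for example a complex manifold), $\mathcal A$ a sheaf of rings on $X$ and $\hbar$ a global section of $\mathcal A$ contained in the center of $\mathcal A$. All modules are left modules. For an $\mathcal A$-module $\mathcal M$ and $n\ge 0$ put $\mathcal M_n=\mathcal M/\hbar^{n+1}\mathcal M$ and ${}_n\mathcal M=\ker(\hbar^{n+1}:\mathcal M\to\mathcal M)$, and let $\mathcal A_0=\mathcal A/\hbar\mathcal A$. A module $\mathcal M$ over a sheaf of rings $\mathcal R$ is coherent if it is locally finitely generated and, for every open $U$, every locally finitely generated submodule of $\mathcal M|_U$ locally admits a finite free presentation; $\mathrm{Mod}_{coh}(\mathcal R)$ is the full subcategory of coherent modules. A sheaf of rings $\mathcal R$ is left Noetherian if it is coherent as a left module over itself, all its stalks are left Noetherian, and for every open $U$ the sum of any family of coherent left ideals of $\mathcal R|_U$ is coherent. Assume that $\mathcal A$ is an algebra of formal deformation, that is: (i) $\hbar:\mathcal A\to\mathcal A$ is injective and $\mathcal A\to\varprojlim_n\mathcal A_n$ is an isomorphism; (ii) $\mathcal A_0$ is a left Noetherian sheaf of rings; and at least one of the following holds: (iii) there is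 a basis $\mathcal B$ of open subsets of $X$ such that $H^n(U;\mathcal F)=0$ for all $U\in\mathcal B$, all coherent $\mathcal A_0|_U$-modules $\mathcal F$ and all $n>0$; (iv) there are a family $\mathcal B$ of compact subsets of $X$ such that for every $x\in X$ and every open $U\ni x$ some $K\in\mathcal B$ satisfies $x\in\mathrm{Int}(K)$ and $K\subset U$, and, for each open $U$, a full subcategory $\mathrm{Mod}_{good}(\mathcal A_0|_U)$ of $\mathrm{Mod}_{coh}(\mathcal A_0|_U)$, stable by restriction to smaller open sets, such that: (a) for $K\in\mathcal B$ and $U$ open with $K\subset U$ there is $K'\in\mathcal B$ with $K\subset\mathrm{Int}(K')\subset K'\subset U$; (b) a coherent $\mathcal A_0|_U$-module whose restriction to every open $V$ with compact closure contained in $U$ is good is itself good; (c) $\mathrm{Mod}_{good}(\mathcal A_0|_U)$ is stable by subobjects and quotients in $\mathrm{Mod}_{coh}(\mathcal A_0|_U)$; (d) $H^j(K;\mathcal M)=0$ for $K\in\mathcal B$, $U$ open containing $K$, $\mathcal M\in\mathrm{Mod}_{good}(\mathcal A_0|_U)$ and $j>0$; (e) every coherent $\mathcal A_0|_U$-module is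 locally good; (f) $\mathcal A_0$ is good. Let $\mathcal S: U\mapsto\mathcal S(U)$ be a full Serre substack of $U\mapsto\mathrm{Mod}_{coh}(\mathcal A|_U)$: each $\mathcal S(U)$ is a Serre subcategory of $\mathrm{Mod}_{coh}(\mathcal A|_U)$ (it contains $0$, and in a short exact sequence of coherent modules the middle term belongs to it if and only if both outer terms do), $\mathcal S$ is stable by restriction, and a coherent $\mathcal A|_U$-module that belongs locally to $\mathcal S$ belongs to $\mathcal S(U)$. Let $\mathcal S_n$ consist of the objects of $\mathcal S(X)$ annihilated by $\hbar^{n+1}$, and let $\mathrm{Mod}_{\mathcal S}(\mathcal A)$ be the full subcategory of $\mathrm{Mod}_{coh}(\mathcal A)$ of the $\mathcal M$ such that ${}_n\mathcal M\in\mathcal S_n$ and $\mathcal M_n\in\mathcal S_n$ for all $n\ge0$. Then $\mathrm{Mod}_{\mathcal S}(\mathcal A)$ is a Serre subcategory of $\mathrm{Mod}_{coh}(\mathcal A)$. Moreover, for a coherent $\mathcal A$-module $\mathcal M$ the following are equivalent: (1) $\mathcal M\in\mathrm{Mod}_{\mathcal S}(\mathcal A)$; (2) $\mathcal M_0\in\mathcal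 S_0$; (3) $\mathcal M_n\in\mathcal S_n$ for every $n\ge0$. -/

import Mathlib

open CategoryTheory CategoryTheory.Limits TopologicalSpace Opposite

universe u v

noncomputable section

/-! ### Coherent modules and Noetherian sheaves of rings -/

/-- A coherent module over a sheaf of rings `R`: it is locally finitely generated, and for every
object `U` of the site, each locally finitely generated submodule of its restriction to `U`
locally admits a finite free presentation. -/
def IsCoherentModule {C : Type u} [SmallCategory C] {J : GrothendieckTopology C}
    {R : Sheaf J RingCat.{u}} (M : SheafOfModules.{u} R) : Prop :=
  M.IsFiniteType ∧
    ∀ (U : C) (N : SheafOfModules.{u} (R.over U)) (i : N ⟶ M.over U),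
      Mono i → N.IsFiniteType → N.IsFinitePresentation

/-- The objects of `Mod_coh(R)`, as a property of objects of `Mod(R)`. -/
def coherentModules {C : Type u} [SmallCategory C] {J : GrothendieckTopology C}
    (R : Sheaf J RingCat.{u}) : ObjectProperty (SheafOfModules.{u} R) :=
  IsCoherentModule

/-- `S` is a Serre subcategory of the full subcategory `P` of the abelian category `𝒞`, where `P`
is closed under finite limits and colimits (as is the case for coherent modules), so that
exactness in `P` is exactness in `𝒞`: it is a full subcategory of `P` containing zero, and for
a short exact sequence in `P` the middle term is in `S` if and only if both outer terms are. -/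
structure IsSerreSubcategory {𝒞 : Type u} [Category.{v} 𝒞] [Abelian 𝒞]
    (P S : ObjectProperty 𝒞) : Prop where
  le : S ≤ P
  zero : ∀ Z : 𝒞, IsZero Z → S Z
  shortExact : ∀ E : ShortComplex 𝒞, E.ShortExact → P E.X₁ → P E.X₂ → P E.X₃ →
    (S E.X₂ ↔ S E.X₁ ∧ S E.X₃)

variable {X : TopCat.{u}}

/-- Restriction of modules from an open subset `U` to an open subset `V ⊆ U`. -/
abbrev restrictModule {R : Sheaf (Opens.grothendieckTopology X) RingCat.{u}} {U V : Opens X} (i : V ⟶ U)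
    (M : SheafOfModules.{u} (R.over U)) : SheafOfModules.{u} (R.over V) :=
  (SheafOfModules.overMap R i).obj M

/-- A left Noetherian sheaf of rings (in the sense of Kashiwara): it is coherent, its stalks are
left Noetherian, and over any open subset the sum of any family of coherent left ideals is
coherent. -/
structure IsLeftNoetherianSheaf (R : Sheaf (Opens.grothendieckTopology X) RingCat.{u}) : Prop where
  coherent : IsCoherentModule (SheafOfModules.unit R)
  stalk : ∀ x : X, IsNoetherianRing (TopCat.Presheaf.stalk (C := RingCat.{u}) R.obj x)
  sum : ∀ (U : Opens X) (F : Set (Subobject (SheafOfModules.unit (R.over U)))),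
    (∀ I ∈ F, IsCoherentModule (I : SheafOfModules.{u} (R.over U))) →
      ∀ T : Subobject (SheafOfModules.unit (R.over U)), IsLUB F T →
        IsCoherentModule (T : SheafOfModules.{u} (R.over U))

/-! ### The section `ħ`, the modules `M / ħ ^ (n + 1) M` and `ker (ħ ^ (n + 1))` -/

/-- The restriction to `U` of a global section of a sheaf of rings. -/
def resTop (A : Sheaf (Opens.grothendieckTopology X) RingCat.{u}) (s : A.obj.obj (op ⊤)) (U : (Opens X)ᵒᵖ) : A.obj.obj U :=
  A.obj.map (homOfLE (le_top : U.unop ≤ ⊤)).op s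

lemma resTop_map (A : Sheaf (Opens.grothendieckTopology X) RingCat.{u}) (s : A.obj.obj (op ⊤)) {U V : (Opens X)ᵒᵖ}
    (f : U ⟶ V) : A.obj.map f (resTop A s U) = resTop A s V := by
  unfold resTop
  rw [← RingCat.comp_apply, ← A.obj.map_comp]
  rfl

/-- A global section `ħ` of `A` contained in the center of `A`. -/
structure CentralSection (A : Sheaf (Opens.grothendieckTopology X) RingCat.{u}) where
  val : A.obj.obj (op ⊤)
  central : ∀ (U : (Opens X)ᵒᵖ) (a : A.obj.obj U), resTop A val U * a = a * resTop A val U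

variable {A : Sheaf (Opens.grothendieckTopology X) RingCat.{u}} (h : CentralSection A)

/-- Multiplication by `ħ ^ n` on an `A`-module. -/
def hPow (M : SheafOfModules.{u} A) (n : ℕ) : M ⟶ M where
  val :=
    { app := fun U => ModuleCat.ofHom
        { toFun := fun m => (resTop A h.val U) ^ n • m
          map_add' := fun x y => smul_add _ x y
          map_smul' := fun a x => by
            have e : Commute (resTop A h.val U) a := h.central U a
            simp only [RingHom.id_apply, smul_smul, (e.pow_left n).eq] }
      naturality := fun {U V} f => by
        ext m
        change (resTop A h.val V) ^ n • M.val.map f m = M.val.map f ((resTop A h.val U) ^ n • m)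
        rw [M.val.map_smul, ← resTop_map A h.val f, map_pow] }

lemma hPow_succ (M : SheafOfModules.{u} A) (n : ℕ) :
    hPow h M (n + 1) = hPow h M 1 ≫ hPow h M n := by
  ext U m
  change (resTop A h.val U) ^ (n + 1) • m =
    (resTop A h.val U) ^ n • ((resTop A h.val U) ^ 1 • m)
  rw [smul_smul, pow_succ, pow_one]

/-- `_nM`, the kernel of `ħ ^ (n + 1) : M ⟶ M`. -/
abbrev hKer (M : SheafOfModules.{u} A) (n : ℕ) : SheafOfModules.{u} A :=
  kernel (hPow h M (n + 1))

/-- `M_n`, the quotient `M / ħ ^ (n + 1) M`. -/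
abbrev hQuot (M : SheafOfModules.{u} A) (n : ℕ) : SheafOfModules.{u} A :=
  cokernel (hPow h M (n + 1))

/-- The projection `M ⟶ M_n`. -/
abbrev hProj (M : SheafOfModules.{u} A) (n : ℕ) : M ⟶ hQuot h M n :=
  cokernel.π (hPow h M (n + 1))

/-- The transition morphism `M_{n + 1} ⟶ M_n`. -/
def hTrans (M : SheafOfModules.{u} A) (n : ℕ) : hQuot h M (n + 1) ⟶ hQuot h M n :=
  cokernel.desc (hPow h M (n + 1 + 1)) (hProj h M n) (by
    rw [hPow_succ, Category.assoc, hProj, cokernel.condition, comp_zero])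

lemma hProj_hTrans (M : SheafOfModules.{u} A) (n : ℕ) :
    hProj h M (n + 1) ≫ hTrans h M n = hProj h M n :=
  cokernel.π_desc _ _ _

/-- The cone with vertex `M` over the projective system `(M_n)`. -/
def hCone (M : SheafOfModules.{u} A) : Cone (Functor.ofOpSequence (hTrans h M)) where
  pt := M
  π := NatTrans.ofOpSequence (fun n => hProj h M n) (fun n => by
    rw [Functor.ofOpSequence_map_homOfLE_succ]
    exact (Category.id_comp _).trans (hProj_hTrans h M n).symm)

/-- `M` is `ħ`-torsion free: multiplication by `ħ` is injective. -/
def IsHTorsionFree (M : SheafOfModules.{u} A) : Prop := Mono (hPow h M 1)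

/-- `M` is `ħ`-complete: `M` is the projective limit of the `M_n`. -/
def IsHComplete (M : SheafOfModules.{u} A) : Prop := Nonempty (IsLimit (hCone h M))

/-! ### The sheaf of rings `A₀ = A / ħ A` -/

/-- The ideal `ħ A(U)` of `A(U)`. -/
def hIdeal (U : (Opens X)ᵒᵖ) : Ideal (A.obj.obj U) := Ideal.span {resTop A h.val U}

instance (U : (Opens X)ᵒᵖ) : (hIdeal h U).IsTwoSided where
  mul_mem_of_left := by
    intro a b ha
    obtain ⟨c, rfl⟩ := Ideal.mem_span_singleton'.1 ha
    refine Ideal.mem_span_singleton'.2 ⟨c * b, ?_⟩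
    rw [mul_assoc, ← h.central U b, mul_assoc]

lemma hIdeal_le_comap {U V : (Opens X)ᵒᵖ} (f : U ⟶ V) :
    hIdeal h U ≤ Ideal.comap (A.obj.map f).hom (hIdeal h V) := by
  refine (Ideal.span_singleton_le_iff_mem _).2 ?_
  change A.obj.map f (resTop A h.val U) ∈ hIdeal h V
  rw [resTop_map]
  exact Ideal.subset_span rfl

/-- The presheaf of rings `U ↦ A(U) / ħ A(U)`. -/
def quotPresheaf : (Opens X)ᵒᵖ ⥤ RingCat.{u} where
  obj U := RingCat.of (A.obj.obj U ⧸ hIdeal h U)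
  map f := RingCat.ofHom (Ideal.quotientMap _ (A.obj.map f).hom (hIdeal_le_comap h f))
  map_id U := by
    ext x
    simp
  map_comp f g := by
    ext x
    simp

/-- The sheaf of rings `A₀ = A / ħ A`. -/
def reduction : Sheaf (Opens.grothendieckTopology X) RingCat.{u} :=
  (presheafToSheaf (Opens.grothendieckTopology X) RingCat.{u}).obj (quotPresheaf h)

/-! ### Cohomology on open and on compact subsets -/

/-- The cohomology `H^j(U; F)` of a module `F` over the restriction of a sheaf of rings to the
open subset `U`. -/
abbrev cohomologyOpen {R : Sheaf (Opens.grothendieckTopology X) RingCat.{u}} {U : Opens X}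
    (F : SheafOfModules.{u} (R.over U)) (j : ℕ) : Type u :=
  ((SheafOfModules.toSheaf (R.over U)).obj F).H j

/-- A subset of `X` with the induced topology. -/
def subsetSpace (K : Set X) : TopCat.{u} := TopCat.of K

/-- The inclusion of a subset. -/
def subsetIncl (K : Set X) : subsetSpace K ⟶ X :=
  TopCat.ofHom ⟨Subtype.val, continuous_subtype_val⟩

/-- For `K ⊆ U`, the functor `W ↦ W ∩ K` from the open subsets of `U` to those of `K`. -/
abbrev interFunctor (U : Opens X) (K : Set X) : Over U ⥤ Opens (subsetSpace K) :=
  Over.forget U ⋙ Opens.map (subsetIncl K)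

instance (U : Opens X) (K : Set X) : (interFunctor U K).IsContinuous
    ((Opens.grothendieckTopology X).over U) (Opens.grothendieckTopology (subsetSpace K)) :=
  Functor.isContinuous_comp _ _ _ (Opens.grothendieckTopology X) _

/-- For `K ⊆ U`, the inverse image on `K` of the abelian sheaf underlying a module on `U`. -/
def inverseImage {R : Sheaf (Opens.grothendieckTopology X) RingCat.{u}} {U : Opens X}
    (F : SheafOfModules.{u} (R.over U)) (K : Set X) :
    Sheaf (Opens.grothendieckTopology (subsetSpace K)) AddCommGrpCat.{u} :=
  ((interFunctor U K).sheafPullback AddCommGrpCat.{u} ((Opens.grothendieckTopology X).over U)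
    (Opens.grothendieckTopology (subsetSpace K))).obj ((SheafOfModules.toSheaf (R.over U)).obj F)

/-- For `K ⊆ U`, the cohomology `H^j(K; F)`. -/
abbrev cohomologySubset {R : Sheaf (Opens.grothendieckTopology X) RingCat.{u}} {U : Opens X}
    (F : SheafOfModules.{u} (R.over U)) (K : Set X) (j : ℕ) : Type u :=
  (inverseImage F K).H j

/-! ### Algebras of formal deformation -/

/-- There is a basis of open subsets on which all coherent modules over the restriction of `R`
are acyclic. -/
def HasAcyclicOpenBasis (R : Sheaf (Opens.grothendieckTopology X) RingCat.{u}) : Prop :=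
  ∃ B : Set (Opens X), Opens.IsBasis B ∧
    ∀ U ∈ B, ∀ F : SheafOfModules.{u} (R.over U), IsCoherentModule F →
      ∀ n : ℕ, 0 < n → Subsingleton (cohomologyOpen F n)

/-- `B` is a basis of compact subsets of `X` and `good`, with `good U` a full subcategory of
`Mod(R|_U)` for every open `U`, is a prestack of good modules adapted to `B`. -/
structure IsGoodPrestack (R : Sheaf (Opens.grothendieckTopology X) RingCat.{u}) (B : Set (Set X))
    (good : ∀ U : Opens X, ObjectProperty (SheafOfModules.{u} (R.over U))) : Prop where
  compact : ∀ K ∈ B, IsCompact K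
  basis : ∀ (x : X) (U : Opens X), x ∈ U → ∃ K ∈ B, x ∈ interior K ∧ K ⊆ U
  between : ∀ K ∈ B, ∀ U : Opens X, K ⊆ U → ∃ K' ∈ B, K ⊆ interior K' ∧ K' ⊆ U
  coherent : ∀ U : Opens X, good U ≤ coherentModules (R.over U)
  restrict : ∀ (U V : Opens X) (i : V ⟶ U) (M : SheafOfModules.{u} (R.over U)),
    good U M → good V (restrictModule i M)
  exhaust : ∀ (U : Opens X) (M : SheafOfModules.{u} (R.over U)), IsCoherentModule M →
    (∀ (V : Opens X) (i : V ⟶ U), IsCompact (closure (V : Set X)) →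
      closure (V : Set X) ⊆ U → good V (restrictModule i M)) → good U M
  sub : ∀ (U : Opens X) (M N : SheafOfModules.{u} (R.over U)) (f : N ⟶ M), Mono f →
    IsCoherentModule N → good U M → good U N
  quot : ∀ (U : Opens X) (M N : SheafOfModules.{u} (R.over U)) (f : M ⟶ N), Epi f →
    IsCoherentModule N → good U M → good U N
  acyclic : ∀ K ∈ B, ∀ U : Opens X, K ⊆ U → ∀ M : SheafOfModules.{u} (R.over U), good U M →
    ∀ j : ℕ, 0 < j → Subsingleton (cohomologySubset M K j)
  locally_good : ∀ (U : Opens X) (M : SheafOfModules.{u} (R.over U)), IsCoherentModule M →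
    ∀ x ∈ U, ∃ (V : Opens X) (i : V ⟶ U), x ∈ V ∧ good V (restrictModule i M)
  unit : good ⊤ (SheafOfModules.unit (R.over ⊤))

/-- `A` is an algebra of formal deformation with parameter `ħ`: it is `ħ`-torsion free and
`ħ`-complete, `A₀ = A / ħ A` is a left Noetherian ring, and `A₀` has either a basis of open
subsets acyclic for coherent modules or a prestack of good modules with a basis of compact
subsets. -/
structure IsFormalDeformation (A : Sheaf (Opens.grothendieckTopology X) RingCat.{u}) (h : CentralSection A) : Prop where
  torsionFree : IsHTorsionFree h (SheafOfModules.unit A)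
  complete : IsHComplete h (SheafOfModules.unit A)
  noetherian : IsLeftNoetherianSheaf (reduction h)
  acyclic : HasAcyclicOpenBasis (reduction h) ∨ ∃ B good, IsGoodPrestack (reduction h) B good

/-! ### Serre substacks and the category `Mod_S(A)` -/

/-- A full Serre substack `U ↦ S(U)` of `U ↦ Mod_coh(A|_U)`: each `S(U)` is a Serre subcategory,
stable by restriction, and a coherent module which locally belongs to `S` belongs to `S`. -/
structure SerreSubstack (A : Sheaf (Opens.grothendieckTopology X) RingCat.{u}) where
  obj : ∀ U : Opens X, ObjectProperty (SheafOfModules.{u} (A.over U))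
  serre : ∀ U : Opens X, IsSerreSubcategory (coherentModules (A.over U)) (obj U)
  restrict : ∀ (U V : Opens X) (i : V ⟶ U) (M : SheafOfModules.{u} (A.over U)),
    obj U M → obj V (restrictModule i M)
  glue : ∀ (U : Opens X) (M : SheafOfModules.{u} (A.over U)), IsCoherentModule M →
    (∀ x ∈ U, ∃ (V : Opens X) (i : V ⟶ U), x ∈ V ∧ obj V (restrictModule i M)) → obj U M

/-- `S(X)`, as a full subcategory of `Mod(A)`. -/
def SerreSubstack.global (S : SerreSubstack A) : ObjectProperty (SheafOfModules.{u} A) :=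
  fun M => S.obj ⊤ (M.over ⊤)

/-- `S_n(X) = S(X) ∩ Mod(A_n)`, where `Mod(A_n)` is identified with the category of the
`A`-modules annihilated by `ħ ^ (n + 1)`. -/
def SerreSubstack.level (S : SerreSubstack A) (h : CentralSection A) (n : ℕ) :
    ObjectProperty (SheafOfModules.{u} A) :=
  fun M => S.global M ∧ hPow h M (n + 1) = 0

/-- `Mod_S(A)`: the coherent `A`-modules `M` such that `_nM` and `M_n` are objects of `S_n` for
all `n`. -/
def modSerre (S : SerreSubstack A) (h : CentralSection A) :
    ObjectProperty (SheafOfModules.{u} A) :=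
  fun M => IsCoherentModule M ∧
    ∀ n : ℕ, S.level h n (hKer h M n) ∧ S.level h n (hQuot h M n)

end

/-! The theorem is formal once the `ħ`-power torsion is controlled. Since `M₀ → M_{n+1} → M_n` is
exact, (2) gives (3) by induction (`global_hQuot`). For (3) ⇒ (1) it is enough that near each point
some `N` satisfies `_nM ∩ ħ^{N+1}M = 0` for all `n` (`TorsionEmbeds`): then `_nM` is locally a
subobject of `M_N`, and membership in `S` glues. Membership in `Mod_S(A)` is thus read off from
`M₀`, and the Serre property follows from the exact sequence `₀M'' → M'₀ → M₀ → M''₀ → 0` of the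
snake lemma (`global_snake`, `exact_hQuot`).

The substance is `IsFormalDeformation.torsionEmbeds`. Let `y` be local generators of the coherent
module `M`, and write `Yφ = ∑ φᵢ yᵢ`. The modules of those `φ` with `ħ^r Yφ ∈ ħ^{r+1}M` increase
with `r`, contain all multiples of `ħ`, and are locally finitely generated; their reductions modulo
`ħ` are locally stationary because `A₀` is Noetherian, so they themselves are stable from some `N`
on (`stationary_initial`). Hence a section `s` of `ħ^N M` with `ħs = 0` is infinitely divisible by
`ħ` (`mem_pow_of_torsion`).

It remains to see that such an `s = ħ^N Yf`, if it lies in `ħ^{N+1}M`, vanishes. Let `g` be finitely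
many generators of the relations between the `ħ^N yᵢ`; it suffices to solve `a·g = f`. By infinite
divisibility, every solution modulo `ħ^{n+1}` improves locally to one modulo `ħ^{n+2}`
(`improvable_of_torsion`), but the neighbourhoods could shrink with `n`. The approximate solutions
are therefore arranged in a tower of modules whose successive kernels are all the same coherent
`A₀`-module, namely the relations between the reductions of `g` (`exact_towerKer`). Vanishing of its
`H¹` on an open or compact neighbourhood lifts a solution through the whole tower over one fixed
open set (`exists_liftsTowers`), and completeness of `A` supplies the limit (`exists_lincomb_eq`).

Coherence is handled by elements: a module is coherent exactly when it is locally finitely generated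
and the relations between any finite family of sections are so too (`isCoherentModule_iff`). -/

noncomputable section

/-! ### Local properties on a site -/

namespace CategoryTheory.GrothendieckTopology

variable {C : Type u} [Category.{v} C] (J : GrothendieckTopology C)

/-- A property of the morphisms to `U` holds locally if it holds on a covering sieve. -/
def Locally (U : C) (p : ∀ V : C, (V ⟶ U) → Prop) : Prop :=
  ∃ S ∈ J U, ∀ (V : C) (f : V ⟶ U), S f → p V f

variable {J} {U : C} {p q : ∀ V : C, (V ⟶ U) → Prop}

lemma Locally.mono (h : J.Locally U p) (hpq : ∀ V f, p V f → q V f) : J.Locally U q := by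
  obtain ⟨S, hS, h⟩ := h
  exact ⟨S, hS, fun V f hf => hpq V f (h V f hf)⟩

lemma Locally.of_forall (h : ∀ V f, p V f) : J.Locally U p :=
  ⟨⊤, J.top_mem U, fun V f _ => h V f⟩

lemma Locally.and (hp : J.Locally U p) (hq : J.Locally U q) :
    J.Locally U (fun V f => p V f ∧ q V f) := by
  obtain ⟨S, hS, hp⟩ := hp
  obtain ⟨T, hT, hq⟩ := hq
  exact ⟨S ⊓ T, J.intersection_covering hS hT, fun V f hf => ⟨hp V f hf.1, hq V f hf.2⟩⟩

lemma Locally.pullback (hp : J.Locally U p) {V : C} (f : V ⟶ U) :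
    J.Locally V (fun W g => p W (g ≫ f)) := by
  obtain ⟨S, hS, hp⟩ := hp
  exact ⟨S.pullback f, J.pullback_stable f hS, fun W g hg => hp W _ hg⟩

lemma Locally.bind (hp : J.Locally U p)
    (h : ∀ V f, p V f → J.Locally V (fun W g => q W (g ≫ f))) : J.Locally U q := by
  obtain ⟨S, hS, hp⟩ := hp
  choose T hT hq using fun (V : C) (f : V ⟶ U) (hf : S f) => h V f (hp V f hf)
  refine ⟨Sieve.bind S.arrows T, J.bind_covering hS (fun {Y f} H => hT Y f H), ?_⟩
  rintro V _ ⟨W, g, f, hf, hg, rfl⟩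
  exact hq W f hf V g hg

lemma Locally.forall_finite {ι : Type*} [Finite ι] {p : ι → ∀ V : C, (V ⟶ U) → Prop}
    (h : ∀ i, J.Locally U (p i)) : J.Locally U (fun V f => ∀ i, p i V f) := by
  choose S hS hp using h
  have key : ∀ s : Set ι, s.Finite → ∃ T ∈ J U, ∀ i ∈ s, T ≤ S i := by
    intro s hs
    induction s, hs using Set.Finite.induction_on with
    | empty => exact ⟨⊤, J.top_mem U, by simp⟩
    | @insert a s _ _ ih =>
      obtain ⟨T, hT, h⟩ := ih
      refine ⟨S a ⊓ T, J.intersection_covering (hS a) hT, ?_⟩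
      rintro i (rfl | hi)
      · exact inf_le_left
      · exact inf_le_right.trans (h i hi)
  obtain ⟨T, hT, h⟩ := key Set.univ Set.finite_univ
  exact ⟨T, hT, fun V f hf i => hp i V f (h i (Set.mem_univ i) _ hf)⟩

variable {D : Type u} [Category.{v} D] {K : GrothendieckTopology D}

/-- This is the cover-lifting property of `F`. Generators, relations and exactness all pass to slice
sites through it. -/
lemma Locally.of_cocontinuous (F : D ⥤ C) [F.IsCocontinuous K J] {Y : D}
    {p : ∀ V : C, (V ⟶ F.obj Y) → Prop} (hp : J.Locally (F.obj Y) p) :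
    K.Locally Y (fun Z f => p (F.obj Z) (F.map f)) := by
  obtain ⟨S, hS, hp⟩ := hp
  exact ⟨S.functorPullback F, F.cover_lift K J hS, fun Z f hf => hp _ _ hf⟩

lemma Locally.of_over {X : C} {Y : Over X} {p : ∀ V : C, (V ⟶ Y.left) → Prop}
    (hp : (J.over X).Locally Y (fun Z f => p Z.left f.left)) : J.Locally Y.left p := by
  obtain ⟨S, hS, hp⟩ := hp
  refine ⟨Sieve.overEquiv Y S, (J.mem_over_iff S).1 hS, fun V f hf => ?_⟩
  exact hp _ _ ((Sieve.overEquiv_iff _ _).1 hf)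

end CategoryTheory.GrothendieckTopology

open CategoryTheory.GrothendieckTopology

/-! ### Sections of sheaves of modules -/

section Site

variable {C : Type u} [SmallCategory C] {J : GrothendieckTopology C} {R : Sheaf J RingCat.{u}}

namespace SheafOfModules

scoped instance (priority := 5000) hasSheafifyAb : HasSheafify J AddCommGrpCat.{u} := inferInstance

scoped instance (priority := 5000) hasWeakSheafifyAb : HasWeakSheafify J AddCommGrpCat.{u} :=
  inferInstance

scoped instance (priority := 5000) wEqualsLocallyBijectiveAb :
    J.WEqualsLocallyBijective AddCommGrpCat.{u} := inferInstance

end SheafOfModules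

open SheafOfModules

/-- The ring of sections over `U`. -/
abbrev CategoryTheory.Sheaf.RSec (R : Sheaf J RingCat.{u}) (U : C) : Type u := R.obj.obj (op U)

/-- The restriction of sections of a sheaf of rings. -/
def CategoryTheory.Sheaf.rres (R : Sheaf J RingCat.{u}) {U V : C} (f : V ⟶ U) :
    R.RSec U →+* R.RSec V := (R.obj.map f.op).hom

lemma CategoryTheory.Sheaf.rres_comp (R : Sheaf J RingCat.{u}) {U V W : C} (f : V ⟶ U) (g : W ⟶ V)
    (r : R.RSec U) : R.rres g (R.rres f r) = R.rres (g ≫ f) r := by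
  simp [Sheaf.rres]

lemma CategoryTheory.Sheaf.rres_id (R : Sheaf J RingCat.{u}) {U : C} (r : R.RSec U) :
    R.rres (𝟙 U) r = r := by
  simp [Sheaf.rres]

namespace SheafOfModules

/-- The module of sections over `U`. -/
abbrev Sec (M : SheafOfModules.{u} R) (U : C) : Type u := M.val.obj (op U)

/-- The restriction of sections of a sheaf of modules. -/
def res (M : SheafOfModules.{u} R) {U V : C} (f : V ⟶ U) : M.Sec U →+ M.Sec V where
  toFun m := M.val.map f.op m
  map_zero' := map_zero _
  map_add' := map_add _

lemma res_smul (M : SheafOfModules.{u} R) {U V : C} (f : V ⟶ U) (r : R.RSec U) (m : M.Sec U) :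
    M.res f (r • m) = R.rres f r • M.res f m :=
  M.val.map_smul f.op r m

lemma res_comp (M : SheafOfModules.{u} R) {U V W : C} (f : V ⟶ U) (g : W ⟶ V) (m : M.Sec U) :
    M.res g (M.res f m) = M.res (g ≫ f) m := by
  change _ = M.val.presheaf.map (g ≫ f).op m
  rw [op_comp, Functor.map_comp]
  rfl

lemma res_id (M : SheafOfModules.{u} R) {U : C} (m : M.Sec U) : M.res (𝟙 U) m = m := by
  change M.val.presheaf.map (𝟙 _) m = m
  rw [CategoryTheory.Functor.map_id]
  rfl

/-- The additive map on sections induced by a morphism. -/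
def ev {M N : SheafOfModules.{u} R} (φ : M ⟶ N) (U : C) : M.Sec U →ₗ[R.RSec U] N.Sec U :=
  (φ.val.app (op U)).hom

lemma ev_res {M N : SheafOfModules.{u} R} (φ : M ⟶ N) {U V : C} (f : V ⟶ U) (m : M.Sec U) :
    ev φ V (M.res f m) = N.res f (ev φ U m) :=
  PresheafOfModules.naturality_apply φ.val f.op m

lemma ev_comp {M N P : SheafOfModules.{u} R} (φ : M ⟶ N) (ψ : N ⟶ P) (U : C) (m : M.Sec U) :
    ev (φ ≫ ψ) U m = ev ψ U (ev φ U m) := rfl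

lemma ev_id (M : SheafOfModules.{u} R) (U : C) (m : M.Sec U) : ev (𝟙 M) U m = m := rfl

lemma ev_zero (M N : SheafOfModules.{u} R) (U : C) (m : M.Sec U) : ev (0 : M ⟶ N) U m = 0 := rfl

lemma hom_ext_ev {M N : SheafOfModules.{u} R} {φ ψ : M ⟶ N} (h : ∀ U m, ev φ U m = ev ψ U m) :
    φ = ψ := by
  ext U m
  exact h U.unop m

lemma sec_separated (M : SheafOfModules.{u} R) {U : C} {m m' : M.Sec U}
    (h : J.Locally U fun V f => M.res f m = M.res f m') : m = m' := by
  obtain ⟨S, hS, h⟩ := h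
  exact M.isSheaf.isSeparated _ S hS m m' fun Y f hf => h Y f hf

lemma sec_zero_of_locally (M : SheafOfModules.{u} R) {U : C} {m : M.Sec U}
    (h : J.Locally U fun V f => M.res f m = 0) : m = 0 :=
  M.sec_separated (h.mono fun _ _ hf => by rw [hf, map_zero])

/-- Gluing of sections of a presheaf of abelian groups. -/
lemma _root_.CategoryTheory.Presheaf.isSheaf_of_glue (F : Cᵒᵖ ⥤ AddCommGrpCat.{u})
    (sep : ∀ (U : C) (m : F.obj (op U)), J.Locally U (fun _ f => F.map f.op m = 0) → m = 0)
    (glue : ∀ (U : C), ∀ S ∈ J U, ∀ x : ∀ (V : C) (f : V ⟶ U), S f → F.obj (op V),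
      (∀ (V W : C) (f : V ⟶ U) (g : W ⟶ V) (hf : S f),
        F.map g.op (x V f hf) = x W (g ≫ f) (S.downward_closed hf g)) →
      ∃ t : F.obj (op U), ∀ (V : C) (f : V ⟶ U) (hf : S f), F.map f.op t = x V f hf) :
    Presheaf.IsSheaf J F := by
  rw [Presheaf.isSheaf_iff_isSheaf_forget J F (CategoryTheory.forget AddCommGrpCat),
    isSheaf_iff_isSheaf_of_type]
  intro U S hS x hx
  rw [Presieve.compatible_iff_sieveCompatible] at hx
  obtain ⟨t, ht⟩ := glue U S hS (fun V f hf => x f hf)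
    (fun V W f g hf => (hx f g hf).symm)
  refine ⟨t, fun V f hf => ht V f hf, fun t' ht' => ?_⟩
  refine sub_eq_zero.1 (sep U (t' - t : F.obj (op U)) ⟨S, hS, fun V f hf => ?_⟩)
  refine ((F.map f.op).hom.map_sub t' t).trans (sub_eq_zero.2 ?_)
  exact (ht' f hf).trans (ht V f hf).symm

lemma sec_glue (M : SheafOfModules.{u} R) {U : C} {S : Sieve U} (hS : S ∈ J U)
    (x : ∀ (V : C) (f : V ⟶ U), S f → M.Sec V)
    (hx : ∀ (V W : C) (f : V ⟶ U) (g : W ⟶ V) (hf : S f),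
        M.res g (x V f hf) = x W (g ≫ f) (S.downward_closed hf g)) :
    ∃ t : M.Sec U, ∀ (V : C) (f : V ⟶ U) (hf : S f), M.res f t = x V f hf := by
  have h := M.isSheaf
  rw [Presheaf.isSheaf_iff_isSheaf_forget J _ (CategoryTheory.forget AddCommGrpCat),
    isSheaf_iff_isSheaf_of_type] at h
  obtain ⟨t, ht, -⟩ := h S hS (fun V f hf => x V f hf)
    ((Presieve.compatible_iff_sieveCompatible _).2 fun V W f g hf => (hx V W f g hf).symm)
  exact ⟨t, fun V f hf => ht f hf⟩

/-- A subsheaf of modules, given by submodules of the modules of sections. -/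
structure SubFamily (M : SheafOfModules.{u} R) where
  obj : ∀ U : C, Submodule (R.RSec U) (M.Sec U)
  res_mem : ∀ {U V : C} (f : V ⟶ U) {m : M.Sec U}, m ∈ obj U → M.res f m ∈ obj V
  local_mem : ∀ {U : C} {m : M.Sec U}, J.Locally U (fun V f => M.res f m ∈ obj V) → m ∈ obj U

namespace SubFamily

variable {M : SheafOfModules.{u} R} (N : M.SubFamily)

/-- The presheaf of modules underlying a subsheaf. -/
def presub : M.val.Submodule where
  obj X := N.obj X.unop
  map f _ hm := N.res_mem f.unop hm

/-- The sheaf of modules associated with a subsheaf. -/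
def sheaf : SheafOfModules.{u} R where
  val := N.presub.toPresheafOfModules
  isSheaf := by
    refine Presheaf.isSheaf_of_glue _ (fun U m hm => ?_) (fun U S hS x hx => ?_)
    · exact Subtype.ext (M.sec_zero_of_locally
        (hm.mono fun V f hf => congr_arg Subtype.val hf))
    · obtain ⟨t, ht⟩ := M.sec_glue hS (fun V f hf => (x V f hf).1)
        (fun V W f g hf => congr_arg Subtype.val (hx V W f g hf))
      refine ⟨⟨t, N.local_mem ⟨S, hS, fun V f hf => ?_⟩⟩, fun V f hf => Subtype.ext (ht V f hf)⟩
      change M.res f t ∈ N.obj V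
      rw [ht V f hf]
      exact (x V f hf).2

/-- The inclusion of a subsheaf. -/
def incl : N.sheaf ⟶ M where
  val := N.presub.ι

instance : Mono N.incl :=
  (SheafOfModules.forget R).mono_of_mono_map (inferInstanceAs (Mono N.presub.ι))

lemma ev_incl_mem {U : C} (m : N.sheaf.Sec U) : ev N.incl U m ∈ N.obj U := m.2

lemma ev_incl_injective (U : C) : Function.Injective (ev N.incl U) := Subtype.val_injective

lemma exists_ev_incl {U : C} {m : M.Sec U} (hm : m ∈ N.obj U) :
    ∃ n : N.sheaf.Sec U, ev N.incl U n = m := ⟨⟨m, hm⟩, rfl⟩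

/-- The factorization of a morphism through a subsheaf. -/
def lift {P : SheafOfModules.{u} R} (φ : P ⟶ M) (h : ∀ U m, ev φ U m ∈ N.obj U) : P ⟶ N.sheaf where
  val :=
    { app X := ModuleCat.ofHom ((ev φ X.unop).codRestrict (N.obj X.unop) (h X.unop))
      naturality {X Y} f := by
        ext m
        exact Subtype.ext (ev_res φ f.unop m) }

lemma lift_incl {P : SheafOfModules.{u} R} (φ : P ⟶ M) (h : ∀ U m, ev φ U m ∈ N.obj U) :
    N.lift φ h ≫ N.incl = φ := rfl

end SubFamily

/-- The inclusion of sheaves into presheaves preserves monomorphisms, and for presheaves these are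
tested objectwise. No localization is needed, unlike for epimorphisms. -/
lemma ev_injective {M N : SheafOfModules.{u} R} (φ : M ⟶ N) [Mono φ] (U : C) :
    Function.Injective (ev φ U) := by
  have : Mono ((SheafOfModules.forget R).map φ) := inferInstance
  exact PresheafOfModules.injective_of_mono ((SheafOfModules.forget R).map φ) (op U)

lemma mono_of_ev {M N : SheafOfModules.{u} R} (φ : M ⟶ N) (h : ∀ U m, ev φ U m = 0 → m = 0) :
    Mono φ := by
  refine Preadditive.mono_of_cancel_zero _ fun {P} g hg => hom_ext_ev fun U m => ?_
  refine h U _ ?_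
  rw [← ev_comp, hg]
  rfl

/-- The image of a morphism, as a subsheaf. -/
def imFamily {M N : SheafOfModules.{u} R} (φ : M ⟶ N) : N.SubFamily where
  obj U :=
    { carrier := {n | J.Locally U fun V f => ∃ m, ev φ V m = N.res f n}
      zero_mem' := .of_forall fun V f => ⟨0, by simp⟩
      add_mem' := fun {a b} ha hb => (ha.and hb).mono (by
        rintro V f ⟨⟨x, hx⟩, ⟨y, hy⟩⟩
        exact ⟨x + y, by simp [hx, hy]⟩)
      smul_mem' := fun r a ha => ha.mono (by
        rintro V f ⟨x, hx⟩
        exact ⟨R.rres f r • x, by rw [map_smul, hx, res_smul]⟩) }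
  res_mem {_ _} f {m} hm := (hm.pullback f).mono (by
    rintro V g ⟨x, hx⟩
    exact ⟨x, by rw [hx, res_comp]⟩)
  local_mem {U m} hm := hm.bind (by
    intro V f hf
    refine Locally.mono hf ?_
    rintro W g ⟨x, hx⟩
    exact ⟨x, by rw [hx, res_comp]⟩)

/-- The inclusion of the image subsheaf is a monomorphism, and it is an epimorphism because `φ`
factors through it; in an abelian category it is then an isomorphism. -/
lemma exists_ev_of_epi {M N : SheafOfModules.{u} R} (φ : M ⟶ N) [Epi φ] {U : C} (n : N.Sec U) :
    J.Locally U fun V f => ∃ m, ev φ V m = N.res f n := by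
  let I := imFamily φ
  have hI : ∀ U m, ev φ U m ∈ I.obj U := fun U m =>
    .of_forall fun V f => ⟨M.res f m, ev_res _ _ _⟩
  have : Epi (I.lift φ hI ≫ I.incl) := by rw [I.lift_incl]; infer_instance
  have : Epi I.incl := epi_of_epi (I.lift φ hI) I.incl
  have : IsIso I.incl := isIso_of_mono_of_epi _
  have e : ev I.incl U (ev (inv I.incl) U n) = n := by
    rw [← ev_comp, IsIso.inv_hom_id, ev_id]
  have := I.ev_incl_mem (ev (inv I.incl) U n)
  rwa [e] at this

lemma epi_of_ev {M N : SheafOfModules.{u} R} (φ : M ⟶ N)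
    (h : ∀ U (n : N.Sec U), J.Locally U fun V f => ∃ m, ev φ V m = N.res f n) : Epi φ := by
  refine Preadditive.epi_of_cancel_zero _ fun {P} g hg => hom_ext_ev fun U n => ?_
  refine P.sec_zero_of_locally ((h U n).mono ?_)
  rintro V f ⟨m, hm⟩
  rw [← ev_res, ← hm, ← ev_comp, hg]
  rfl

/-- The kernel of a morphism, as a subsheaf. -/
def kerFamily {M N : SheafOfModules.{u} R} (φ : M ⟶ N) : M.SubFamily where
  obj U := LinearMap.ker (ev φ U)
  res_mem {_ _} f {m} hm := by
    rw [LinearMap.mem_ker] at hm ⊢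
    rw [ev_res, hm, map_zero]
  local_mem {U m} hm := by
    refine N.sec_zero_of_locally (hm.mono fun V f hf => ?_)
    rwa [← ev_res]

lemma exists_ev_kernel {M N : SheafOfModules.{u} R} (φ : M ⟶ N) {U : C} {m : M.Sec U}
    (hm : ev φ U m = 0) : ∃ k, ev (kernel.ι φ) U k = m := by
  let K := kerFamily φ
  let l : K.sheaf ⟶ kernel φ := kernel.lift φ K.incl (hom_ext_ev fun U m => K.ev_incl_mem m)
  obtain ⟨n, hn⟩ := K.exists_ev_incl (U := U) (m := m) hm
  refine ⟨ev l U n, ?_⟩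
  rw [← ev_comp, kernel.lift_ι, hn]

lemma ev_kernel {M N : SheafOfModules.{u} R} (φ : M ⟶ N) {U : C} (k : (kernel φ).Sec U) :
    ev φ U (ev (kernel.ι φ) U k) = 0 := by
  rw [← ev_comp, kernel.condition]
  rfl

lemma exists_ev_of_exact {E : ShortComplex (SheafOfModules.{u} R)} (hE : E.Exact) {U : C}
    {m : E.X₂.Sec U} (hm : ev E.g U m = 0) :
    J.Locally U fun V f => ∃ x, ev E.f V x = E.X₂.res f m := by
  obtain ⟨k, hk⟩ := exists_ev_kernel E.g hm
  have : Epi (kernel.lift E.g E.f E.zero) := hE.epi_kernelLift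
  refine (exists_ev_of_epi (kernel.lift E.g E.f E.zero) k).mono ?_
  rintro V f ⟨x, hx⟩
  refine ⟨x, ?_⟩
  rw [← hk, ← ev_res, ← hx, ← ev_comp, kernel.lift_ι]

lemma exact_of_ev (E : ShortComplex (SheafOfModules.{u} R))
    (h : ∀ U (m : E.X₂.Sec U), ev E.g U m = 0 →
      J.Locally U fun V f => ∃ x, ev E.f V x = E.X₂.res f m) : E.Exact := by
  rw [E.exact_iff_epi_kernel_lift]
  refine epi_of_ev _ fun U k => (h U _ (ev_kernel E.g k)).mono ?_
  rintro V f ⟨x, hx⟩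
  refine ⟨x, ev_injective (kernel.ι E.g) V ?_⟩
  rw [← ev_comp, kernel.lift_ι, hx, ev_res]

lemma exists_ev_of_cokernel {M N : SheafOfModules.{u} R} (φ : M ⟶ N) {U : C} {n : N.Sec U}
    (hn : ev (cokernel.π φ) U n = 0) : J.Locally U fun V f => ∃ m, ev φ V m = N.res f n :=
  exists_ev_of_exact (E := ShortComplex.mk φ (cokernel.π φ) (cokernel.condition φ))
    (ShortComplex.exact_cokernel φ) hn

lemma ev_cokernel {M N : SheafOfModules.{u} R} (φ : M ⟶ N) {U : C} (m : M.Sec U) :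
    ev (cokernel.π φ) U (ev φ U m) = 0 := by
  rw [← ev_comp, cokernel.condition]
  rfl

end SheafOfModules

end Site
end

noncomputable section
open CategoryTheory.GrothendieckTopology

/-! ### Elementwise description of coherent modules -/

namespace SheafOfModules

section Site

variable {C : Type u} [SmallCategory C] {J : GrothendieckTopology C} {R : Sheaf J RingCat.{u}}

/-- The sections `s` over `U` generate `M` over `U`. -/
def Gen (M : SheafOfModules.{u} R) {U : C} {ι : Type*} [Fintype ι] (s : ι → M.Sec U) : Prop :=
  ∀ (V : C) (f : V ⟶ U) (m : M.Sec V), J.Locally V fun W g =>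
    ∃ a : ι → R.RSec W, M.res g m = ∑ i, a i • M.res (g ≫ f) (s i)

/-- The relations `r` over `U` generate the module of relations between the sections `s`. -/
def RelGen (M : SheafOfModules.{u} R) {U : C} {ι κ : Type*} [Fintype ι] [Fintype κ]
    (s : ι → M.Sec U) (r : κ → ι → R.RSec U) : Prop :=
  (∀ k, ∑ i, r k i • s i = 0) ∧ ∀ (V : C) (f : V ⟶ U) (a : ι → R.RSec V),
    ∑ i, a i • M.res f (s i) = 0 → J.Locally V fun W g =>
      ∃ b : κ → R.RSec W, ∀ i, R.rres g (a i) = ∑ k, b k * R.rres (g ≫ f) (r k i)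

/-- `M` is locally finitely generated. -/
def LFG (M : SheafOfModules.{u} R) : Prop :=
  ∀ U : C, J.Locally U fun V _ => ∃ (n : ℕ) (s : Fin n → M.Sec V), M.Gen s

/-- The modules of relations between finitely many sections of `M` are locally finitely
generated. -/
def RelFG (M : SheafOfModules.{u} R) : Prop :=
  ∀ (U : C) (n : ℕ) (s : Fin n → M.Sec U), J.Locally U fun V f =>
    ∃ (p : ℕ) (r : Fin p → Fin n → R.RSec V), M.RelGen (fun i => M.res f (s i)) r

variable {M : SheafOfModules.{u} R} {U : C} {ι κ : Type*} [Fintype ι] [Fintype κ]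

lemma res_sum_smul {V : C} (f : V ⟶ U) (a : ι → R.RSec U) (s : ι → M.Sec U) :
    M.res f (∑ i, a i • s i) = ∑ i, R.rres f (a i) • M.res f (s i) := by
  simp only [map_sum, res_smul]

lemma Gen.res {s : ι → M.Sec U} (hs : M.Gen s) {V : C} (f : V ⟶ U) :
    M.Gen (fun i => M.res f (s i)) := fun _ g m =>
  (hs _ (g ≫ f) m).mono fun Z h ⟨a, ha⟩ => ⟨a, by simp only [ha, res_comp, Category.assoc]⟩

lemma RelGen.res {s : ι → M.Sec U} {r : κ → ι → R.RSec U} (hr : M.RelGen s r) {V : C}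
    (f : V ⟶ U) : M.RelGen (fun i => M.res f (s i)) (fun k i => R.rres f (r k i)) := by
  refine ⟨fun k => by rw [← res_sum_smul, hr.1, map_zero], fun W g a ha => ?_⟩
  refine (hr.2 W (g ≫ f) a (by simpa only [res_comp] using ha)).mono fun Z h ⟨b, hb⟩ =>
    ⟨b, fun i => ?_⟩
  simp only [hb, Sheaf.rres_comp, Category.assoc]

lemma Gen.reindex {s : ι → M.Sec U} (hs : M.Gen s) {ι' : Type*} [Fintype ι'] (e : ι' ≃ ι) :
    M.Gen (s ∘ e) := fun V f m =>
  (hs V f m).mono fun W g ⟨a, ha⟩ => ⟨a ∘ e, ha.trans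
    (Fintype.sum_equiv e (fun i => (a ∘ e) i • M.res (g ≫ f) ((s ∘ e) i))
      (fun i => a i • M.res (g ≫ f) (s i)) fun _ => rfl).symm⟩

lemma RelGen.reindex {s : ι → M.Sec U} {r : κ → ι → R.RSec U} (hr : M.RelGen s r)
    {ι' κ' : Type*} [Fintype ι'] [Fintype κ'] (e : ι' ≃ ι) (e' : κ' ≃ κ) :
    M.RelGen (s ∘ e) (fun k i => r (e' k) (e i)) := by
  refine ⟨fun k => (Fintype.sum_equiv e _ (fun i => r (e' k) i • s i) fun _ => rfl).trans
    (hr.1 (e' k)), fun V f a ha => ?_⟩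
  have h0 : ∑ i, (a ∘ e.symm) i • M.res f (s i) = 0 :=
    (Fintype.sum_equiv e (fun i => a i • M.res f ((s ∘ e) i))
      (fun i => (a ∘ e.symm) i • M.res f (s i)) fun _ => by simp).symm.trans ha
  refine (hr.2 V f (a ∘ e.symm) h0).mono fun W g ⟨b, hb⟩ => ⟨b ∘ e', fun i => ?_⟩
  have := hb (e i)
  simp only [Function.comp, e.symm_apply_apply] at this
  exact this.trans (Fintype.sum_equiv e' (fun k => (b ∘ e') k * R.rres (g ≫ f) (r (e' k) (e i)))
      (fun k => b k * R.rres (g ≫ f) (r k (e i))) fun _ => rfl).symm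

lemma LFG.of_gen (h : ∀ U : C, J.Locally U fun V _ =>
    ∃ (ι : Type) (_ : Fintype ι) (s : ι → M.Sec V), M.Gen s) : M.LFG := fun U =>
  (h U).mono fun _ _ ⟨ι, _, s, hs⟩ => ⟨Fintype.card ι, s ∘ (Fintype.equivFin ι).symm,
    hs.reindex (Fintype.equivFin ι).symm⟩

lemma RelFG.exists_relGen (h : M.RelFG) {ι : Type*} [Fintype ι] (s : ι → M.Sec U) :
    J.Locally U fun V f => ∃ (p : ℕ) (r : Fin p → ι → R.RSec V),
      M.RelGen (fun i => M.res f (s i)) r := by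
  refine (h U (Fintype.card ι) (s ∘ (Fintype.equivFin ι).symm)).mono fun V f ⟨p, r, hr⟩ =>
    ⟨p, fun k i => r k (Fintype.equivFin ι i), ?_⟩
  have := hr.reindex (Fintype.equivFin ι) (Equiv.refl (Fin p))
  simpa [Function.comp_def] using this

lemma RelFG.of_relGen (h : ∀ (U : C) (n : ℕ) (s : Fin n → M.Sec U), J.Locally U fun V f =>
    ∃ (κ : Type) (_ : Fintype κ) (r : κ → Fin n → R.RSec V),
      M.RelGen (fun i => M.res f (s i)) r) : M.RelFG := fun U n s =>
  (h U n s).mono fun _ _ ⟨κ, _, r, hr⟩ => ⟨Fintype.card κ,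
    fun k => r ((Fintype.equivFin κ).symm k),
    hr.reindex (Equiv.refl (Fin n)) (Fintype.equivFin κ).symm⟩

/-- Relations between one system of generators give relations between any other system. -/
lemma RelGen.change {t : ι → M.Sec U} {r : κ → ι → R.RSec U} (hr : M.RelGen t r)
    {ι' : Type*} [Fintype ι'] [DecidableEq ι'] {s : ι' → M.Sec U}
    {a : ι → ι' → R.RSec U} (ha : ∀ i, t i = ∑ j, a i j • s j)
    {b : ι' → ι → R.RSec U} (hb : ∀ j, s j = ∑ i, b j i • t i) :
    M.RelGen s (Sum.elim (fun j l => (if j = l then 1 else 0) - ∑ i, b j i * a i l)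
      (fun k l => ∑ i, r k i * a i l)) := by
  have key : ∀ (V : C) (f : V ⟶ U) (c : ι → R.RSec V), ∑ l, (∑ i, c i * R.rres f (a i l)) •
      M.res f (s l) = ∑ i, c i • M.res f (t i) := by
    intro V f c
    simp only [ha, res_sum_smul, Finset.smul_sum, Finset.sum_smul, smul_smul]
    exact Finset.sum_comm
  have key' : ∀ c : ι → R.RSec U, ∑ l, (∑ i, c i * a i l) • s l = ∑ i, c i • t i := fun c => by
    have := key U (𝟙 U) c
    simpa only [Sheaf.rres_id, res_id] using this
  refine ⟨?_, fun V f c hc => ?_⟩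
  · rintro (j | k)
    · simp only [Sum.elim_inl, sub_smul, Finset.sum_sub_distrib, key', ← hb, ite_smul, one_smul,
        zero_smul, Finset.sum_ite_eq, Finset.mem_univ, if_true, sub_self]
    · simp only [Sum.elim_inr, key', hr.1]
  -- Substituting `s = b t`, a relation `c` between the `s` becomes a relation `c b` between the
  -- `t`, so `c b = d r` locally. Then `c = c (1 - b a) + (c b) a = c (1 - b a) + d (r a)`, which
  -- explains the two blocks of relations.
  · have h0 : ∑ i, (∑ j, c j * R.rres f (b j i)) • M.res f (t i) = 0 := by
      rw [← hc]
      simp only [hb, res_sum_smul, Finset.smul_sum, Finset.sum_smul, smul_smul]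
      rw [Finset.sum_comm]
    refine (hr.2 V f _ h0).mono fun W g ⟨d, hd⟩ =>
      ⟨Sum.elim (fun j => R.rres g (c j)) d, fun l => ?_⟩
    simp only [Fintype.sum_sum_type, Sum.elim_inl, Sum.elim_inr, map_sub, map_sum, map_mul,
      mul_sub, Finset.sum_sub_distrib]
    have e1 : ∑ j, R.rres g (c j) * R.rres (g ≫ f) (if j = l then 1 else 0) =
        R.rres g (c l) := by
      simp only [apply_ite (R.rres (g ≫ f)), map_one, map_zero, mul_ite, mul_one, mul_zero,
        Finset.sum_ite_eq', Finset.mem_univ, if_true]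
    have e2 : ∑ k, d k * ∑ i, R.rres (g ≫ f) (r k i) * R.rres (g ≫ f) (a i l) =
        ∑ i, (∑ j, R.rres g (c j) * R.rres (g ≫ f) (b j i)) * R.rres (g ≫ f) (a i l) := by
      have hd' : ∀ i, ∑ j, R.rres g (c j) * R.rres (g ≫ f) (b j i) =
          ∑ k, d k * R.rres (g ≫ f) (r k i) := fun i => by
        rw [← hd i]
        simp only [map_sum, map_mul, Sheaf.rres_comp]
      simp only [hd', Finset.mul_sum, Finset.sum_mul, mul_assoc]
      exact Finset.sum_comm
    rw [e1, e2]
    simp only [Finset.mul_sum, Finset.sum_mul, mul_assoc]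
    rw [Finset.sum_comm, sub_add_cancel]

/-! ### Pushforward along a cocontinuous functor -/

section Pushforward

variable {D : Type u} [SmallCategory D] {K : GrothendieckTopology D} (F : D ⥤ C)
  [F.IsContinuous K J] [F.IsCocontinuous K J] {S : Sheaf K RingCat.{u}}
  (φ : S ⟶ (F.sheafPushforwardContinuous RingCat.{u} K J).obj R)
  (hφ : ∀ Y : D, Function.Bijective (φ.hom.app (op Y)).hom)

/-- The ring morphism on sections given by `φ`. -/
def ringApp (Y : D) : S.RSec Y →+* R.RSec (F.obj Y) := (φ.hom.app (op Y)).hom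

omit [F.IsCocontinuous K J] in
lemma ringApp_rres {Y Z : D} (f : Z ⟶ Y) (a : S.RSec Y) :
    ringApp F φ Z (S.rres f a) = R.rres (F.map f) (ringApp F φ Y a) :=
  congr($(φ.hom.naturality f.op) a)

omit [F.IsCocontinuous K J] in
lemma pushforward_sum {Y : D} (a : ι → S.RSec Y) (s : ι → M.Sec (F.obj Y)) :
    (∑ i, a i • (show ((pushforward φ).obj M).Sec Y from s i) :
      ((pushforward φ).obj M).Sec Y) = (∑ i, ringApp F φ Y (a i) • s i : M.Sec (F.obj Y)) := rfl

include hφ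

/-- Cocontinuity of `F` carries the coverings, and surjectivity of `φ` carries the coefficients. For
relations, injectivity of `φ` is used as well. -/
lemma Gen.pushforward {Y : D} {s : ι → M.Sec (F.obj Y)} (hs : M.Gen s) :
    ((pushforward φ).obj M).Gen (U := Y) s := by
  intro Z f m
  refine ((hs (F.obj Z) (F.map f) m).of_cocontinuous (K := K) F).mono fun W g ⟨a, ha⟩ => ?_
  choose a' ha' using fun i => (hφ W).2 (a i)
  refine ⟨a', ?_⟩
  refine (Eq.trans ha ?_).trans (pushforward_sum F φ (M := M) a' _).symm
  refine Finset.sum_congr rfl fun i _ => ?_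
  change a i • _ = ringApp F φ W (a' i) • M.res (F.map (g ≫ f)) (s i)
  rw [F.map_comp, ← ha' i]
  rfl

lemma RelGen.pushforward {Y : D} {s : ι → M.Sec (F.obj Y)} {r : κ → ι → R.RSec (F.obj Y)}
    (hr : M.RelGen s r) {r' : κ → ι → S.RSec Y} (hr' : ∀ k i, ringApp F φ Y (r' k i) = r k i) :
    ((pushforward φ).obj M).RelGen (U := Y) s r' := by
  refine ⟨fun k => (pushforward_sum F φ (M := M) (r' k) s).trans ?_, fun Z f a ha => ?_⟩
  · simp only [hr']
    exact hr.1 k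
  · have ha' := (pushforward_sum F φ (M := M) a (fun i => M.res (F.map f) (s i))).symm.trans ha
    refine ((hr.2 (F.obj Z) (F.map f) _ ha').of_cocontinuous (K := K) F).mono
      fun W g ⟨b, hb⟩ => ?_
    choose b' hb' using fun i => (hφ W).2 (b i)
    refine ⟨b', fun i => (hφ W).1 ?_⟩
    change ringApp F φ W _ = ringApp F φ W _
    simp only [map_sum, map_mul, ringApp_rres, F.map_comp, hr']
    rw [hb i]
    exact Finset.sum_congr rfl fun k _ => congr_arg (· * _) (hb' k).symm

lemma LFG.pushforward (hM : M.LFG) : ((pushforward φ).obj M).LFG := fun Y =>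
  ((hM (F.obj Y)).of_cocontinuous (K := K) F).mono fun _ _ ⟨n, s, hs⟩ =>
    ⟨n, s, hs.pushforward F φ hφ⟩

lemma RelFG.pushforward (hM : M.RelFG) : ((pushforward φ).obj M).RelFG := fun Y n s =>
  ((hM (F.obj Y) n s).of_cocontinuous (K := K) F).mono fun Z f ⟨p, r, hr⟩ => by
    choose r' hr' using fun k i => (hφ Z).2 (r k i)
    exact ⟨p, r', hr.pushforward F φ hφ hr'⟩

end Pushforward

section Over

lemma Gen.over {X : C} {Y : Over X} {s : ι → M.Sec Y.left} (hs : M.Gen s) :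
    (M.over X).Gen (U := Y) s :=
  hs.pushforward (Over.forget X) (𝟙 (R.over X)) (fun _ => Function.bijective_id)

lemma RelGen.over {X : C} {Y : Over X} {s : ι → M.Sec Y.left} {r : κ → ι → R.RSec Y.left}
    (hr : M.RelGen s r) : (M.over X).RelGen (U := Y) s r :=
  hr.pushforward (Over.forget X) (𝟙 (R.over X)) (fun _ => Function.bijective_id) fun _ _ => rfl

lemma LFG.over (hM : M.LFG) (X : C) : (M.over X).LFG :=
  hM.pushforward (Over.forget X) (𝟙 (R.over X)) (fun _ => Function.bijective_id)

lemma RelFG.over (hM : M.RelFG) (X : C) : (M.over X).RelFG :=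
  hM.pushforward (Over.forget X) (𝟙 (R.over X)) (fun _ => Function.bijective_id)

lemma Gen.of_over {X : C} {Y : Over X} {s : ι → M.Sec Y.left}
    (hs : (M.over X).Gen (U := Y) s) : M.Gen s := fun V f m =>
  Locally.of_over (Y := Over.mk (f ≫ Y.hom))
    (hs (Over.mk (f ≫ Y.hom)) (Over.homMk f) m)

lemma RelGen.of_over {X : C} {Y : Over X} {s : ι → M.Sec Y.left} {r : κ → ι → R.RSec Y.left}
    (hr : (M.over X).RelGen (U := Y) s r) : M.RelGen s r :=
  ⟨hr.1, fun V f a ha => Locally.of_over (Y := Over.mk (f ≫ Y.hom))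
    (hr.2 (Over.mk (f ≫ Y.hom)) (Over.homMk f) a ha)⟩

end Over

end Site

end SheafOfModules
end

noncomputable section
open CategoryTheory.GrothendieckTopology

namespace SheafOfModules

section Site

variable {C : Type u} [SmallCategory C] {J : GrothendieckTopology C} {R : Sheaf J RingCat.{u}}
  {M : SheafOfModules.{u} R}

/-! ### Generators and epimorphisms from free modules -/

/-- The value of a global section. -/
def secVal (s : M.sections) (U : C) : M.Sec U := s.val (op U)

lemma secVal_res (s : M.sections) {U V : C} (f : V ⟶ U) : M.res f (secVal s U) = secVal s V :=
  s.property f.op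

lemma SubFamily.mem_of_epi (N : M.SubFamily) [Epi N.incl] {U : C} (m : M.Sec U) : m ∈ N.obj U := by
  refine N.local_mem ((exists_ev_of_epi N.incl m).mono ?_)
  rintro V f ⟨x, hx⟩
  rw [← hx]
  exact N.ev_incl_mem x

/-- The subsheaf generated by finitely many sections. -/
def spanFamily {ι : Type*} [Fintype ι] (s : ι → M.sections) : M.SubFamily where
  obj U :=
    { carrier := {m | J.Locally U fun V f => ∃ a : ι → R.RSec V,
        M.res f m = ∑ i, a i • secVal (s i) V}
      zero_mem' := .of_forall fun V f => ⟨0, by simp⟩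
      add_mem' := fun {m n} hm hn => (hm.and hn).mono (by
        rintro V f ⟨⟨a, ha⟩, ⟨b, hb⟩⟩
        exact ⟨a + b, by simp only [map_add, ha, hb, Pi.add_apply, add_smul,
          Finset.sum_add_distrib]⟩)
      smul_mem' := fun r m hm => hm.mono (by
        rintro V f ⟨a, ha⟩
        exact ⟨fun i => R.rres f r * a i, by
          rw [res_smul, ha, Finset.smul_sum]
          simp only [smul_smul]⟩) }
  res_mem {_ _} f {m} hm := (hm.pullback f).mono (by
    rintro V g ⟨a, ha⟩
    exact ⟨a, by rw [res_comp, ha]⟩)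
  local_mem {U m} hm := hm.bind (by
    intro V f hf
    refine Locally.mono hf ?_
    rintro W g ⟨a, ha⟩
    exact ⟨a, by rw [← res_comp, ha]⟩)

lemma section_mem_spanFamily {ι : Type*} [Fintype ι] [DecidableEq ι] (s : ι → M.sections) (i : ι)
    (U : C) : secVal (s i) U ∈ (spanFamily s).obj U :=
  .of_forall fun V f => ⟨Pi.single i 1, by
    rw [Finset.sum_eq_single i (fun j _ hj => by rw [Pi.single_eq_of_ne hj, zero_smul]) (by simp),
      Pi.single_eq_same, one_smul]
    exact secVal_res (s i) f⟩

/-- A section of a subsheaf. -/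
def SubFamily.liftSection (N : M.SubFamily) (s : M.sections)
    (h : ∀ U : C, secVal s U ∈ N.obj U) : N.sheaf.sections :=
  PresheafOfModules.sectionsMk (fun X => (⟨s.val X, h X.unop⟩ : N.obj X.unop))
    (fun _ _ f => Subtype.ext (s.property f))

/-- The epimorphism from the free module factors through the subsheaf spanned by `s`, whose
inclusion is therefore an epimorphism. -/
lemma mem_spanFamily_of_epi {ι : Type u} [Fintype ι] (s : ι → M.sections)
    [Epi (M.freeHomEquiv.symm s)] {U : C} (m : M.Sec U) : m ∈ (spanFamily s).obj U := by
  classical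
  let N := spanFamily s
  let s' : ι → N.sheaf.sections := fun i => N.liftSection (s i) (section_mem_spanFamily s i)
  have e : N.sheaf.freeHomEquiv.symm s' ≫ N.incl = M.freeHomEquiv.symm s :=
    freeHomEquiv_symm_comp s' N.incl
  have : Epi (N.sheaf.freeHomEquiv.symm s' ≫ N.incl) := by rw [e]; infer_instance
  have : Epi N.incl := epi_of_epi (N.sheaf.freeHomEquiv.symm s') N.incl
  exact N.mem_of_epi m

variable (R) in
/-- The basis sections of a free module. -/
def freeBasis {ι : Type u} (i : ι) (U : C) : (free (R := R) ι).Sec U :=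
  secVal (freeSection i) U

lemma freeBasis_res {ι : Type u} (i : ι) {U V : C} (f : V ⟶ U) :
    (free ι).res f (freeBasis R i U) = freeBasis R i V :=
  secVal_res (freeSection i) f

lemma ev_freeBasis {ι : Type u} (s : ι → M.sections) (i : ι) (U : C) :
    ev (M.freeHomEquiv.symm s) U (freeBasis R i U) = secVal (s i) U :=
  congr($(sectionsMap_freeHomEquiv_symm_freeSection s i).val (op U))

lemma exists_freeBasis {ι : Type u} [Fintype ι] {U : C} (x : (free (R := R) ι).Sec U) :
    J.Locally U fun V f => ∃ a : ι → R.RSec V, (free ι).res f x = ∑ i, a i • freeBasis R i V := by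
  have e : (free (R := R) ι).freeHomEquiv.symm freeSection = 𝟙 _ :=
    Equiv.symm_apply_apply _ _
  have : Epi ((free (R := R) ι).freeHomEquiv.symm freeSection) := by rw [e]; infer_instance
  exact mem_spanFamily_of_epi freeSection x

/-- The universal property of the free module provides the coordinate morphisms to `unit R`: `δ`
prescribes the value `1` on the `j`-th basis section and `0` on the others. -/
lemma freeBasis_independent {ι : Type u} [Fintype ι] {U : C} {a b : ι → R.RSec U}
    (h : ∑ i, a i • freeBasis R i U = ∑ i, b i • freeBasis R i U) : a = b := by
  classical
  ext j
  let δ : ι → (unit R).sections := fun i =>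
    if i = j then (unit R).unitHomEquiv (𝟙 _) else (unit R).unitHomEquiv 0
  have hδ : ∀ c : ι → R.RSec U, ev ((unit R).freeHomEquiv.symm δ) U (∑ i, c i • freeBasis R i U)
      = (id (c j) : (unit R).Sec U) := by
    intro c
    rw [map_sum, Finset.sum_eq_single j]
    · rw [map_smul, ev_freeBasis]
      simp only [δ, if_true]
      exact mul_one (c j)
    · intro i _ hij
      rw [map_smul, ev_freeBasis]
      simp only [δ, if_neg hij]
      exact mul_zero (c i)
    · simp
  exact (hδ a).symm.trans ((congr_arg _ h).trans (hδ b))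

lemma epi_freeHomEquiv_symm {ι : Type u} [Fintype ι] (s : ι → M.sections)
    (hs : ∀ (U : C) (m : M.Sec U), m ∈ (spanFamily s).obj U) : Epi (M.freeHomEquiv.symm s) := by
  refine epi_of_ev _ fun U m => (hs U m).mono ?_
  rintro V f ⟨a, ha⟩
  refine ⟨∑ i, a i • freeBasis R i V, ?_⟩
  rw [map_sum, ha]
  simp only [map_smul, ev_freeBasis]

/-! ### Sections over a terminal object -/

/-- The global section given by a section over a terminal object. -/
def topSection {T : C} (hT : IsTerminal T) (m : M.Sec T) : M.sections :=
  PresheafOfModules.sectionsMk (fun X => M.res (hT.from X.unop) m)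
    (fun X Y f => (M.res_comp (hT.from X.unop) f.unop m).trans
      (by rw [hT.hom_ext (f.unop ≫ hT.from X.unop) (hT.from Y.unop)]))

lemma secVal_topSection {T : C} (hT : IsTerminal T) (m : M.Sec T) {U : C} (f : U ⟶ T) :
    secVal (topSection hT m) U = M.res f m := by
  rw [hT.hom_ext f (hT.from U)]
  rfl

lemma Gen.mem_spanFamily {T : C} (hT : IsTerminal T) {ι : Type*} [Fintype ι] {s : ι → M.Sec T}
    (hs : M.Gen s) {U : C} (m : M.Sec U) :
    m ∈ (spanFamily fun i => topSection hT (s i)).obj U := by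
  refine (hs U (hT.from U) m).mono ?_
  rintro V f ⟨a, ha⟩
  exact ⟨a, ha.trans (Finset.sum_congr rfl fun i _ => by rw [secVal_topSection])⟩

lemma gen_of_epi {ι : Type u} [Fintype ι] (s : ι → M.sections) [Epi (M.freeHomEquiv.symm s)]
    (U : C) : M.Gen (fun i => secVal (s i) U) := by
  intro V f m
  refine (mem_spanFamily_of_epi s m).mono ?_
  rintro W g ⟨a, ha⟩
  exact ⟨a, ha.trans (Finset.sum_congr rfl fun i _ => by rw [secVal_res])⟩

/-- The relations between the images of a local basis of `F` under a morphism, when its kernel is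
finitely generated. -/
lemma relGen_of_basis {F K : SheafOfModules.{u} R} {ι κ : Type u} [Fintype ι] [Fintype κ]
    (e : ι → F.sections)
    (span : ∀ {U : C} (x : F.Sec U), J.Locally U fun V f =>
      ∃ a : ι → R.RSec V, F.res f x = ∑ i, a i • secVal (e i) V)
    (indep : ∀ {U : C} {a b : ι → R.RSec U},
      ∑ i, a i • secVal (e i) U = ∑ i, b i • secVal (e i) U → a = b)
    (π : F ⟶ M) (j : K ⟶ F) (hj : j ≫ π = 0)
    (hker : ∀ {U : C} {x : F.Sec U}, ev π U x = 0 → ∃ y, ev j U y = x)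
    (t : κ → K.sections) (ht : ∀ U, K.Gen fun k => secVal (t k) U) (U : C) :
    J.Locally U fun V _ => ∃ r : κ → ι → R.RSec V,
      M.RelGen (fun i => ev π V (secVal (e i) V)) r := by
  let ρ : ∀ (k : κ) (V : C), F.Sec V := fun k V => ev j V (secVal (t k) V)
  have hρ : ∀ k {V W : C} (f : W ⟶ V), F.res f (ρ k V) = ρ k W := by
    intro k V W f
    simp only [ρ]
    rw [← ev_res, secVal_res]
  refine (Locally.forall_finite fun k => span (ρ k U)).mono fun V f h => ?_
  choose r hr using h
  refine ⟨r, fun k => ?_, fun W g a ha => ?_⟩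
  · have : ev π V (F.res f (ρ k U)) = 0 := by
      rw [hρ]
      simp only [ρ]
      rw [← ev_comp, hj, ev_zero]
    rw [hr k, map_sum] at this
    simpa only [map_smul] using this
  · have h0 : ev π W (∑ i, a i • secVal (e i) W) = 0 := by
      rw [map_sum]
      simpa only [map_smul, ← ev_res, secVal_res] using ha
    obtain ⟨y, hy⟩ := hker h0
    refine (ht W W (𝟙 W) y).mono fun Z z ⟨b, hb⟩ => ⟨b, ?_⟩
    have h2 : ∑ i, R.rres z (a i) • secVal (e i) Z =
        ∑ i, (∑ k, b k * R.rres (z ≫ g) (r k i)) • secVal (e i) Z := by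
      have h1 := congr_arg (ev j Z) hb
      rw [ev_res, hy, res_sum_smul, map_sum] at h1
      simp only [map_smul, secVal_res] at h1
      refine h1.trans ?_
      simp only [Finset.sum_smul, mul_smul]
      rw [Finset.sum_comm]
      refine Finset.sum_congr rfl fun k _ => ?_
      rw [← Finset.smul_sum]
      congr 1
      change ρ k Z = _
      rw [← hρ k (z ≫ g), ← hρ k f, hr k, res_sum_smul]
      simp only [secVal_res]
    exact congr_fun (indep h2)

lemma relGen_of_epi {ι κ : Type u} [Fintype ι] [Fintype κ] (s : ι → M.sections)
    (t : κ → (kernel (M.freeHomEquiv.symm s)).sections) [Epi (freeHomEquiv _ |>.symm t)] (U : C) :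
    J.Locally U fun V _ => ∃ r : κ → ι → R.RSec V, M.RelGen (fun i => secVal (s i) V) r := by
  refine (relGen_of_basis freeSection exists_freeBasis freeBasis_independent
    (M.freeHomEquiv.symm s) (kernel.ι _) (kernel.condition _) (exists_ev_kernel _) t
    (gen_of_epi t) U).mono fun V _ ⟨r, hr⟩ => ⟨r, ?_⟩
  have : ∀ i, ev (M.freeHomEquiv.symm s) V (secVal (freeSection i) V) = secVal (s i) V :=
    fun i => ev_freeBasis s i V
  simpa only [this] using hr

lemma Presentation.relGen (P : M.Presentation) [P.IsFinite] (U : C) :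
    J.Locally U fun V _ => ∃ (ι κ : Type u) (_ : Fintype ι) (_ : Fintype κ) (s : ι → M.Sec V)
      (r : κ → ι → R.RSec V), M.Gen s ∧ M.RelGen s r := by
  have : Fintype P.generators.I := Fintype.ofFinite _
  have : Fintype P.relations.I := Fintype.ofFinite _
  have := P.generators.epi
  have := P.relations.epi
  exact (relGen_of_epi P.generators.s P.relations.s U).mono fun V _ ⟨r, hr⟩ =>
    ⟨_, _, _, _, _, r, gen_of_epi P.generators.s V, hr⟩

lemma epi_topSection {T : C} (hT : IsTerminal T) {ι : Type u} [Fintype ι] {s : ι → M.Sec T}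
    (hs : M.Gen s) : Epi (M.freeHomEquiv.symm fun i => topSection hT (s i)) :=
  epi_freeHomEquiv_symm _ fun _ m => hs.mem_spanFamily hT m

lemma Gen.exists_generatingSections {T : C} (hT : IsTerminal T) {n : ℕ}
    {s : Fin n → M.Sec T} (hs : M.Gen s) : ∃ G : M.GeneratingSections, G.IsFiniteType :=
  ⟨⟨ULift.{u} (Fin n), _, epi_topSection hT (hs.reindex Equiv.ulift)⟩,
    ⟨inferInstanceAs (Finite (ULift.{u} (Fin n)))⟩⟩

/-- Generators of the relations between the images of generators generate the kernel. -/
lemma RelGen.gen_kernel {F K : SheafOfModules.{u} R} {T : C} {ι κ : Type*} [Fintype ι] [Fintype κ]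
    {e : ι → F.Sec T} (he : F.Gen e) (π : F ⟶ M) (j : K ⟶ F) [Mono j] (hj : j ≫ π = 0)
    {r : κ → ι → R.RSec T} (hr : M.RelGen (fun i => ev π T (e i)) r)
    {y : κ → K.Sec T} (hy : ∀ k, ev j T (y k) = ∑ i, r k i • e i) : K.Gen y := by
  intro U f m
  refine (he U f (ev j U m)).bind fun V g ⟨a, ha⟩ => ?_
  have h0 : ∑ i, a i • M.res (g ≫ f) (ev π T (e i)) = 0 := by
    have : ev π V (F.res g (ev j U m)) = 0 := by
      rw [ev_res, ← ev_comp, hj, ev_zero, map_zero]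
    rw [ha, map_sum] at this
    simpa only [map_smul, ← ev_res] using this
  refine (hr.2 V (g ≫ f) a h0).mono fun W h ⟨b, hb⟩ => ⟨b, ?_⟩
  refine ev_injective j W ?_
  rw [ev_res, ← res_comp, ha, res_sum_smul, map_sum]
  have e' : ∀ k, ev j W (b k • K.res ((h ≫ g) ≫ f) (y k)) =
      ∑ i, (b k * R.rres (h ≫ g ≫ f) (r k i)) • F.res (h ≫ g ≫ f) (e i) := by
    intro k
    rw [map_smul, ev_res, hy, res_sum_smul, Finset.smul_sum]
    exact Finset.sum_congr rfl fun i _ => by rw [smul_smul, Category.assoc]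
  simp only [e']
  rw [Finset.sum_comm]
  refine Finset.sum_congr rfl fun i _ => ?_
  rw [hb, res_comp, Finset.sum_smul]

lemma RelGen.epi_topSection {T : C} (hT : IsTerminal T) {ι κ : Type u} [Fintype ι] [Fintype κ]
    {s : ι → M.Sec T} {r : κ → ι → R.RSec T} (hr : M.RelGen s r) :
    ∃ t : κ → (kernel (M.freeHomEquiv.symm fun i => topSection hT (s i))).sections,
      Epi (freeHomEquiv _ |>.symm t) := by
  have hs : ∀ i, ev (M.freeHomEquiv.symm fun i => topSection hT (s i)) T (freeBasis R i T) = s i :=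
    fun i => by
      refine (ev_freeBasis _ i T).trans ?_
      rw [secVal_topSection _ _ (𝟙 T), res_id]
  have hρ : ∀ k, ev (M.freeHomEquiv.symm fun i => topSection hT (s i)) T
      (∑ i, r k i • freeBasis R i T) = 0 := fun k => by
    rw [map_sum, ← hr.1 k]
    exact Finset.sum_congr rfl fun i _ => by rw [map_smul, hs]
  have he : (free ι).Gen (fun i => freeBasis R i T) := fun U f x =>
    (exists_freeBasis x).mono fun V g ⟨a, ha⟩ => ⟨a, by simpa only [freeBasis_res] using ha⟩
  choose y hy using fun k => exists_ev_kernel _ (hρ k)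
  exact ⟨fun k => topSection hT (y k), SheafOfModules.epi_topSection hT
    (RelGen.gen_kernel he _ _ (kernel.condition _) (by simpa only [hs] using hr) hy)⟩

lemma RelGen.exists_presentation {T : C} (hT : IsTerminal T) {n p : ℕ}
    {s : Fin n → M.Sec T} {r : Fin p → Fin n → R.RSec T} (hs : M.Gen s) (hr : M.RelGen s r) :
    ∃ P : M.Presentation, P.IsFinite := by
  obtain ⟨t, ht⟩ := (hr.reindex (ι' := ULift.{u} (Fin n)) (κ' := ULift.{u} (Fin p))
    Equiv.ulift Equiv.ulift).epi_topSection hT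
  exact ⟨⟨⟨ULift.{u} (Fin n), _, SheafOfModules.epi_topSection hT (hs.reindex Equiv.ulift)⟩,
    ⟨ULift.{u} (Fin p), t, ht⟩⟩, ⟨⟨inferInstanceAs (Finite (ULift.{u} (Fin n)))⟩,
    ⟨inferInstanceAs (Finite (ULift.{u} (Fin p)))⟩⟩⟩

/-! ### Modules of finite type and of finite presentation -/

/-- Generators over the members of a covering family restrict to smaller objects. Conversely, the
objects over which some finite generating family exists form, taken all together, a covering family.
-/
lemma isFiniteType_iff : M.IsFiniteType ↔ M.LFG := by
  constructor
  · rintro ⟨σ, hσ⟩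
    intro U
    refine ⟨_, σ.coversTop U, fun V f hf => ?_⟩
    obtain ⟨i, ⟨g⟩⟩ := (Sieve.mem_ofObjects_iff _ _).1 hf
    have : Finite (σ.generators i).I := (hσ.isFiniteType i).finite
    have : Fintype (σ.generators i).I := Fintype.ofFinite _
    have := (σ.generators i).epi
    let e := (Fintype.equivFin (σ.generators i).I).symm
    exact ⟨_, _, Gen.of_over (Y := Over.mk g)
      ((gen_of_epi (σ.generators i).s (Over.mk g)).reindex e)⟩
  · intro h
    choose n s hs using fun V : {V : C // ∃ (n : ℕ) (s : Fin n → M.Sec V), M.Gen s} => V.2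
    have hs' : ∀ V : {V : C // ∃ (n : ℕ) (s : Fin n → M.Sec V), M.Gen s},
        ∃ G : (M.over V.1).GeneratingSections, G.IsFiniteType := fun V =>
      Gen.exists_generatingSections Over.mkIdTerminal (Gen.over (Y := Over.mk (𝟙 V.1)) (hs V))
    choose G hG using hs'
    have hcov : J.CoversTop
        (Subtype.val : {V : C // ∃ (n : ℕ) (s : Fin n → M.Sec V), M.Gen s} → C) := by
      intro U
      obtain ⟨S, hS, h⟩ := h U
      refine J.superset_covering (fun V f hf => ?_) hS
      exact (Sieve.mem_ofObjects_iff _ _).2 ⟨⟨V, h V f hf⟩, ⟨𝟙 V⟩⟩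
    let σ : LocalGeneratorsData.{u} M :=
      { I := _, X := _, coversTop := hcov, generators := G }
    have : σ.IsFiniteType := ⟨hG⟩
    exact ⟨σ, this⟩

lemma IsFinitePresentation.relGen (hM : M.IsFinitePresentation) (U : C) :
    J.Locally U fun V _ => ∃ (ι κ : Type u) (_ : Fintype ι) (_ : Fintype κ) (s : ι → M.Sec V)
      (r : κ → ι → R.RSec V), M.Gen s ∧ M.RelGen s r := by
  obtain ⟨σ, hσ⟩ := hM
  have : J.Locally U fun V _ => ∃ i, Nonempty (V ⟶ σ.X i) :=
    ⟨_, σ.coversTop U, fun V f hf => (Sieve.mem_ofObjects_iff _ _).1 hf⟩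
  refine this.bind ?_
  rintro V f ⟨i, ⟨g⟩⟩
  refine Locally.of_over (Y := Over.mk g) ?_
  refine ((σ.presentation i).relGen (Over.mk g)).mono ?_
  rintro Z z ⟨ι, κ, _, _, s, r, hs, hr⟩
  exact ⟨ι, κ, inferInstance, inferInstance, s, r, hs.of_over, hr.of_over⟩

lemma isFinitePresentation_of_relGen (h : ∀ U : C, J.Locally U fun V _ =>
    ∃ (n p : ℕ) (s : Fin n → M.Sec V) (r : Fin p → Fin n → R.RSec V), M.Gen s ∧ M.RelGen s r) :
    M.IsFinitePresentation := by
  choose n p s r hs hr using fun V : {V : C // ∃ (n p : ℕ) (s : Fin n → M.Sec V)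
    (r : Fin p → Fin n → R.RSec V), M.Gen s ∧ M.RelGen s r} => V.2
  have h' : ∀ V : {V : C // ∃ (n p : ℕ) (s : Fin n → M.Sec V)
      (r : Fin p → Fin n → R.RSec V), M.Gen s ∧ M.RelGen s r},
      ∃ P : (M.over V.1).Presentation, P.IsFinite := fun V =>
    RelGen.exists_presentation Over.mkIdTerminal (Gen.over (Y := Over.mk (𝟙 V.1)) (hs V))
      (RelGen.over (Y := Over.mk (𝟙 V.1)) (hr V))
  choose P hP using h'
  have hcov : J.CoversTop (Subtype.val : {V : C // ∃ (n p : ℕ) (s : Fin n → M.Sec V)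
      (r : Fin p → Fin n → R.RSec V), M.Gen s ∧ M.RelGen s r} → C) := by
    intro U
    obtain ⟨S, hS, h⟩ := h U
    refine J.superset_covering (fun V f hf => ?_) hS
    exact (Sieve.mem_ofObjects_iff _ _).2 ⟨⟨V, h V f hf⟩, ⟨𝟙 V⟩⟩
  let σ : QuasicoherentData.{u} M :=
    { I := _, X := _, coversTop := hcov, presentation := P }
  have : σ.IsFinitePresentation := ⟨hP⟩
  exact ⟨σ, this⟩

lemma IsFinitePresentation.exists_relGen (hM : M.IsFinitePresentation) {U : C} {n : ℕ}
    {s : Fin n → M.Sec U} (hs : M.Gen s) : J.Locally U fun V f =>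
      ∃ (κ : Type u) (_ : Fintype κ) (r : κ → Fin n → R.RSec V),
        M.RelGen (fun i => M.res f (s i)) r := by
  refine (IsFinitePresentation.relGen hM U).bind ?_
  rintro V f ⟨ι, κ, _, _, t, r, ht, hr⟩
  have h1 := Locally.forall_finite fun i => hs V f (t i)
  have h2 := Locally.forall_finite fun j => ht V (𝟙 V) (M.res f (s j))
  refine (h1.and h2).mono ?_
  rintro W g ⟨ha, hb⟩
  choose a ha using ha
  choose b hb using hb
  refine ⟨Fin n ⊕ κ, inferInstance, _, (hr.res g).change (s := fun i => M.res (g ≫ f) (s i))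
    ha (b := b) fun j => ?_⟩
  simpa only [Category.comp_id, res_comp] using hb j

lemma Gen.of_mono {M N : SheafOfModules.{u} R} (φ : N ⟶ M) [Mono φ] {U : C} {ι κ : Type*}
    [Fintype ι] [Fintype κ] {s : ι → N.Sec U} {r : κ → ι → R.RSec U}
    (hr : M.RelGen (fun i => ev φ U (s i)) r) : N.RelGen s r := by
  refine ⟨fun k => ev_injective φ U ?_, fun V f a ha => hr.2 V f a ?_⟩
  · rw [map_sum, map_zero]
    simpa only [map_smul] using hr.1 k
  · have := congr_arg (ev φ V) ha
    simpa only [map_sum, map_smul, ev_res, map_zero] using this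

lemma RelFG.of_mono {M N : SheafOfModules.{u} R} (φ : N ⟶ M) [Mono φ] (hM : M.RelFG) :
    N.RelFG := fun U n s =>
  (hM U n fun i => ev φ U (s i)).mono fun V f ⟨p, r, hr⟩ =>
    ⟨p, r, Gen.of_mono φ (by simpa only [ev_res] using hr)⟩

end Site

end SheafOfModules

open SheafOfModules

/-- Sections `s` over `U` span a submodule of finite type of the restriction of `M`; it is finitely
presented, and finite presentation makes the relations between any finite generating family finitely
generated. Conversely, a locally finitely generated submodule inherits the condition on relations
from `M`, since relations are tested after a monomorphism. -/
lemma isCoherentModule_iff {C : Type u} [SmallCategory C] {J : GrothendieckTopology C}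
    {R : Sheaf J RingCat.{u}} {M : SheafOfModules.{u} R} :
    IsCoherentModule M ↔ M.LFG ∧ M.RelFG := by
  constructor
  · rintro ⟨h1, h2⟩
    refine ⟨isFiniteType_iff.1 h1, RelFG.of_relGen fun U n s => ?_⟩
    let s₀ : Fin n → (M.over U).Sec (Over.mk (𝟙 U)) := s
    let t : Fin n → (M.over U).sections := fun i => topSection Over.mkIdTerminal (s₀ i)
    let N := spanFamily t
    have hs : ∀ i, s₀ i ∈ N.obj (Over.mk (𝟙 U)) := by
      intro i
      have := section_mem_spanFamily t i (Over.mk (𝟙 U))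
      rwa [secVal_topSection _ _ (𝟙 _), res_id] at this
    choose s' hs' using fun i => N.exists_ev_incl (hs i)
    have hgen : N.sheaf.Gen s' := by
      intro V f m
      refine Locally.mono (N.ev_incl_mem m) ?_
      rintro W g ⟨a, ha⟩
      refine ⟨a, N.ev_incl_injective W ?_⟩
      rw [ev_res, ha, map_sum]
      refine Finset.sum_congr rfl fun i _ => ?_
      rw [map_smul, ev_res, hs', secVal_topSection _ _ (g ≫ f)]
    have hN : N.sheaf.IsFinitePresentation := by
      refine h2 U N.sheaf N.incl inferInstance (isFiniteType_iff.2 fun V => ?_)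
      exact .of_forall fun W f => ⟨n, _, hgen.res (Over.mkIdTerminal.from W)⟩
    have := IsFinitePresentation.exists_relGen hN hgen
    refine Locally.of_over (Y := Over.mk (𝟙 U)) (this.mono ?_)
    rintro Z f ⟨κ, _, r, hr⟩
    refine ⟨Fin (Fintype.card κ), inferInstance, fun k => r ((Fintype.equivFin κ).symm k), ?_⟩
    have hr' := hr.reindex (Equiv.refl (Fin n)) (Fintype.equivFin κ).symm
    have hr'' : (M.over U).RelGen (fun i => (M.over U).res f (s₀ i))
      fun k => r ((Fintype.equivFin κ).symm k) := by
      refine ⟨fun k => ?_, fun V g a ha => hr'.2 V g a (N.ev_incl_injective V ?_)⟩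
      · have := congr_arg (ev N.incl Z) (hr'.1 k)
        rw [map_sum, map_zero] at this
        simpa only [map_smul, ev_res, hs', Function.comp, Equiv.refl_apply] using this
      · rw [map_sum, map_zero]
        simpa only [map_smul, ev_res, hs', Function.comp, Equiv.refl_apply] using ha
    exact hr''.of_over
  · rintro ⟨h1, h2⟩
    refine ⟨isFiniteType_iff.2 h1, fun U N i _ hN => isFinitePresentation_of_relGen fun V => ?_⟩
    have hN1 : N.LFG := isFiniteType_iff.1 hN
    have hN2 : N.RelFG := (h2.over U).of_mono i
    refine (hN1 V).bind ?_
    rintro W f ⟨n, s, hs⟩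
    refine (hN2 W n s).mono ?_
    rintro Z g ⟨p, r, hr⟩
    exact ⟨n, p, _, r, hs.res g, hr⟩
end

noncomputable section
open CategoryTheory.GrothendieckTopology SheafOfModules

/-! ### Kernels, cokernels and images of coherent modules -/

namespace SheafOfModules

section Site

variable {C : Type u} [SmallCategory C] {J : GrothendieckTopology C} {R : Sheaf J RingCat.{u}}
  {M N : SheafOfModules.{u} R}

lemma LFG.of_epi (hM : M.LFG) (φ : M ⟶ N) [Epi φ] : N.LFG := fun U =>
  (hM U).mono fun V _ ⟨n, s, hs⟩ => ⟨n, fun i => ev φ V (s i), fun W f m => by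
    refine (exists_ev_of_epi φ m).bind fun Z g ⟨x, hx⟩ => ?_
    refine (hs Z (g ≫ f) x).mono fun Y h ⟨a, ha⟩ => ⟨a, ?_⟩
    rw [← res_comp, ← hx, ← ev_res, ha, map_sum]
    simp only [map_smul, ev_res, Category.assoc]⟩

/-- The relations between the images of generators of `M` produce generators of the kernel. Nothing
is asked about relations in `M`, so this applies to free `A`-modules without coherence of `A`. -/
lemma LFG.kernel_hom (hM : M.LFG) (hN : N.RelFG) (φ : M ⟶ N) : (kernel φ).LFG := fun U => by
  refine (hM U).bind fun V _ ⟨n, s, hs⟩ => ?_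
  refine (hN V n fun i => ev φ V (s i)).mono fun W f ⟨p, r, hr⟩ => ?_
  simp only [← ev_res] at hr
  have h0 : ∀ k, ev φ W (∑ i, r k i • M.res f (s i)) = 0 := fun k => by
    rw [map_sum, ← hr.1 k]
    simp only [map_smul]
  choose y hy using fun k => exists_ev_kernel φ (h0 k)
  exact ⟨p, y, RelGen.gen_kernel (hs.res f) φ (kernel.ι φ) (kernel.condition φ) hr hy⟩

/-- Lift the sections locally to `t` in `N` and let `x` generate `M`. A relation in the cokernel is
a relation in `N` between the `t` and the `φ x` whose coefficients on the `φ x` have been forgotten.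
-/
lemma RelFG.cokernel_hom (hM : M.LFG) (hN : N.RelFG) (φ : M ⟶ N) : (cokernel φ).RelFG :=
  RelFG.of_relGen fun U n s => by
    refine (Locally.forall_finite fun i => exists_ev_of_epi (cokernel.π φ) (s i)).bind
      fun V f ht => ?_
    choose t ht using ht
    refine (hM V).bind fun W g ⟨m, x, hx⟩ => ?_
    refine (hN.exists_relGen (Sum.elim (fun i => N.res g (t i)) (fun j => ev φ W (x j)))).mono
      fun Z h ⟨p, r, hr⟩ => ⟨Fin p, inferInstance, fun k i => r k (Sum.inl i), ?_⟩
    have hs : ∀ i, (cokernel φ).res (h ≫ g ≫ f) (s i) =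
        ev (cokernel.π φ) Z (N.res (h ≫ g) (t i)) := fun i => by
      rw [ev_res, ht, res_comp, Category.assoc]
    simp only [Category.assoc, hs]
    refine ⟨fun k => ?_, fun Y y a ha => ?_⟩
    · have := congr_arg (ev (cokernel.π φ) Z) (hr.1 k)
      simp only [Fintype.sum_sum_type, Sum.elim_inl, Sum.elim_inr, map_add, map_sum, map_smul,
        map_zero, res_comp, ← ev_res, ev_cokernel, smul_zero, Finset.sum_const_zero,
        add_zero] at this
      exact this
    · have h0 : ev (cokernel.π φ) Y (∑ i, a i • N.res (y ≫ h ≫ g) (t i)) = 0 := by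
        rw [map_sum, ← ha]
        simp only [map_smul, ← ev_res, res_comp]
      refine (exists_ev_of_cokernel φ h0).bind fun Y' y' ⟨w, hw⟩ => ?_
      refine (hx Y' (y' ≫ y ≫ h) w).bind fun Y'' y'' ⟨b, hb⟩ => ?_
      have h1 : ∑ i, Sum.elim (fun i => R.rres (y'' ≫ y') (a i)) (fun j => - b j) i •
          N.res ((y'' ≫ y') ≫ y) (N.res h (Sum.elim (fun i => N.res g (t i))
            (fun j => ev φ W (x j)) i)) = 0 := by
        have h2 := congr_arg (N.res y'') hw
        rw [← ev_res, hb, res_comp, map_sum, res_sum_smul] at h2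
        simp only [Fintype.sum_sum_type, Sum.elim_inl, Sum.elim_inr, neg_smul,
          Finset.sum_neg_distrib, res_comp, Category.assoc, ← ev_res]
        simp only [map_smul, res_comp, Category.assoc] at h2
        rw [h2, add_neg_cancel]
      refine (hr.2 _ _ _ h1).mono fun Y₃ y₃ ⟨c, hc⟩ => ⟨c, fun i => ?_⟩
      have := hc (Sum.inl i)
      simpa only [Sum.elim_inl, Sheaf.rres_comp, Category.assoc] using this

/-- The restriction of an epimorphism is an epimorphism. -/
lemma epi_over {φ : M ⟶ N} [Epi φ] (X : C) : Epi ((overFunctor R X).map φ) := by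
  refine epi_of_ev _ fun Y n => ?_
  exact (exists_ev_of_epi φ (U := Y.left) n).of_cocontinuous (K := J.over X) (Over.forget X)

lemma exact_over {E : ShortComplex (SheafOfModules.{u} R)} (hE : E.Exact) (X : C)
    [(overFunctor R X).PreservesZeroMorphisms] : (E.map (overFunctor R X)).Exact := by
  refine exact_of_ev _ fun Y n hn => ?_
  exact (exists_ev_of_exact hE (U := Y.left) hn).of_cocontinuous (K := J.over X) (Over.forget X)

lemma mono_over {φ : M ⟶ N} [Mono φ] (X : C) : Mono ((overFunctor R X).map φ) :=
  mono_of_ev _ fun Y _ hm => ev_injective φ Y.left (hm.trans (map_zero _).symm)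

instance (X : C) : (overFunctor R X).PreservesZeroMorphisms where
  map_zero _ _ := rfl

lemma shortExact_over {E : ShortComplex (SheafOfModules.{u} R)} (hE : E.ShortExact) (X : C) :
    (E.map (overFunctor R X)).ShortExact where
  exact := exact_over hE.exact X
  mono_f := by
    have := hE.mono_f
    exact mono_over X
  epi_g := by
    have := hE.epi_g
    exact epi_over X

end Site

end SheafOfModules

section Coherent

variable {C : Type u} [SmallCategory C] {J : GrothendieckTopology C} {R : Sheaf J RingCat.{u}}
  {M N : SheafOfModules.{u} R}

lemma IsCoherentModule.of_mono (hM : IsCoherentModule M) (hN : N.LFG) (φ : N ⟶ M) [Mono φ] :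
    IsCoherentModule N :=
  isCoherentModule_iff.2 ⟨hN, (isCoherentModule_iff.1 hM).2.of_mono φ⟩

lemma IsCoherentModule.kernel_hom (hM : IsCoherentModule M) (hN : IsCoherentModule N) (φ : M ⟶ N) :
    IsCoherentModule (kernel φ) :=
  hM.of_mono (LFG.kernel_hom (isCoherentModule_iff.1 hM).1 (isCoherentModule_iff.1 hN).2 φ)
    (kernel.ι φ)

lemma IsCoherentModule.cokernel_hom (hM : IsCoherentModule M) (hN : IsCoherentModule N) (φ : M ⟶ N) :
    IsCoherentModule (cokernel φ) :=
  isCoherentModule_iff.2 ⟨(isCoherentModule_iff.1 hN).1.of_epi (cokernel.π φ),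
    RelFG.cokernel_hom (isCoherentModule_iff.1 hM).1 (isCoherentModule_iff.1 hN).2 φ⟩

lemma IsCoherentModule.over (hM : IsCoherentModule M) (X : C) : IsCoherentModule (M.over X) :=
  isCoherentModule_iff.2 ⟨(isCoherentModule_iff.1 hM).1.over X, (isCoherentModule_iff.1 hM).2.over X⟩

lemma IsCoherentModule.of_isZero (hM : IsZero M) : IsCoherentModule M := by
  have h0 : ∀ (U : C) (m : M.Sec U), m = 0 := fun U m => by
    rw [← ev_id M U m, hM.eq_of_src (𝟙 M) 0, ev_zero]
  refine isCoherentModule_iff.2 ⟨fun U => .of_forall fun V f => ⟨0, Fin.elim0, fun W g m =>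
    .of_forall fun Z h => ⟨Fin.elim0, ?_⟩⟩, fun U n s => .of_forall fun V f =>
    -- In a zero module every family of coefficients is a relation, so the standard basis generates
    -- the relations.
    ⟨n, fun k => Pi.single k 1, fun k => h0 _ _, fun W g a _ => .of_forall fun Z h =>
      ⟨fun k => R.rres h (a k), fun i => ?_⟩⟩⟩
  · rw [h0 _ (M.res h m), h0 _ (∑ i, _)]
  · beta_reduce
    rw [Finset.sum_eq_single i]
    · rw [Pi.single_eq_same, map_one, mul_one]
    · intro b _ hb
      rw [Pi.single_eq_of_ne hb.symm, map_zero, mul_zero]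
    · simp

end Coherent
end

noncomputable section
open CategoryTheory.GrothendieckTopology SheafOfModules

/-! ### Serre subcategories of coherent modules -/

section Abelian

variable {𝒞 : Type u} [Category.{v} 𝒞] [Abelian 𝒞] {P S : ObjectProperty 𝒞}

lemma IsSerreSubcategory.of_mono (hS : IsSerreSubcategory P S)
    (hC : ∀ {M N : 𝒞} (f : M ⟶ N), P M → P N → P (cokernel f)) {M N : 𝒞} (f : N ⟶ M) [Mono f]
    (hN : P N) (hM : S M) : S N :=
  ((hS.shortExact (ShortComplex.mk f (cokernel.π f) (cokernel.condition f))
    { exact := ShortComplex.exact_cokernel f } hN (hS.le _ hM)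
    (hC f hN (hS.le _ hM))).1 hM).1

lemma IsSerreSubcategory.of_epi (hS : IsSerreSubcategory P S)
    (hK : ∀ {M N : 𝒞} (f : M ⟶ N), P M → P N → P (kernel f)) {M N : 𝒞} (f : M ⟶ N) [Epi f]
    (hN : P N) (hM : S M) : S N :=
  ((hS.shortExact (ShortComplex.mk (kernel.ι f) f (kernel.condition f))
    { exact := ShortComplex.exact_kernel f } (hK f (hS.le _ hM) hN) (hS.le _ hM) hN).1 hM).2

/-- The object `E.X₂` is an extension of the coimage of `E.g`, a subobject of `E.X₃`, by the kernel
of `E.g`, a quotient of `E.X₁`. -/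
lemma IsSerreSubcategory.of_exact (hS : IsSerreSubcategory P S)
    (hK : ∀ {M N : 𝒞} (f : M ⟶ N), P M → P N → P (kernel f))
    (hC : ∀ {M N : 𝒞} (f : M ⟶ N), P M → P N → P (cokernel f))
    {E : ShortComplex 𝒞} (hE : E.Exact) (h₂ : P E.X₂) (h₁ : S E.X₁) (h₃ : S E.X₃) : S E.X₂ := by
  have hker := hK E.g h₂ (hS.le _ h₃)
  have hcok := hC (kernel.ι E.g) hker h₂
  have := hE.epi_kernelLift
  have s₁ : S (kernel E.g) := hS.of_epi hK (kernel.lift E.g E.f E.zero) hker h₁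
  have s₃ : S (cokernel (kernel.ι E.g)) := hS.of_mono hC (Abelian.factorThruCoimage E.g) hcok h₃
  exact (hS.shortExact (ShortComplex.mk (kernel.ι E.g) (cokernel.π _) (cokernel.condition _))
    { exact := ShortComplex.exact_cokernel _ } hker h₂ hcok).2 ⟨s₁, s₃⟩

end Abelian

/-! ### Reduction of the theorem to the local separation of torsion -/

section Deformation

variable {X : TopCat.{u}} {A : Sheaf (Opens.grothendieckTopology X) RingCat.{u}}

lemma IsCoherentModule.of_iso {C : Type u} [SmallCategory C] {J : GrothendieckTopology C}
    {R : Sheaf J RingCat.{u}} {M N : SheafOfModules.{u} R} (hM : IsCoherentModule M) (e : M ≅ N) :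
    IsCoherentModule N :=
  hM.of_mono ((isCoherentModule_iff.1 hM).1.of_epi e.hom) e.inv

lemma SerreSubstack.obj_iso (S : SerreSubstack A) {U : Opens X} {M N : SheafOfModules.{u} (A.over U)}
    (hM : S.obj U M) (e : M ≅ N) : S.obj U N :=
  (S.serre U).of_mono (fun f h₁ h₂ => IsCoherentModule.cokernel_hom h₁ h₂ f) e.inv
    (((S.serre U).le _ hM).of_iso e) hM

/-- Restriction to the open subset `⊤` is exact and preserves coherence. Coherence of `M` itself is
made part of the property rather than descended from the restriction to `⊤`. -/
lemma SerreSubstack.serre_global (S : SerreSubstack A) :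
    IsSerreSubcategory (coherentModules A) (fun M => IsCoherentModule M ∧ S.global M) where
  le _ h := h.1
  zero Z hZ := ⟨.of_isZero hZ, (S.serre ⊤).zero _ ((overFunctor A ⊤).map_isZero hZ)⟩
  shortExact E hE h₁ h₂ h₃ := by
    have := (S.serre ⊤).shortExact _ (shortExact_over hE ⊤) (IsCoherentModule.over h₁ ⊤)
      (IsCoherentModule.over h₂ ⊤) (IsCoherentModule.over h₃ ⊤)
    exact ⟨fun h => ⟨⟨h₁, (this.1 h.2).1⟩, h₃, (this.1 h.2).2⟩,
      fun h => ⟨h₂, this.2 ⟨h.1.2, h.2.2⟩⟩⟩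

variable (h : CentralSection A)

lemma hPow_naturality {M N : SheafOfModules.{u} A} (f : M ⟶ N) (n : ℕ) :
    hPow h M n ≫ f = f ≫ hPow h N n :=
  hom_ext_ev fun U m => (ev f U).map_smul (resTop A h.val (op U) ^ n) m

lemma hPow_hKer (M : SheafOfModules.{u} A) (n : ℕ) : hPow h (hKer h M n) (n + 1) = 0 := by
  rw [← cancel_mono (kernel.ι (hPow h M (n + 1))), hPow_naturality, kernel.condition, zero_comp]

lemma hPow_hQuot (M : SheafOfModules.{u} A) (n : ℕ) : hPow h (hQuot h M n) (n + 1) = 0 := by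
  rw [← cancel_epi (cokernel.π (hPow h M (n + 1))), ← hPow_naturality, cokernel.condition,
    comp_zero]

lemma IsCoherentModule.hKer {M : SheafOfModules.{u} A} (hM : IsCoherentModule M) (n : ℕ) :
    IsCoherentModule (hKer h M n) := hM.kernel_hom hM _

lemma IsCoherentModule.hQuot {M : SheafOfModules.{u} A} (hM : IsCoherentModule M) (n : ℕ) :
    IsCoherentModule (hQuot h M n) := hM.cokernel_hom hM _

/-- The morphism `M_0 ⟶ M_{n + 1}` induced by `ħ ^ (n + 1)`. -/
def hMul (M : SheafOfModules.{u} A) (n : ℕ) : hQuot h M 0 ⟶ hQuot h M (n + 1) :=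
  cokernel.desc (hPow h M (0 + 1)) (hPow h M (n + 1) ≫ hProj h M (n + 1)) (by
    have : hPow h M (0 + 1) ≫ hPow h M (n + 1) = hPow h M (n + 1 + 1) := (hPow_succ h M (n + 1)).symm
    rw [← Category.assoc, this]
    exact cokernel.condition _)

lemma hProj_hMul (M : SheafOfModules.{u} A) (n : ℕ) :
    hProj h M 0 ≫ hMul h M n = hPow h M (n + 1) ≫ hProj h M (n + 1) := cokernel.π_desc _ _ _

lemma hMul_hTrans (M : SheafOfModules.{u} A) (n : ℕ) : hMul h M n ≫ hTrans h M n = 0 := by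
  rw [← cancel_epi (cokernel.π (hPow h M (0 + 1))), ← Category.assoc, hProj_hMul, Category.assoc,
    hProj_hTrans, cokernel.condition, comp_zero]

/-- If the class of `m` in `M_{n+1}` dies in `M_n`, then locally `m = ħ^{n+1}x`, so it comes from
the class of `x`. Torsion can prevent `hMul` from being injective, but exactness in the middle is
enough. -/
lemma exact_hMul_hTrans (M : SheafOfModules.{u} A) (n : ℕ) :
    (ShortComplex.mk (hMul h M n) (hTrans h M n) (hMul_hTrans h M n)).Exact := by
  refine exact_of_ev _ fun U c hc => ?_
  refine (exists_ev_of_epi (hProj h M (n + 1)) c).bind fun V f ⟨m, hm⟩ => ?_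
  have h0 : ev (hProj h M n) V m = 0 := by
    rw [← hProj_hTrans, ev_comp, hm, ev_res]
    exact (congr_arg _ hc).trans (map_zero _)
  refine (exists_ev_of_cokernel _ h0).mono fun W g ⟨x, hx⟩ => ⟨ev (hProj h M 0) W x, ?_⟩
  change ev (hMul h M n) W _ = (hQuot h M (n + 1)).res _ c
  rw [← ev_comp, hProj_hMul, ev_comp, hx, ev_res, hm, res_comp]

/-- Dévissage: `M_{n+1}` sits between `M₀` and `M_n`. -/
lemma global_hQuot (S : SerreSubstack A) {M : SheafOfModules.{u} A} (hM : IsCoherentModule M)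
    (h0 : S.global (hQuot h M 0)) (n : ℕ) : S.global (hQuot h M n) := by
  induction n with
  | zero => exact h0
  | succ n ih =>
    exact (S.serre_global.of_exact (fun f h₁ h₂ => IsCoherentModule.kernel_hom h₁ h₂ f)
      (fun f h₁ h₂ => IsCoherentModule.cokernel_hom h₁ h₂ f) (exact_hMul_hTrans h M n)
      (hM.hQuot h _) ⟨hM.hQuot h _, h0⟩ ⟨hM.hQuot h _, ih⟩).2

/-- `ħ`-torsion is locally separated from a multiple of `ħ`: locally, for some `N`, the kernels of
all the powers of `ħ` embed into `M / ħ ^ (N + 1) M`. -/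
def TorsionEmbeds (M : SheafOfModules.{u} A) : Prop :=
  ∀ x : X, ∃ (V : Opens X) (N : ℕ), x ∈ V ∧ ∀ n : ℕ,
    Mono ((overFunctor A V).map (kernel.ι (hPow h M (n + 1)) ≫ hProj h M N))

variable {h}

/-- Near a point the kernel is a coherent subobject of `M_N`, hence in `S`, and membership in `S` is
local. The index `N` varies with the point, which is why every `M_n` is required to be in `S`. -/
lemma TorsionEmbeds.global_hKer {M : SheafOfModules.{u} A} (hT : TorsionEmbeds h M)
    (S : SerreSubstack A) (hM : IsCoherentModule M) (hS : ∀ n, S.global (hQuot h M n)) (n : ℕ) :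
    S.global (hKer h M n) := by
  refine S.glue ⊤ _ ((hM.hKer h n).over ⊤) fun x _ => ?_
  obtain ⟨V, N, hx, hV⟩ := hT x
  let i : V ⟶ (⊤ : Opens X) := homOfLE le_top
  have := hV n
  refine ⟨V, i, hx, S.obj_iso ?_ ((overFunctorMap A i).app (hKer h M n)).symm⟩
  refine (S.serre V).of_mono (fun f h₁ h₂ => IsCoherentModule.cokernel_hom h₁ h₂ f)
    ((overFunctor A V).map (kernel.ι (hPow h M (n + 1)) ≫ hProj h M N)) ((hM.hKer h n).over V) ?_
  exact S.obj_iso (S.restrict ⊤ V i _ (hS N)) ((overFunctorMap A i).app (hQuot h M N))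

/-- Multiplication by `ħ ^ n` on a short complex. -/
def hPowComplex (h : CentralSection A) (E : ShortComplex (SheafOfModules.{u} A)) (n : ℕ) : E ⟶ E where
  τ₁ := hPow h E.X₁ n
  τ₂ := hPow h E.X₂ n
  τ₃ := hPow h E.X₃ n
  comm₁₂ := hPow_naturality h E.f n
  comm₂₃ := hPow_naturality h E.g n

/-- The snake diagram of `ħ` on a short exact sequence. -/
def hSnake (h : CentralSection A) {E : ShortComplex (SheafOfModules.{u} A)} (hE : E.ShortExact) :
    ShortComplex.SnakeInput (SheafOfModules.{u} A) where
  L₀ := kernel (hPowComplex h E (0 + 1))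
  L₁ := E
  L₂ := E
  L₃ := cokernel (hPowComplex h E (0 + 1))
  v₀₁ := kernel.ι _
  v₁₂ := hPowComplex h E (0 + 1)
  v₂₃ := cokernel.π _
  w₀₂ := kernel.condition _
  w₁₃ := cokernel.condition _
  h₀ := kernelIsKernel _
  h₃ := cokernelIsCokernel _
  L₁_exact := hE.exact
  epi_L₁_g := hE.epi_g
  L₂_exact := hE.exact
  mono_L₂_f := hE.mono_f

lemma SerreSubstack.global_iso (S : SerreSubstack A) {M N : SheafOfModules.{u} A} (e : M ≅ N)
    (hM : IsCoherentModule M ∧ S.global M) : IsCoherentModule N ∧ S.global N :=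
  S.serre_global.of_mono (fun f h₁ h₂ => IsCoherentModule.cokernel_hom h₁ h₂ f) e.inv
    (hM.1.of_iso e) hM

/-- The snake lemma for `ħ` gives the exact sequence `ker(ħ on X₃) → X₁/ħX₁ → X₂/ħX₂` through the
connecting morphism. The functor `M ↦ M₀` is not left exact, and the torsion of `X₃` measures the
defect. -/
lemma global_snake (S : SerreSubstack A) {E : ShortComplex (SheafOfModules.{u} A)}
    (hE : E.ShortExact) (h₁ : IsCoherentModule E.X₁) (h₂ : IsCoherentModule E.X₂)
    (h₃ : IsCoherentModule E.X₃) (hk : S.global (hKer h E.X₃ 0)) (hq : S.global (hQuot h E.X₂ 0)) :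
    S.global (hQuot h E.X₁ 0) := by
  let T := hSnake h hE
  have e₁ : hQuot h E.X₁ 0 ≅ T.L₃.X₁ :=
    (cokernelIsCokernel (hPow h E.X₁ (0 + 1))).coconePointUniqueUpToIso T.h₃τ₁
  have e₂ : hQuot h E.X₂ 0 ≅ T.L₃.X₂ :=
    (cokernelIsCokernel (hPow h E.X₂ (0 + 1))).coconePointUniqueUpToIso T.h₃τ₂
  have e₃ : hKer h E.X₃ 0 ≅ T.L₀.X₃ :=
    (kernelIsKernel (hPow h E.X₃ (0 + 1))).conePointUniqueUpToIso T.h₀τ₃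
  have key := S.serre_global.of_exact (fun f h₁ h₂ => IsCoherentModule.kernel_hom h₁ h₂ f)
    (fun f h₁ h₂ => IsCoherentModule.cokernel_hom h₁ h₂ f) T.L₂'_exact
    ((IsCoherentModule.hQuot h h₁ 0).of_iso e₁)
    (S.global_iso e₃ ⟨IsCoherentModule.hKer h h₃ 0, hk⟩)
    (S.global_iso e₂ ⟨IsCoherentModule.hQuot h h₂ 0, hq⟩)
  exact (S.global_iso e₁.symm key).2

/-- Right exactness of `M ↦ M/ħM`: a section of `X₂` whose image in `X₃` is `ħm` is corrected by `ħ`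
times a local lift of `m`. -/
lemma exact_hQuot {E : ShortComplex (SheafOfModules.{u} A)} (hE : E.ShortExact) :
    ∃ (f : hQuot h E.X₁ 0 ⟶ hQuot h E.X₂ 0) (g : hQuot h E.X₂ 0 ⟶ hQuot h E.X₃ 0)
      (w : f ≫ g = 0), (ShortComplex.mk f g w).Exact ∧ Epi g := by
  have := hE.epi_g
  let f : hQuot h E.X₁ 0 ⟶ hQuot h E.X₂ 0 := cokernel.map _ _ E.f E.f (hPow_naturality h E.f _)
  let g : hQuot h E.X₂ 0 ⟶ hQuot h E.X₃ 0 := cokernel.map _ _ E.g E.g (hPow_naturality h E.g _)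
  have hf : hProj h E.X₁ 0 ≫ f = E.f ≫ hProj h E.X₂ 0 := cokernel.π_desc _ _ _
  have hg : hProj h E.X₂ 0 ≫ g = E.g ≫ hProj h E.X₃ 0 := cokernel.π_desc _ _ _
  refine ⟨f, g, ?_, exact_of_ev _ fun U q hq => ?_, ?_⟩
  · rw [← cancel_epi (hProj h E.X₁ 0), ← Category.assoc, hf, Category.assoc, hg, ← Category.assoc,
      E.zero, zero_comp, comp_zero]
  · refine (exists_ev_of_epi (hProj h E.X₂ 0) q).bind fun V i ⟨y, hy⟩ => ?_
    have h0 : ev (hProj h E.X₃ 0) V (ev E.g V y) = 0 := by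
      rw [← ev_comp, ← hg, ev_comp, hy, ev_res]
      exact (congr_arg _ hq).trans (map_zero _)
    refine (exists_ev_of_cokernel _ h0).bind fun W j ⟨m, hm⟩ => ?_
    refine (exists_ev_of_epi E.g m).bind fun Z k ⟨n, hn⟩ => ?_
    have h1 : ev E.g Z (E.X₂.res (k ≫ j) y - ev (hPow h E.X₂ (0 + 1)) Z n) = 0 := by
      rw [map_sub, ← ev_comp, hPow_naturality, ev_comp, hn, ev_res, ev_res, hm, res_comp, sub_self]
    refine (exists_ev_of_exact hE.exact h1).mono fun Z' k' ⟨x, hx⟩ => ⟨ev (hProj h E.X₁ 0) Z' x, ?_⟩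
    change ev f Z' _ = (hQuot h E.X₂ 0).res _ q
    rw [← ev_comp, hf, ev_comp, hx, ev_res, map_sub]
    have h2 : ev (hProj h E.X₂ 0) Z (ev (hPow h E.X₂ (0 + 1)) Z n) = 0 := ev_cokernel _ _
    rw [h2, sub_zero, ev_res, hy, res_comp, res_comp]
    simp only [Category.assoc]
  · have : Epi (hProj h E.X₂ 0 ≫ g) := by
      rw [hg]
      infer_instance
    exact epi_of_epi (hProj h E.X₂ 0) g

lemma modSerre_tfae (hT : ∀ M : SheafOfModules.{u} A, IsCoherentModule M → TorsionEmbeds h M)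
    (S : SerreSubstack A) (M : SheafOfModules.{u} A) (hM : IsCoherentModule M) :
    List.TFAE [modSerre S h M, S.level h 0 (hQuot h M 0),
      ∀ n : ℕ, S.level h n (hQuot h M n)] := by
  tfae_have 1 → 2 := fun H => (H.2 0).2
  tfae_have 2 → 3 := fun H n => ⟨global_hQuot h S hM H.1 n, hPow_hQuot h M n⟩
  tfae_have 3 → 1 := fun H => ⟨hM, fun n =>
    ⟨⟨(hT M hM).global_hKer S hM (fun n => (H n).1) n, hPow_hKer h M n⟩, H n⟩⟩
  tfae_finish

lemma isSerreSubcategory_modSerre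
    (hT : ∀ M : SheafOfModules.{u} A, IsCoherentModule M → TorsionEmbeds h M)
    (S : SerreSubstack A) : IsSerreSubcategory (coherentModules A) (modSerre S h) := by
  have key : ∀ M : SheafOfModules.{u} A, IsCoherentModule M →
      (modSerre S h M ↔ S.global (hQuot h M 0)) := fun M hM =>
    ((modSerre_tfae hT S M hM).out 0 1).trans
      (show S.level h 0 (hQuot h M 0) ↔ S.global (hQuot h M 0) from
        ⟨fun H => H.1, fun H => ⟨H, hPow_hQuot h M 0⟩⟩)
  refine ⟨fun M H => H.1, fun Z hZ => ?_, fun E hE h₁ h₂ h₃ => ?_⟩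
  · have hZ' : IsZero (hQuot h Z 0) := by
      rw [IsZero.iff_id_eq_zero, ← cancel_epi (hProj h Z 0)]
      exact hZ.eq_of_src _ _
    exact (key Z (.of_isZero hZ)).2 (S.serre_global.zero _ hZ').2
  · obtain ⟨f, g, w, hfg, _⟩ := exact_hQuot (h := h) hE
    constructor
    · intro H
      have H₂ := (key _ h₂).1 H
      have H₃ : modSerre S h E.X₃ := (key _ h₃).2
        (S.serre_global.of_epi (fun f h₁ h₂ => IsCoherentModule.kernel_hom h₁ h₂ f) g
          (IsCoherentModule.hQuot h h₃ 0) ⟨IsCoherentModule.hQuot h h₂ 0, H₂⟩).2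
      -- The quotient has to be treated first: full membership of `E.X₃`, not merely that of its
      -- reduction, provides the kernel of `ħ` needed for `E.X₁`.
      exact ⟨(key _ h₁).2 (global_snake S hE h₁ h₂ h₃ (H₃.2 0).1.1 H₂), H₃⟩
    · rintro ⟨H₁, H₃⟩
      exact (key _ h₂).2 (S.serre_global.of_exact
        (fun f h₁ h₂ => IsCoherentModule.kernel_hom h₁ h₂ f)
        (fun f h₁ h₂ => IsCoherentModule.cokernel_hom h₁ h₂ f) hfg (IsCoherentModule.hQuot h h₂ 0)
        ⟨IsCoherentModule.hQuot h h₁ 0, (key _ h₁).1 H₁⟩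
        ⟨IsCoherentModule.hQuot h h₃ 0, (key _ h₃).1 H₃⟩).2

end Deformation
end

noncomputable section
open CategoryTheory.GrothendieckTopology SheafOfModules

/-! ### Powers of a sheaf of modules and linear combinations -/

namespace SheafOfModules

section Site

variable {C : Type u} [SmallCategory C] {J : GrothendieckTopology C} {R : Sheaf J RingCat.{u}}

/-- A morphism of sheaves of modules given by linear maps on sections. -/
def homOfEv {M N : SheafOfModules.{u} R} (φ : ∀ U : C, M.Sec U →ₗ[R.RSec U] N.Sec U)
    (h : ∀ {U V : C} (f : V ⟶ U) (m : M.Sec U), φ V (M.res f m) = N.res f (φ U m)) : M ⟶ N where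
  val :=
    { app X := ModuleCat.ofHom (φ X.unop)
      naturality {X Y} f := by
        ext m
        exact h f.unop m }

variable (R) in
/-- The sheaf of modules of families of sections of `R`. -/
def vec (ι : Type) : SheafOfModules.{u} R where
  val :=
    { obj U := ModuleCat.of (R.obj.obj U) (ι → R.obj.obj U)
      map {U V} f := ModuleCat.ofHom (Y := (ModuleCat.restrictScalars (R.obj.map f).hom).obj
          (ModuleCat.of (R.obj.obj V) (ι → R.obj.obj V)))
        { toFun v i := R.obj.map f (v i)
          map_add' v w := funext fun i => map_add (R.obj.map f).hom (v i) (w i)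
          map_smul' r v := funext fun i => map_mul (R.obj.map f).hom r (v i) }
      map_id U := by
        ext v
        funext i
        change R.obj.map (𝟙 U) (v i) = v i
        rw [R.obj.map_id]
        rfl
      map_comp {U V W} f g := by
        ext v
        funext i
        change R.obj.map (f ≫ g) (v i) = R.obj.map g (R.obj.map f (v i))
        rw [R.obj.map_comp]
        rfl }
  isSheaf := by
    refine Presheaf.isSheaf_of_glue _ (fun U v hv => ?_) (fun U S hS x hx => ?_)
    · funext i
      exact (unit R).sec_zero_of_locally (m := v i) (hv.mono fun V f hf => congr_fun hf i)
    · choose t ht using fun i => (unit R).sec_glue hS (fun V f hf => (x V f hf : ι → R.RSec V) i)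
        (fun V W f g hf => congr_fun (hx V W f g hf) i)
      exact ⟨t, fun V f hf => funext fun i => ht i V f hf⟩

variable {ι κ : Type}

/-- The coordinates of a section of `vec R ι`. -/
def coord {U : C} (v : (vec R ι).Sec U) : ι → R.RSec U := v

/-- The section of `vec R ι` with given coordinates. -/
def ofCoord {U : C} (v : ι → R.RSec U) : (vec R ι).Sec U := v

@[simp] lemma coord_ofCoord {U : C} (v : ι → R.RSec U) : coord (ofCoord v) = v := rfl

@[ext] lemma coord_ext {U : C} {v w : (vec R ι).Sec U} (h : ∀ i, coord v i = coord w i) : v = w :=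
  funext h

@[simp] lemma coord_res {U V : C} (f : V ⟶ U) (v : (vec R ι).Sec U) (i : ι) :
    coord ((vec R ι).res f v) i = R.rres f (coord v i) := rfl

@[simp] lemma coord_add {U : C} (v w : (vec R ι).Sec U) (i : ι) :
    coord (v + w) i = coord v i + coord w i := rfl

@[simp] lemma coord_sub {U : C} (v w : (vec R ι).Sec U) (i : ι) :
    coord (v - w) i = coord v i - coord w i := rfl

@[simp] lemma coord_zero {U : C} (i : ι) : coord (0 : (vec R ι).Sec U) i = 0 := rfl

@[simp] lemma coord_smul {U : C} (r : R.RSec U) (v : (vec R ι).Sec U) (i : ι) :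
    coord (r • v) i = r * coord v i := rfl

@[simp] lemma coord_sum {U : C} {κ : Type*} (s : Finset κ) (v : κ → (vec R ι).Sec U) (i : ι) :
    coord (∑ k ∈ s, v k) i = ∑ k ∈ s, coord (v k) i :=
  Finset.sum_apply (M := fun _ => R.RSec U) i s v

/-- The morphism from `vec R ι` given by linear combinations of global sections. -/
def lincomb [Fintype ι] (M : SheafOfModules.{u} R) {T : C} (hT : IsTerminal T) (s : ι → M.Sec T) :
    vec R ι ⟶ M :=
  homOfEv (fun U =>
    { toFun v := ∑ i, coord v i • M.res (hT.from U) (s i)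
      map_add' v w := by simp only [coord_add, add_smul, Finset.sum_add_distrib]
      map_smul' r v := by simp only [coord_smul, mul_smul, Finset.smul_sum, RingHom.id_apply] })
    (fun {_ V} f v => by
      change ∑ i, _ = M.res f (∑ i, _)
      rw [res_sum_smul]
      simp only [coord_res, res_comp, hT.comp_from])

lemma ev_lincomb [Fintype ι] (M : SheafOfModules.{u} R) {T : C} (hT : IsTerminal T)
    (s : ι → M.Sec T) {U : C} (v : (vec R ι).Sec U) :
    ev (lincomb M hT s) U v = ∑ i, coord v i • M.res (hT.from U) (s i) := rfl

/-- Reindexing of coordinates along a partially defined map, extended by zero. -/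
def vecMap (e : κ → Option ι) : vec R ι ⟶ vec R κ :=
  homOfEv (fun U =>
    { toFun v := ofCoord fun k => (e k).elim 0 (coord v)
      map_add' v w := coord_ext fun k => by
        rw [coord_ofCoord, coord_add, coord_ofCoord, coord_ofCoord]
        cases e k <;> simp
      map_smul' r v := coord_ext fun k => by
        rw [coord_ofCoord, coord_smul, coord_ofCoord]
        cases e k <;> simp })
    (fun {U V} f v => coord_ext fun k => by
      change (e k).elim 0 (coord ((vec R ι).res f v)) = R.rres f ((e k).elim 0 (coord v))
      cases e k <;> simp)

lemma coord_vecMap (e : κ → Option ι) {U : C} (v : (vec R ι).Sec U) (k : κ) :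
    coord (ev (vecMap e) U v) k = (e k).elim 0 (coord v) := rfl

variable (R) in
/-- A coordinate of `vec R ι`. -/
def proj (i : ι) : vec R ι ⟶ unit R :=
  homOfEv (fun U =>
    { toFun v := coord v i
      map_add' _ _ := rfl
      map_smul' _ _ := rfl }) (fun _ _ => rfl)

lemma vec_lfg [Fintype ι] : (vec R ι).LFG := by
  classical
  refine LFG.of_gen fun U => .of_forall fun V f => ⟨ι, inferInstance,
    fun i => ofCoord (Pi.single i 1), fun W g v => .of_forall fun Z h => ⟨fun i =>
      R.rres h (coord v i), coord_ext fun i => ?_⟩⟩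
  rw [coord_sum, Finset.sum_eq_single i]
  · simp
  · intro j _ hj
    simp [Pi.single_eq_of_ne hj.symm]
  · simp

lemma exists_lift_of_mono {K M' M : SheafOfModules.{u} R} (φ : M' ⟶ M) [Mono φ] (θ : K ⟶ M)
    (h : ∀ (U : C) (m : K.Sec U), ∃ x, ev φ U x = ev θ U m) : ∃ l : K ⟶ M', l ≫ φ = θ := by
  choose l hl using h
  exact ⟨homOfEv (fun U =>
      { toFun := l U
        map_add' := fun a b => ev_injective φ U (by simp only [map_add, hl])
        map_smul' := fun a b => ev_injective φ U (by simp only [map_smul, hl, RingHom.id_apply]) })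
      (fun {U V} f m => ev_injective φ V (by
        change ev φ V (l V _) = ev φ V (M'.res f (l U m))
        simp only [hl, ev_res])), hom_ext_ev hl⟩

/-! ### Finiteness conditions and extensions -/

/-- Relations `r` between the images in `M''` give sections `x = r·s` coming from `M'`; if `d`
generates the relations between these, the products `d r` generate the relations between the `s`. -/
lemma RelFG.of_exact {M' M M'' : SheafOfModules.{u} R} (φ : M' ⟶ M) [Mono φ] (ψ : M ⟶ M'')
    (hexact : ∀ {U : C} (m : M.Sec U), ev ψ U m = 0 → ∃ x, ev φ U x = m)
    (h' : M'.RelFG) (h'' : M''.RelFG) : M.RelFG := fun U n s => by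
  refine (h'' U n fun i => ev ψ U (s i)).bind fun V f ⟨p, r, hr⟩ => ?_
  simp only [← ev_res] at hr
  have h0 : ∀ k, ev ψ V (∑ i, r k i • M.res f (s i)) = 0 := fun k => by
    rw [map_sum, ← hr.1 k]
    simp only [map_smul]
  choose x hx using fun k => hexact _ (h0 k)
  refine (h' V p x).mono fun W g ⟨q, d, hd⟩ => ⟨q, fun l i => ∑ k, d l k * R.rres g (r k i), ?_⟩
  have key : ∀ {Z : C} (z : Z ⟶ W) (b : Fin p → R.RSec Z),
      ∑ i, (∑ k, b k * R.rres (z ≫ g) (r k i)) • M.res (z ≫ g ≫ f) (s i) =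
        ev φ Z (∑ k, b k • M'.res (z ≫ g) (x k)) := by
    intro Z z b
    rw [map_sum]
    simp only [map_smul, ev_res, hx, res_sum_smul, Finset.sum_smul, Finset.smul_sum, smul_smul,
      res_comp, Category.assoc]
    exact Finset.sum_comm
  refine ⟨fun l => ?_, fun Z z a ha => ?_⟩
  · have := key (𝟙 W) (d l)
    simp only [Category.id_comp] at this
    rw [this, hd.1, map_zero]
  · have h1 : ∑ i, a i • M''.res (z ≫ g) (ev ψ V (M.res f (s i))) = 0 := by
      rw [← map_zero (ev ψ Z), ← ha, map_sum]
      simp only [map_smul, ← ev_res, res_comp, Category.assoc]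
    refine (hr.2 Z (z ≫ g) a h1).bind fun Y y ⟨b, hb⟩ => ?_
    have h2 : ∑ k, b k • M'.res (y ≫ z) (M'.res g (x k)) = 0 := by
      refine ev_injective φ Y ?_
      simp only [res_comp]
      rw [← key (y ≫ z) b, map_zero, ← map_zero (M.res y), ← ha, res_sum_smul]
      refine Finset.sum_congr rfl fun i _ => ?_
      simp only [hb, res_comp, Category.assoc]
    refine (hd.2 Y (y ≫ z) _ h2).mono fun Y' y' ⟨c, hc⟩ => ⟨c, fun i => ?_⟩
    rw [← Sheaf.rres_comp, hb]
    simp only [map_sum, map_mul, hc, Sheaf.rres_comp, Finset.sum_mul, Finset.mul_sum, mul_assoc,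
      Category.assoc]
    exact Finset.sum_comm

/-- The map `Fin.cases none some` inserts a zero at index `0`. With the projection to that
coordinate this gives `R^n → R^{n+1} → R`, along which finiteness conditions are propagated by
induction on the rank. -/
instance mono_vecMap_some (n : ℕ) :
    Mono (vecMap (R := R) (fun i : Fin (n + 1) => (Fin.cases none some i : Option (Fin n)))) :=
  mono_of_ev _ fun U v hv => coord_ext fun i => by
    have := congr_fun (congr_arg coord hv) i.succ
    rwa [coord_vecMap] at this

lemma exists_vecMap {n : ℕ} {U : C} (v : (vec R (Fin (n + 1))).Sec U) (hv : ev (proj R 0) U v = 0) :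
    ∃ w, ev (vecMap (fun i : Fin (n + 1) => (Fin.cases none some i : Option (Fin n)))) U w = v :=
  ⟨ofCoord fun i => coord v i.succ, coord_ext fun i => by
    rw [coord_vecMap]
    induction i using Fin.cases with
    | zero => exact hv.symm
    | succ i => rfl⟩

lemma vec_relFG (h : (unit R).RelFG) (n : ℕ) : (vec R (Fin n)).RelFG := by
  induction n with
  | zero =>
    have : Mono (0 : vec R (Fin 0) ⟶ unit R) :=
      mono_of_ev _ fun U v _ => coord_ext fun i => i.elim0
    exact RelFG.of_mono (0 : vec R (Fin 0) ⟶ unit R) h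
  | succ n ih => exact RelFG.of_exact _ _ exists_vecMap ih h

lemma vec_coherent (h : IsCoherentModule (unit R)) (n : ℕ) : IsCoherentModule (vec R (Fin n)) :=
  isCoherentModule_iff.2 ⟨vec_lfg, vec_relFG (isCoherentModule_iff.1 h).2 n⟩

/-! ### Noetherian modules -/

namespace SubFamily

variable {M N P : SheafOfModules.{u} R}

lemma lfg_of_surj (L : M.SubFamily) (hP : P.LFG) (φ : P ⟶ M) (h : ∀ U m, ev φ U m ∈ L.obj U)
    (surj : ∀ {U : C} {m : M.Sec U}, m ∈ L.obj U →
      J.Locally U fun V f => ∃ x, ev φ V x = M.res f m) : L.sheaf.LFG := by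
  have : Epi (L.lift φ h) := epi_of_ev _ fun U n => (surj (L.ev_incl_mem n)).mono
    fun V f ⟨x, hx⟩ => ⟨x, L.ev_incl_injective V (by rw [← ev_comp, L.lift_incl, hx, ev_res])⟩
  exact hP.of_epi (L.lift φ h)

/-- The inverse image of a subsheaf. -/
def comap (φ : M ⟶ N) (L : N.SubFamily) : M.SubFamily where
  obj U := (L.obj U).comap (ev φ U)
  res_mem {_ _} f {m} hm := by
    change ev φ _ _ ∈ L.obj _
    rw [ev_res]
    exact L.res_mem f hm
  local_mem {U m} hm := L.local_mem (hm.mono fun V f hf => by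
    rw [← ev_res]
    exact hf)

lemma mem_comap (φ : M ⟶ N) (L : N.SubFamily) {U : C} {m : M.Sec U} :
    m ∈ (comap φ L).obj U ↔ ev φ U m ∈ L.obj U := Iff.rfl

end SubFamily

lemma imFamily_lfg {M N : SheafOfModules.{u} R} (hM : M.LFG) (φ : M ⟶ N) :
    (imFamily φ).sheaf.LFG :=
  (imFamily φ).lfg_of_surj hM φ (fun U m => .of_forall fun V f => ⟨M.res f m, ev_res _ _ _⟩) id

lemma kerFamily_lfg {M N : SheafOfModules.{u} R} (hM : M.LFG) (hN : N.RelFG) (φ : M ⟶ N) :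
    (kerFamily φ).sheaf.LFG :=
  (kerFamily φ).lfg_of_surj (hM.kernel_hom hN φ) (kernel.ι φ) (fun _ m => ev_kernel φ m)
    fun {U m} hm => .of_forall fun V f => exists_ev_kernel φ ((kerFamily φ).res_mem f hm)

/-- An increasing sequence of subsheaves is locally stationary. -/
def Stationary {M : SheafOfModules.{u} R} (N : ℕ → M.SubFamily) : Prop :=
  ∀ U : C, J.Locally U fun V _ => ∃ r₀ : ℕ, ∀ r, r₀ ≤ r → ∀ (W : C) (_ : W ⟶ V) (m : M.Sec W),
    m ∈ (N r).obj W → m ∈ (N r₀).obj W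

/-- Increasing sequences of locally finitely generated subsheaves are locally stationary. -/
def IsChainNoetherian (M : SheafOfModules.{u} R) : Prop :=
  ∀ N : ℕ → M.SubFamily, (∀ r U, (N r).obj U ≤ (N (r + 1)).obj U) → (∀ r, (N r).sheaf.LFG) →
    Stationary N

lemma SubFamily.le_of_le {M : SheafOfModules.{u} R} {N : ℕ → M.SubFamily}
    (hN : ∀ r U, (N r).obj U ≤ (N (r + 1)).obj U) (U : C) {r s : ℕ} (h : r ≤ s) :
    (N r).obj U ≤ (N s).obj U :=
  monotone_nat_of_le_succ (f := fun r => (N r).obj U) (fun r => hN r U) h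

/-- A chain is stationary once its images in `M''` and its traces on `M'` are. The traces are
locally finitely generated because they are covered by the kernels of `N r ⟶ M''`, which is where
the finiteness of relations in `M''` enters. -/
lemma IsChainNoetherian.of_exact {M' M M'' : SheafOfModules.{u} R} (φ : M' ⟶ M) [Mono φ]
    (ψ : M ⟶ M'')
    (hexact : ∀ {U : C} (m : M.Sec U), ev ψ U m = 0 → ∃ x, ev φ U x = m) (hφψ : φ ≫ ψ = 0)
    (h : M''.RelFG) (h' : IsChainNoetherian M') (h'' : IsChainNoetherian M'') :
    IsChainNoetherian M := by
  intro N hN hfg U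
  have hI := h'' (fun r => imFamily ((N r).incl ≫ ψ))
    (fun r U n hn => Locally.mono hn fun V f ⟨m, hm⟩ =>
      ⟨⟨m.1, hN r V m.2⟩, hm⟩) (fun r => imFamily_lfg (hfg r) _) U
  have hK := h' (fun r => (N r).comap φ) (fun r U x hx => hN r U hx) (fun r => by
    obtain ⟨l, hl⟩ := exists_lift_of_mono φ (kernel.ι ((N r).incl ≫ ψ) ≫ (N r).incl)
      fun U m => hexact _ (ev_kernel ((N r).incl ≫ ψ) m)
    refine ((N r).comap φ).lfg_of_surj ((hfg r).kernel_hom h ((N r).incl ≫ ψ)) l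
      (fun U m => ?_) fun {U m} hm => .of_forall fun V f => ?_
    · rw [SubFamily.mem_comap, ← ev_comp, hl]
      exact (N r).ev_incl_mem _
    · obtain ⟨n, hn⟩ := (N r).exists_ev_incl ((N r).res_mem f hm)
      obtain ⟨k, hk⟩ := exists_ev_kernel ((N r).incl ≫ ψ) (m := n) (by
        rw [ev_comp, hn, ← ev_res, ← ev_comp, hφψ, ev_zero])
      refine ⟨k, ev_injective φ V ?_⟩
      rw [← ev_comp, hl, ev_comp, hk, hn, ev_res]) U
  refine (hI.and hK).mono fun V f ⟨⟨a, ha⟩, ⟨b, hb⟩⟩ => ⟨max a b, fun r hr W g m hm => ?_⟩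
  have h1 : ev ψ W m ∈ (imFamily ((N r).incl ≫ ψ)).obj W := by
    refine .of_forall fun Z z => ⟨⟨M.res z m, (N r).res_mem z hm⟩, ev_res ψ z m⟩
  refine (N _).local_mem ((ha r (le_trans (le_max_left a b) hr) W g _ h1).bind
    fun Z z ⟨n, hn⟩ => .of_forall fun Y y => ?_)
  obtain ⟨x, hx⟩ := hexact (M.res z m - ev (N a).incl Z n) (by
    rw [map_sub, ← ev_comp, hn, ev_res, sub_self])
  have hn' : ev (N a).incl Z n ∈ (N (max a b)).obj Z :=
    SubFamily.le_of_le hN Z (le_max_left a b) ((N a).ev_incl_mem n)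
  have hx' : x ∈ ((N b).comap φ).obj Z := by
    refine hb r (le_trans (le_max_right a b) hr) Z (z ≫ g) x ?_
    rw [SubFamily.mem_comap, hx]
    exact Submodule.sub_mem _ ((N r).res_mem z hm) (SubFamily.le_of_le hN Z hr hn')
  rw [SubFamily.mem_comap, hx] at hx'
  have := Submodule.add_mem _ (SubFamily.le_of_le hN Z (le_max_right a b) hx') hn'
  rw [sub_add_cancel] at this
  rw [← res_comp]
  exact (N _).res_mem y this

lemma vec_isChainNoetherian (h : (unit R).RelFG) (h' : IsChainNoetherian (unit R)) (n : ℕ) :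
    IsChainNoetherian (vec R (Fin n)) := by
  induction n with
  | zero =>
    refine fun N _ _ U => .of_forall fun V f => ⟨0, fun r _ W g m _ => ?_⟩
    have : m = 0 := coord_ext fun i => i.elim0
    rw [this]
    exact Submodule.zero_mem _
  | succ n ih => exact .of_exact _ _ exists_vecMap (hom_ext_ev fun U v => rfl) h ih h'

/-- The union of an increasing sequence of subsheaves. -/
def unionFamily {M : SheafOfModules.{u} R} (N : ℕ → M.SubFamily)
    (hN : ∀ r U, (N r).obj U ≤ (N (r + 1)).obj U) : M.SubFamily where
  obj U :=
    { carrier := {m | J.Locally U fun V f => ∃ r, M.res f m ∈ (N r).obj V}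
      zero_mem' := .of_forall fun V f => ⟨0, by
        rw [map_zero]
        exact Submodule.zero_mem _⟩
      add_mem' := fun {a b} ha hb => (ha.and hb).mono (by
        rintro V f ⟨⟨r, hr⟩, ⟨s, hs⟩⟩
        refine ⟨max r s, ?_⟩
        rw [map_add]
        exact Submodule.add_mem _ (SubFamily.le_of_le hN V (le_max_left r s) hr)
          (SubFamily.le_of_le hN V (le_max_right r s) hs))
      smul_mem' := fun c a ha => ha.mono (by
        rintro V f ⟨r, hr⟩
        refine ⟨r, ?_⟩
        rw [res_smul]
        exact Submodule.smul_mem _ _ hr) }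
  res_mem {_ _} f {m} hm := (hm.pullback f).mono (by
    rintro V g ⟨r, hr⟩
    exact ⟨r, by rwa [res_comp]⟩)
  local_mem {U m} hm := hm.bind (by
    intro V f hf
    refine Locally.mono hf ?_
    rintro W g ⟨r, hr⟩
    exact ⟨r, by rwa [← res_comp]⟩)

/-- Finitely many local generators of the union lie, after shrinking, in finitely many terms of the
chain; the largest index works. -/
lemma stationary_of_lfg {M : SheafOfModules.{u} R} (N : ℕ → M.SubFamily)
    (hN : ∀ r U, (N r).obj U ≤ (N (r + 1)).obj U) (hT : (unionFamily N hN).sheaf.LFG) :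
    Stationary N := fun U => by
  refine (hT U).bind fun V f ⟨n, s, hs⟩ => ?_
  refine (Locally.forall_finite fun i => (unionFamily N hN).ev_incl_mem (s i)).mono
    fun W g hr => ?_
  choose r hr using hr
  refine ⟨Finset.univ.sup r, fun p _ Z z m hm => ?_⟩
  obtain ⟨t, ht⟩ := (unionFamily N hN).exists_ev_incl (m := m)
    (.of_forall fun Y y => ⟨p, (N p).res_mem y hm⟩)
  refine (N _).local_mem ((hs Z (z ≫ g) t).mono fun Y y ⟨a, ha⟩ => ?_)
  rw [← ht, ← ev_res, ha, map_sum]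
  refine Submodule.sum_mem _ fun i _ => ?_
  rw [map_smul, ev_res]
  refine Submodule.smul_mem _ _ (SubFamily.le_of_le hN Y (Finset.le_sup (Finset.mem_univ i)) ?_)
  have := (N (r i)).res_mem (y ≫ z) (hr i)
  rwa [res_comp, Category.assoc] at this

lemma SubFamily.factors {M P : SheafOfModules.{u} R} (L : M.SubFamily) (j : P ⟶ M) [Mono j]
    (h : ∀ {U : C} {m : M.Sec U}, m ∈ L.obj U → J.Locally U fun V f => ∃ x, ev j V x = M.res f m) :
    ∃ l : L.sheaf ⟶ P, l ≫ j = L.incl := by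
  have hI : ∀ U m, ev j U m ∈ (imFamily j).obj U := fun U m =>
    .of_forall fun V f => ⟨P.res f m, ev_res _ _ _⟩
  have : Mono ((imFamily j).lift j hI) := mono_of_mono_fac ((imFamily j).lift_incl j hI)
  have : Epi ((imFamily j).lift j hI) := epi_of_ev _ fun U n =>
    Locally.mono ((imFamily j).ev_incl_mem n) fun V f ⟨x, hx⟩ => ⟨x,
      (imFamily j).ev_incl_injective V (by rw [← ev_comp, SubFamily.lift_incl, hx, ev_res])⟩
  have : IsIso ((imFamily j).lift j hI) := isIso_of_mono_of_epi _
  refine ⟨(imFamily j).lift L.incl (fun U m => h (L.ev_incl_mem m)) ≫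
    inv ((imFamily j).lift j hI), ?_⟩
  have e : inv ((imFamily j).lift j hI) ≫ j = (imFamily j).incl := by
    rw [IsIso.inv_comp_eq, SubFamily.lift_incl]
  rw [Category.assoc, e]
  rfl

lemma isLUB_unionFamily {M : SheafOfModules.{u} R} (N : ℕ → M.SubFamily)
    (hN : ∀ r U, (N r).obj U ≤ (N (r + 1)).obj U) :
    IsLUB (Set.range fun r => Subobject.mk (N r).incl) (Subobject.mk (unionFamily N hN).incl) := by
  constructor
  · rintro _ ⟨r, rfl⟩
    exact Subobject.mk_le_mk_of_comm ((unionFamily N hN).lift (N r).incl fun U m =>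
      .of_forall fun V f => ⟨r, (N r).res_mem f ((N r).ev_incl_mem m)⟩) (SubFamily.lift_incl _ _ _)
  · intro S hS
    obtain ⟨l, hl⟩ := (unionFamily N hN).factors S.arrow fun {U m} hm => by
      refine Locally.mono hm fun V f ⟨r, hr⟩ => ?_
      have hrS : Subobject.mk (N r).incl ≤ S := hS ⟨r, rfl⟩
      obtain ⟨x, hx⟩ := (N r).exists_ev_incl hr
      refine ⟨ev (Subobject.ofMkLE (N r).incl S hrS) V x, ?_⟩
      rw [← ev_comp, Subobject.ofMkLE_arrow, hx]
    exact Subobject.mk_le_of_comm l hl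

end Site

end SheafOfModules

/-- A locally finitely generated left ideal is coherent because `R` is. The union of the chain is
its supremum in the lattice of subobjects, so it is coherent by hypothesis, and in particular
locally finitely generated. -/
lemma IsLeftNoetherianSheaf.isChainNoetherian {X : TopCat.{u}}
    {R : Sheaf (Opens.grothendieckTopology X) RingCat.{u}} (hR : IsLeftNoetherianSheaf R)
    (V : Opens X) : IsChainNoetherian (unit (R.over V)) := by
  intro N hN hfg
  have hc : IsCoherentModule (unit (R.over V)) := hR.coherent.over V
  refine stationary_of_lfg N hN ?_
  have key := hR.sum V (Set.range fun r => Subobject.mk (N r).incl) ?_ _ (isLUB_unionFamily N hN)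
  · exact (isCoherentModule_iff.1 (key.of_iso (Subobject.underlyingIso _))).1
  · rintro _ ⟨r, rfl⟩
    exact (hc.of_mono (hfg r) (N r).incl).of_iso (Subobject.underlyingIso _).symm

lemma IsLeftNoetherianSheaf.vec_isChainNoetherian {X : TopCat.{u}}
    {R : Sheaf (Opens.grothendieckTopology X) RingCat.{u}} (hR : IsLeftNoetherianSheaf R)
    (V : Opens X) (n : ℕ) : IsChainNoetherian (vec (R.over V) (Fin n)) :=
  SheafOfModules.vec_isChainNoetherian
    (isCoherentModule_iff.1 (hR.coherent.over V : IsCoherentModule (unit (R.over V)))).2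
    (hR.isChainNoetherian V) n
end

noncomputable section
open CategoryTheory.GrothendieckTopology SheafOfModules

/-! ### Sheaves of rings with a central parameter -/

section Site

variable {C : Type u} [SmallCategory C] {J : GrothendieckTopology C}

/-- A central non-zero-divisor `el` of a sheaf of rings `A`, and a morphism `A ⟶ A₀` that is the
quotient of `A` by `el`. -/
structure FormalParameter (A A₀ : Sheaf J RingCat.{u}) where
  red : A ⟶ A₀
  el : ∀ U : C, A.RSec U
  rres_el : ∀ {U V : C} (f : V ⟶ U), A.rres f (el U) = el V
  central : ∀ (U : C) (a : A.RSec U), el U * a = a * el U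
  eq_zero : ∀ {U : C} {a : A.RSec U}, el U * a = 0 → a = 0
  red_el : ∀ U : C, (red.hom.app (op U)).hom (el U) = 0
  exists_mul : ∀ {U : C} {a : A.RSec U}, (red.hom.app (op U)).hom a = 0 →
    J.Locally U fun V f => ∃ b, A.rres f a = el V * b
  exists_red : ∀ {U : C} (c : A₀.RSec U),
    J.Locally U fun V f => ∃ a, (red.hom.app (op V)).hom a = A₀.rres f c

namespace FormalParameter

variable {A A₀ : Sheaf J RingCat.{u}} (p : FormalParameter A A₀)

/-- The reduction of sections. -/
def redMap (U : C) : A.RSec U →+* A₀.RSec U := (p.red.hom.app (op U)).hom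

lemma redMap_rres {U V : C} (f : V ⟶ U) (a : A.RSec U) :
    p.redMap V (A.rres f a) = A₀.rres f (p.redMap U a) :=
  congr($(p.red.hom.naturality f.op) a)

lemma rres_el_pow {U V : C} (f : V ⟶ U) (n : ℕ) : A.rres f (p.el U ^ n) = p.el V ^ n := by
  rw [map_pow, p.rres_el]

lemma pow_central (U : C) (n : ℕ) (a : A.RSec U) : p.el U ^ n * a = a * p.el U ^ n :=
  ((show Commute (p.el U) a from p.central U a).pow_left n).eq

lemma pow_eq_zero {U : C} {n : ℕ} {a : A.RSec U} (h : p.el U ^ n * a = 0) : a = 0 := by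
  induction n with
  | zero => rwa [pow_zero, one_mul] at h
  | succ n ih =>
    rw [pow_succ', mul_assoc] at h
    exact ih (p.eq_zero h)

/-- Multiplication by a power of the parameter. -/
def mul (M : SheafOfModules.{u} A) (n : ℕ) : M ⟶ M :=
  homOfEv (fun U =>
    { toFun m := p.el U ^ n • m
      map_add' := smul_add _
      map_smul' a m := by rw [smul_smul, p.pow_central, RingHom.id_apply, smul_smul] })
    (fun {U V} f m => by
      change p.el V ^ n • M.res f m = M.res f (p.el U ^ n • m)
      rw [res_smul, p.rres_el_pow])

lemma ev_mul (M : SheafOfModules.{u} A) (n : ℕ) {U : C} (m : M.Sec U) :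
    ev (p.mul M n) U m = p.el U ^ n • m := rfl

/-- The submodule of multiples of a power of the parameter. -/
def pow (M : SheafOfModules.{u} A) (n : ℕ) : M.SubFamily := imFamily (p.mul M n)

lemma pow_smul_mem {M : SheafOfModules.{u} A} (n : ℕ) {U : C} (m : M.Sec U) :
    p.el U ^ n • m ∈ (p.pow M n).obj U :=
  .of_forall fun V f => ⟨M.res f m, by rw [p.ev_mul, res_smul, p.rres_el_pow]⟩

lemma pow_smul_mem_add {M : SheafOfModules.{u} A} {a b : ℕ} {U : C} {m : M.Sec U}
    (hm : m ∈ (p.pow M b).obj U) : p.el U ^ a • m ∈ (p.pow M (a + b)).obj U :=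
  Locally.mono hm fun V f ⟨x, hx⟩ => ⟨x, by
    rw [p.ev_mul] at hx
    rw [p.ev_mul, res_smul, p.rres_el_pow, ← hx, smul_smul, pow_add]⟩

lemma ev_mem_pow {M N : SheafOfModules.{u} A} (φ : M ⟶ N) {n : ℕ} {U : C} {m : M.Sec U}
    (hm : m ∈ (p.pow M n).obj U) : ev φ U m ∈ (p.pow N n).obj U :=
  Locally.mono hm fun V f ⟨x, hx⟩ => ⟨ev φ V x, by
    rw [p.ev_mul] at hx
    rw [p.ev_mul, ← ev_res, ← hx, map_smul]⟩

lemma pow_succ_le {M : SheafOfModules.{u} A} {n : ℕ} {U : C} {m : M.Sec U}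
    (hm : m ∈ (p.pow M (n + 1)).obj U) : m ∈ (p.pow M n).obj U :=
  Locally.mono hm fun V f ⟨x, hx⟩ => ⟨p.el V • x, by
    rw [p.ev_mul] at hx
    rw [p.ev_mul, ← hx, smul_smul, pow_succ]⟩

variable {ι : Type}

lemma vec_smul_injective {n : ℕ} {U : C} {v w : (vec A ι).Sec U}
    (h : p.el U ^ n • v = p.el U ^ n • w) : v = w :=
  coord_ext fun i => sub_eq_zero.1 (p.pow_eq_zero (n := n) (by
    have := congr_fun (congr_arg coord h) i
    rw [coord_smul, coord_smul] at this
    rw [mul_sub, this, sub_self]))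

lemma vec_mem_pow_of_smul {a b : ℕ} {U : C} {v : (vec A ι).Sec U}
    (h : p.el U ^ a • v ∈ (p.pow (vec A ι) (a + b)).obj U) : v ∈ (p.pow (vec A ι) b).obj U :=
  Locally.mono h fun V f ⟨x, hx⟩ => ⟨x, p.vec_smul_injective (n := a) (by
    rw [p.ev_mul] at hx ⊢
    rw [smul_smul, ← pow_add, hx, res_smul, p.rres_el_pow])⟩

lemma vec_mem_pow [Finite ι] {n : ℕ} {U : C} {v : (vec A ι).Sec U}
    (h : ∀ i, (id (coord v i) : (unit A).Sec U) ∈ (p.pow (unit A) n).obj U) :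
    v ∈ (p.pow (vec A ι) n).obj U :=
  (Locally.forall_finite h).mono fun V f hx => by
    choose x hx using hx
    exact ⟨ofCoord x, coord_ext hx⟩

/-! ### The initial modules of a family of sections -/

section Initial

variable {M : SheafOfModules.{u} A} (Y : vec A ι ⟶ M)

/-- The families of coefficients `φ` such that `el ^ r • Y φ` is divisible by `el ^ (r + 1)`. -/
def initial (r : ℕ) : (vec A ι).SubFamily :=
  SubFamily.comap (Y ≫ p.mul M r) (p.pow M (r + 1))

lemma mem_initial {r : ℕ} {U : C} {φ : (vec A ι).Sec U} :
    φ ∈ (p.initial Y r).obj U ↔ p.el U ^ r • ev Y U φ ∈ (p.pow M (r + 1)).obj U := Iff.rfl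

lemma initial_le (r : ℕ) (U : C) : (p.initial Y r).obj U ≤ (p.initial Y (r + 1)).obj U := by
  intro φ hφ
  rw [mem_initial] at hφ ⊢
  have := p.pow_smul_mem_add (a := 1) hφ
  rwa [smul_smul, ← pow_add, add_comm 1 r, add_comm 1 (r + 1)] at this

lemma pow_mem_initial (r : ℕ) {U : C} {φ : (vec A ι).Sec U}
    (hφ : φ ∈ (p.pow (vec A ι) 1).obj U) : φ ∈ (p.initial Y r).obj U :=
  p.pow_smul_mem_add (p.ev_mem_pow Y hφ)

/-- This is the kernel of `φ ↦ el^r Yφ` with values in `M / el^{r+1} M`, and the latter is coherent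
as a cokernel. -/
lemma initial_lfg [Fintype ι] (hM : IsCoherentModule M) (r : ℕ) : (p.initial Y r).sheaf.LFG := by
  have hQ : (cokernel (p.mul M (r + 1))).RelFG := (isCoherentModule_iff.1 (hM.cokernel_hom hM _)).2
  let θ := Y ≫ p.mul M r ≫ cokernel.π (p.mul M (r + 1))
  refine (p.initial Y r).lfg_of_surj (vec_lfg.kernel_hom hQ θ) (kernel.ι θ) (fun U m => ?_)
    fun {U m} hm => .of_forall fun V f => exists_ev_kernel θ ?_
  · exact exists_ev_of_cokernel (p.mul M (r + 1)) (ev_kernel θ m)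
  · refine sec_zero_of_locally _ (Locally.mono ((p.initial Y r).res_mem f hm) fun W g ⟨x, hx⟩ => ?_)
    rw [← ev_res]
    change ev (cokernel.π (p.mul M (r + 1))) W (ev (Y ≫ p.mul M r) W _) = 0
    rw [ev_res, ← hx, ev_cokernel]

/-- The image of a submodule of `vec A ι` under the reduction. -/
def redFamily (L : (vec A ι).SubFamily) : (vec A₀ ι).SubFamily where
  obj U :=
    { carrier := {c | J.Locally U fun V f => ∃ φ ∈ L.obj V, ∀ i,
        p.redMap V (coord φ i) = coord ((vec A₀ ι).res f c) i}
      zero_mem' := .of_forall fun V f => ⟨0, Submodule.zero_mem _, fun i => by simp⟩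
      add_mem' := fun {a b} ha hb => (ha.and hb).mono (by
        rintro V f ⟨⟨x, hx, hx'⟩, ⟨y, hy, hy'⟩⟩
        exact ⟨x + y, Submodule.add_mem _ hx hy, fun i => by
          simp only [coord_add, map_add, hx', hy']⟩)
      smul_mem' := fun r a ha => (Locally.and ha (p.exists_red r)).mono (by
        rintro V f ⟨⟨x, hx, hx'⟩, c, hc⟩
        refine ⟨c • x, Submodule.smul_mem _ _ hx, fun i => ?_⟩
        have hc' : p.redMap V c = A₀.rres f r := hc
        rw [coord_smul, map_mul, hx', res_smul, coord_smul, hc']) }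
  res_mem {_ _} f {m} hm := (hm.pullback f).mono (by
    rintro V g ⟨x, hx, hx'⟩
    exact ⟨x, hx, fun i => by rw [res_comp, hx']⟩)
  local_mem {U m} hm := hm.bind (by
    intro V f hf
    refine Locally.mono hf ?_
    rintro W g ⟨x, hx, hx'⟩
    exact ⟨x, hx, fun i => by rw [← res_comp, hx']⟩)

/-- The reduction of a section of `vec A ι`. -/
def redVec {U : C} (v : (vec A ι).Sec U) : (vec A₀ ι).Sec U := ofCoord fun i => p.redMap U (coord v i)

lemma coord_redVec {U : C} (v : (vec A ι).Sec U) (i : ι) :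
    coord (p.redVec v) i = p.redMap U (coord v i) := rfl

lemma redVec_res {U V : C} (f : V ⟶ U) (v : (vec A ι).Sec U) :
    (vec A₀ ι).res f (p.redVec v) = p.redVec ((vec A ι).res f v) :=
  coord_ext fun i => (p.redMap_rres f _).symm

lemma redVec_smul {U : C} (a : A.RSec U) (v : (vec A ι).Sec U) :
    p.redVec (a • v) = p.redMap U a • p.redVec v :=
  coord_ext fun i => map_mul (p.redMap U) _ _

lemma redVec_add {U : C} (v w : (vec A ι).Sec U) :
    p.redVec (v + w) = p.redVec v + p.redVec w :=
  coord_ext fun i => map_add (p.redMap U) _ _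

lemma redVec_sub {U : C} (v w : (vec A ι).Sec U) :
    p.redVec (v - w) = p.redVec v - p.redVec w :=
  coord_ext fun i => map_sub (p.redMap U) _ _

lemma redVec_sum {κ : Type*} (s : Finset κ) {U : C} (v : κ → (vec A ι).Sec U) :
    p.redVec (∑ k ∈ s, v k) = ∑ k ∈ s, p.redVec (v k) :=
  coord_ext fun i => by simp only [coord_redVec, coord_sum, map_sum]

lemma redVec_eq_zero_of_mem [Finite ι] {U : C} {v : (vec A ι).Sec U}
    (h : v ∈ (p.pow (vec A ι) 1).obj U) : p.redVec v = 0 := by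
  refine sec_zero_of_locally _ (Locally.mono h fun V f ⟨x, hx⟩ => coord_ext fun i => ?_)
  rw [redVec_res, ← hx, p.ev_mul, coord_redVec, coord_smul, map_mul, pow_one]
  exact mul_eq_zero_of_left (p.red_el V) _

lemma mem_pow_of_redVec [Finite ι] {U : C} {v : (vec A ι).Sec U} (h : p.redVec v = 0) :
    v ∈ (p.pow (vec A ι) 1).obj U :=
  p.vec_mem_pow fun i => (p.exists_mul (a := coord v i) (congr_fun (congr_arg coord h) i)).mono
    fun V f ⟨b, hb⟩ => ⟨b, by
      refine (p.ev_mul (unit A) 1 (id b : (unit A).Sec V)).trans ?_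
      rw [pow_one]
      exact hb.symm⟩

lemma exists_redVec [Finite ι] {U : C} (c : (vec A₀ ι).Sec U) :
    J.Locally U fun V f => ∃ v, p.redVec v = (vec A₀ ι).res f c :=
  (Locally.forall_finite fun i => p.exists_red (coord c i)).mono fun V f hx => by
    choose x hx using hx
    exact ⟨ofCoord x, coord_ext hx⟩

lemma redFamily_lfg {L : (vec A ι).SubFamily} (hL : L.sheaf.LFG) : (p.redFamily L).sheaf.LFG := by
  intro U
  refine (hL U).mono fun V f ⟨n, s, hs⟩ => ?_
  have hmem : ∀ i, p.redVec (ev L.incl V (s i)) ∈ (p.redFamily L).obj V := fun i =>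
    .of_forall fun W g => ⟨ev L.incl W (L.sheaf.res g (s i)), L.ev_incl_mem _, fun j => by
      rw [redVec_res, ev_res, coord_redVec]⟩
  choose t ht using fun i => (p.redFamily L).exists_ev_incl (hmem i)
  refine ⟨n, t, fun W g m => ?_⟩
  refine Locally.bind ((p.redFamily L).ev_incl_mem m) fun Z z ⟨φ, hφ, hφ'⟩ => ?_
  obtain ⟨l, hl⟩ := L.exists_ev_incl hφ
  refine (hs Z (z ≫ g) l).mono fun Y y ⟨a, ha⟩ => ⟨fun i => p.redMap Y (a i), ?_⟩
  refine (p.redFamily L).ev_incl_injective Y ?_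
  have h1 : p.redVec φ = (vec A₀ ι).res z (ev (p.redFamily L).incl W m) := coord_ext hφ'
  rw [ev_res, ← res_comp, ← h1, redVec_res, ← hl, ← ev_res, ha, map_sum, redVec_sum, map_sum]
  refine Finset.sum_congr rfl fun i _ => ?_
  rw [map_smul, map_smul, redVec_smul, ev_res, ev_res, ht, redVec_res, Category.assoc]

/-- Each `initial r` contains the multiples of `el`, so it is determined by its reduction; the
reductions form a chain of locally finitely generated submodules of a free `A₀`-module. -/
lemma stationary_initial [Fintype ι] (hM : IsCoherentModule M) (hN : IsChainNoetherian (vec A₀ ι)) :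
    Stationary (p.initial Y) := fun U => by
  refine (hN (fun r => p.redFamily (p.initial Y r)) (fun r U c hc => Locally.mono hc
    fun V f ⟨x, hx, hx'⟩ => ⟨x, p.initial_le Y r V hx, hx'⟩)
    (fun r => p.redFamily_lfg (p.initial_lfg Y hM r)) U).mono
    fun V f ⟨r₀, h⟩ => ⟨r₀, fun r hr W g φ hφ => ?_⟩
  have h1 : p.redVec φ ∈ (p.redFamily (p.initial Y r₀)).obj W :=
    h r hr W g _ (.of_forall fun Z z => ⟨(vec A ι).res z φ, (p.initial Y r).res_mem z hφ,
      fun i => by rw [redVec_res, coord_redVec]⟩)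
  refine (p.initial Y r₀).local_mem (Locally.mono h1 fun Z z ⟨x, hx, hx'⟩ => ?_)
  have h2 : p.redVec ((vec A ι).res z φ - x) = 0 := by
    rw [redVec_sub, ← redVec_res, sub_eq_zero]
    exact (coord_ext hx').symm
  have := Submodule.add_mem _ (p.pow_mem_initial Y r₀ (p.mem_pow_of_redVec h2)) hx
  rwa [sub_add_cancel] at this

end Initial

/-! ### Divisibility of torsion sections -/

section Torsion

variable [Fintype ι] {M : SheafOfModules.{u} A} {T : C} (hT : IsTerminal T) {y : ι → M.Sec T}
  (hy : M.Gen y) {N : ℕ} {κ : Type} [Fintype κ] {g : κ → (vec A ι).Sec T}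
  (hg : M.RelGen (fun i => p.el T ^ N • y i) (fun k => coord (g k)))
  (hN : ∀ r, N ≤ r → ∀ (W : C) (φ : (vec A ι).Sec W), φ ∈ (p.initial (lincomb M hT y) r).obj W →
    φ ∈ (p.initial (lincomb M hT y) N).obj W)

include hy in
lemma exists_lincomb {U : C} (m : M.Sec U) :
    J.Locally U fun V f => ∃ φ, ev (lincomb M hT y) V φ = M.res f m :=
  (hy U (hT.from U) m).mono fun V f ⟨a, ha⟩ => ⟨ofCoord a, by
    rw [ha, ev_lincomb, hT.comp_from]
    rfl⟩

lemma pow_smul_lincomb {U : C} (φ : (vec A ι).Sec U) : p.el U ^ N • ev (lincomb M hT y) U φ =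
    ∑ i, coord φ i • M.res (hT.from U) (p.el T ^ N • y i) := by
  rw [ev_lincomb, Finset.smul_sum]
  refine Finset.sum_congr rfl fun i _ => ?_
  rw [res_smul, p.rres_el_pow, smul_smul, smul_smul, p.pow_central]

include hg in
lemma pow_smul_lincomb_lincomb {U : C} (c : (vec A κ).Sec U) :
    p.el U ^ N • ev (lincomb M hT y) U (ev (lincomb (vec A ι) hT g) U c) = 0 := by
  rw [ev_lincomb (vec A ι), map_sum, Finset.smul_sum]
  refine Finset.sum_eq_zero fun k _ => ?_
  rw [map_smul, smul_smul, p.pow_central, mul_smul, ev_res, ← p.rres_el_pow (hT.from U), ← res_smul,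
    p.pow_smul_lincomb hT]
  have := hg.1 k
  rw [hT.hom_ext (hT.from T) (𝟙 T)]
  simp only [res_id]
  rw [this, map_zero, smul_zero]

include hg in
lemma exists_of_pow_smul_lincomb {U : C} {φ : (vec A ι).Sec U}
    (h : p.el U ^ N • ev (lincomb M hT y) U φ = 0) :
    J.Locally U fun V f => ∃ c, (vec A ι).res f φ = ev (lincomb (vec A ι) hT g) V c := by
  rw [pow_smul_lincomb] at h
  refine (hg.2 U (hT.from U) (coord φ) h).mono fun V f ⟨b, hb⟩ => ⟨ofCoord b, coord_ext fun i => ?_⟩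
  rw [coord_res, hb, ev_lincomb, coord_sum, hT.comp_from]
  rfl

include hy hg in
/-- The elements of `initial N` are sums of multiples of `el` and of relations. -/
lemma exists_of_mem_initial {U : C} {φ : (vec A ι).Sec U}
    (h : φ ∈ (p.initial (lincomb M hT y) N).obj U) :
    J.Locally U fun V f => ∃ ψ c, (vec A ι).res f φ =
      p.el V • ψ + ev (lincomb (vec A ι) hT g) V c := by
  refine Locally.bind h fun V f ⟨m, hm⟩ => ?_
  refine (exists_lincomb hT hy m).bind fun W w ⟨ψ, hψ⟩ => ?_
  -- From `el^N Yφ = el^{N+1} Yψ`, the difference `φ - el ψ` is a relation between the `el^N yᵢ`,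
  -- hence locally a combination of `g`.
  have h0 : p.el W ^ N • ev (lincomb M hT y) W ((vec A ι).res (w ≫ f) φ - p.el W • ψ) = 0 := by
    have := congr_arg (M.res w) hm
    rw [p.ev_mul, res_smul, p.rres_el_pow, ← hψ, ev_comp, p.ev_mul, res_comp, res_smul,
      p.rres_el_pow, ← ev_res] at this
    rw [map_sub, smul_sub, ← this, map_smul, smul_smul, pow_succ, sub_self]
  refine (p.exists_of_pow_smul_lincomb hT hg h0).mono fun Z z ⟨c, hc⟩ =>
    ⟨(vec A ι).res z ψ, c, ?_⟩
  rw [← hc, map_sub, res_comp, res_smul, p.rres_el, Category.assoc, add_sub_cancel]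

include hy hN in
/-- A torsion section divisible by `el ^ N` is infinitely divisible. -/
lemma mem_pow_of_torsion {U : C} {s : M.Sec U} (hs : s ∈ (p.pow M N).obj U) (h0 : p.el U • s = 0)
    (n : ℕ) : s ∈ (p.pow M (N + n)).obj U := by
  induction n with
  | zero => exact hs
  | succ n ih =>
    refine (p.pow M _).local_mem (Locally.bind ih fun V f ⟨m, hm⟩ => ?_)
    refine (exists_lincomb hT hy m).mono fun W w ⟨φ, hφ⟩ => ?_
    have h1 : p.el W ^ (N + n) • ev (lincomb M hT y) W φ = M.res (w ≫ f) s := by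
      rw [hφ, ← res_comp, ← hm, p.ev_mul, res_smul, p.rres_el_pow]
    -- Here `el^{N+n+1} Yφ = el s = 0` is trivially divisible. Stability brings `φ` down to `initial
    -- N`, and multiplying back by `el^n` gains one power of `el` for `s`.
    have h2 : φ ∈ (p.initial (lincomb M hT y) (N + n + 1)).obj W := by
      rw [mem_initial, pow_succ', mul_smul, h1, ← p.rres_el (w ≫ f), ← res_smul, h0, map_zero]
      exact Submodule.zero_mem _
    have h3 := hN _ (by omega) W φ h2
    rw [mem_initial] at h3
    have h4 := p.pow_smul_mem_add (a := n) h3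
    rw [smul_smul, ← pow_add, add_comm n N, h1] at h4
    rwa [show N + (n + 1) = n + (N + 1) by omega]

end Torsion

end FormalParameter

end Site
end

noncomputable section
open CategoryTheory.GrothendieckTopology SheafOfModules

section Site

variable {C : Type u} [SmallCategory C] {J : GrothendieckTopology C}

/-- The section of a subsheaf given by a section of the ambient sheaf. -/
def SheafOfModules.SubFamily.mkSec {R : Sheaf J RingCat.{u}} {M : SheafOfModules.{u} R}
    (N : M.SubFamily) {U : C} (m : M.Sec U) (hm : m ∈ N.obj U) : N.sheaf.Sec U := ⟨m, hm⟩

namespace FormalParameter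

variable {A A₀ : Sheaf J RingCat.{u}} (p : FormalParameter A A₀)

/-! ### Approximate solutions of a linear equation -/

section Tower

variable {T : C} (hT : IsTerminal T) {ι κ : Type} [Fintype κ] (f : (vec A ι).Sec T)
  (g : κ → (vec A ι).Sec T)

/-- The morphism `(a, t) ↦ a • g - t • f`. -/
def towerMap : vec A (Option κ) ⟶ vec A ι := lincomb _ hT (fun o => o.elim (-f) g)

/-- The inclusion `a ↦ (a, 0)`. -/
def towerInc : vec A κ ⟶ vec A (Option κ) := vecMap id

omit [Fintype κ] in
lemma coord_towerInc_some {U : C} (a : (vec A κ).Sec U) (k : κ) :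
    coord (ev towerInc U a) (some k) = coord a k := rfl

omit [Fintype κ] in
lemma coord_towerInc_none {U : C} (a : (vec A κ).Sec U) : coord (ev towerInc U a) none = 0 := rfl

/-- Approximate solutions of `a·g = f` form only a torsor. The extra coordinate `t`, at index
`none`, homogenizes the equation to `a·g = t f`, so that one works with modules; genuine solutions
are recovered at `t = 1`. -/
lemma ev_towerMap {U : C} (v : (vec A (Option κ)).Sec U) :
    ev (towerMap hT f g) U v = ev (lincomb _ hT g) U (ofCoord fun k => coord v (some k)) -
      coord v none • (vec A ι).res (hT.from U) f := by
  rw [towerMap, ev_lincomb, ev_lincomb, Fintype.sum_option]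
  simp only [Option.elim_none, map_neg, smul_neg, Option.elim_some, coord_ofCoord]
  abel

lemma ev_towerMap_towerInc {U : C} (a : (vec A κ).Sec U) :
    ev (towerMap hT f g) U (ev towerInc U a) = ev (lincomb _ hT g) U a := by
  rw [ev_towerMap, coord_towerInc_none, zero_smul, sub_zero]
  rfl

/-- The pairs `(a, t)` such that `a • g - t • f` is divisible by `el ^ (n + 1)`. -/
def towerSub (n : ℕ) : (vec A (Option κ)).SubFamily :=
  SubFamily.comap (towerMap hT f g) (p.pow (vec A ι) (n + 1))

lemma mem_towerSub {n : ℕ} {U : C} {v : (vec A (Option κ)).Sec U} :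
    v ∈ (p.towerSub hT f g n).obj U ↔ ev (towerMap hT f g) U v ∈ (p.pow (vec A ι) (n + 1)).obj U :=
  Iff.rfl

lemma towerSub_succ_le {n : ℕ} {U : C} {v : (vec A (Option κ)).Sec U}
    (hv : v ∈ (p.towerSub hT f g (n + 1)).obj U) : v ∈ (p.towerSub hT f g n).obj U :=
  p.pow_succ_le hv

lemma pow_smul_towerInc_mem (n : ℕ) {U : C} (a : (vec A κ).Sec U) :
    p.el U ^ (n + 1) • ev towerInc U a ∈ (p.towerSub hT f g n).obj U := by
  rw [mem_towerSub, map_smul]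
  exact p.pow_smul_mem _ _

/-- The inclusion of the multiples `(el ^ (n + 1) • a, 0)`. -/
def towerRel (n : ℕ) : vec A κ ⟶ (p.towerSub hT f g n).sheaf :=
  (p.towerSub hT f g n).lift (towerInc ≫ p.mul _ (n + 1))
    fun _ a => p.pow_smul_towerInc_mem hT f g n a

/-- The pairs `(a, t)`, with `a` modulo `el ^ (n + 1)`, such that `a • g - t • f` is divisible by
`el ^ (n + 1)`. -/
def towerObj (n : ℕ) : SheafOfModules.{u} A := cokernel (p.towerRel hT f g n)

/-- The projection to `towerObj`. -/
def towerProj (n : ℕ) : (p.towerSub hT f g n).sheaf ⟶ p.towerObj hT f g n :=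
  cokernel.π (p.towerRel hT f g n)

instance (n : ℕ) : Epi (p.towerProj hT f g n) :=
  inferInstanceAs (Epi (cokernel.π (p.towerRel hT f g n)))

/-- The class in `towerObj` of a pair. -/
def towerMk (n : ℕ) {U : C} (v : (vec A (Option κ)).Sec U)
    (hv : v ∈ (p.towerSub hT f g n).obj U) : (p.towerObj hT f g n).Sec U :=
  ev (p.towerProj hT f g n) U ((p.towerSub hT f g n).mkSec v hv)

lemma towerMk_res (n : ℕ) {U V : C} (i : V ⟶ U) (v : (vec A (Option κ)).Sec U)
    (hv : v ∈ (p.towerSub hT f g n).obj U) :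
    (p.towerObj hT f g n).res i (p.towerMk hT f g n v hv) =
      p.towerMk hT f g n ((vec A (Option κ)).res i v) ((p.towerSub hT f g n).res_mem i hv) :=
  (ev_res (p.towerProj hT f g n) i _).symm

lemma towerMk_sub (n : ℕ) {U : C} {v w : (vec A (Option κ)).Sec U}
    (hv : v ∈ (p.towerSub hT f g n).obj U) (hw : w ∈ (p.towerSub hT f g n).obj U) :
    p.towerMk hT f g n v hv - p.towerMk hT f g n w hw =
      p.towerMk hT f g n (v - w) (Submodule.sub_mem _ hv hw) :=
  (map_sub (ev (p.towerProj hT f g n) U) _ _).symm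

lemma exists_towerMk (n : ℕ) {U : C} (e : (p.towerObj hT f g n).Sec U) :
    J.Locally U fun V i => ∃ v hv, p.towerMk hT f g n v hv = (p.towerObj hT f g n).res i e :=
  (exists_ev_of_epi (p.towerProj hT f g n) e).mono fun V i ⟨v, hv⟩ => ⟨v.1, v.2, hv⟩

lemma towerMk_eq_zero (n : ℕ) {U : C} {v : (vec A (Option κ)).Sec U}
    {hv : v ∈ (p.towerSub hT f g n).obj U} (h : p.towerMk hT f g n v hv = 0) :
    J.Locally U fun V i => ∃ a, p.el V ^ (n + 1) • ev towerInc V a = (vec A (Option κ)).res i v :=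
  (exists_ev_of_cokernel (p.towerRel hT f g n) h).mono fun V i ⟨a, ha⟩ =>
    ⟨a, congr_arg (ev (p.towerSub hT f g n).incl V) ha⟩

lemma towerMk_pow_smul (n : ℕ) {U : C} (a : (vec A κ).Sec U)
    (h : p.el U ^ (n + 1) • ev towerInc U a ∈ (p.towerSub hT f g n).obj U) :
    p.towerMk hT f g n _ h = 0 :=
  ev_cokernel (p.towerRel hT f g n) a

/-- The inclusion of the subsheaves defining the tower. -/
def towerIncl (n : ℕ) : (p.towerSub hT f g (n + 1)).sheaf ⟶ (p.towerSub hT f g n).sheaf :=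
  (p.towerSub hT f g n).lift (p.towerSub hT f g (n + 1)).incl
    fun _ m => p.towerSub_succ_le hT f g m.2

/-- The transition morphism of the tower. -/
def towerTrans (n : ℕ) : p.towerObj hT f g (n + 1) ⟶ p.towerObj hT f g n :=
  cokernel.desc (p.towerRel hT f g (n + 1)) (p.towerIncl hT f g n ≫ p.towerProj hT f g n) <| by
    have : p.towerRel hT f g (n + 1) ≫ p.towerIncl hT f g n =
        p.mul _ 1 ≫ p.towerRel hT f g n := hom_ext_ev fun U a => by
      refine (p.towerSub hT f g n).ev_incl_injective U ?_
      change p.el U ^ (n + 1 + 1) • ev towerInc U a = p.el U ^ (n + 1) • ev towerInc U (p.el U ^ 1 • a)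
      rw [map_smul, smul_smul, pow_succ _ (n + 1), pow_one]
    rw [← Category.assoc, this, Category.assoc]
    exact (congr_arg _ (cokernel.condition (p.towerRel hT f g n))).trans comp_zero

lemma towerProj_towerTrans (n : ℕ) : p.towerProj hT f g (n + 1) ≫ p.towerTrans hT f g n =
    p.towerIncl hT f g n ≫ p.towerProj hT f g n := cokernel.π_desc _ _ _

lemma ev_towerTrans (n : ℕ) {U : C} (v : (vec A (Option κ)).Sec U)
    (hv : v ∈ (p.towerSub hT f g (n + 1)).obj U) :
    ev (p.towerTrans hT f g n) U (p.towerMk hT f g (n + 1) v hv) =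
      p.towerMk hT f g n v (p.towerSub_succ_le hT f g hv) :=
  congr($(congr_arg (fun φ => ev φ U) (p.towerProj_towerTrans hT f g n))
    ((p.towerSub hT f g (n + 1)).mkSec v hv))

/-- The coefficients of the relations between the reductions of `g`. -/
def redRel : (vec A₀ κ).SubFamily :=
  kerFamily (lincomb (vec A₀ ι) hT fun k => p.redVec (g k))

lemma redVec_lincomb {U : C} (a : (vec A κ).Sec U) :
    p.redVec (ev (lincomb (vec A ι) hT g) U a) =
      ev (lincomb (vec A₀ ι) hT fun k => p.redVec (g k)) U (p.redVec a) := by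
  rw [ev_lincomb, ev_lincomb, redVec_sum]
  refine Finset.sum_congr rfl fun k _ => ?_
  rw [redVec_smul, redVec_res, coord_redVec]

/-- The coefficients `a` such that `a • g` is divisible by `el`. -/
def towerRelSub : (vec A κ).SubFamily :=
  SubFamily.comap (lincomb (vec A ι) hT g) (p.pow (vec A ι) 1)

/-- The reduction of the coefficients. -/
def towerRed [Finite ι] : (p.towerRelSub hT g).sheaf ⟶
    (restrictScalars p.red).obj (p.redRel hT g).sheaf :=
  homOfEv (N := (restrictScalars p.red).obj (p.redRel hT g).sheaf) (fun U =>
    { toFun a := (⟨p.redVec a.1, by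
        change ev _ U _ = 0
        rw [← redVec_lincomb]
        exact p.redVec_eq_zero_of_mem a.2⟩ : (p.redRel hT g).obj U)
      map_add' a b := Subtype.ext (p.redVec_add a.1 b.1)
      map_smul' r a := Subtype.ext (p.redVec_smul r a.1) })
    (fun {U V} i a => Subtype.ext (p.redVec_res i a.1).symm)

lemma ev_towerRed [Finite ι] {U : C} (a : (p.towerRelSub hT g).sheaf.Sec U) :
    ev (p.redRel hT g).incl U (ev (p.towerRed hT g) U a) =
      p.redVec (ev (p.towerRelSub hT g).incl U a) := rfl

lemma exists_towerRed [Finite ι] {U : C}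
    (c : ((restrictScalars p.red).obj (p.redRel hT g).sheaf).Sec U) :
    J.Locally U fun V i => ∃ a ha, ev (p.towerRed hT g) V ((p.towerRelSub hT g).mkSec a ha) =
      ((restrictScalars p.red).obj (p.redRel hT g).sheaf).res i c := by
  refine (p.exists_redVec (ev (p.redRel hT g).incl U c)).mono fun V i ⟨a, ha⟩ => ?_
  have h : a ∈ (p.towerRelSub hT g).obj V := by
    refine p.mem_pow_of_redVec ?_
    rw [redVec_lincomb, ha]
    exact (p.redRel hT g).res_mem i c.2
  exact ⟨a, h, Subtype.ext ha⟩

instance [Finite ι] : Epi (p.towerRed hT g) := epi_of_ev _ fun _ c =>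
  (p.exists_towerRed hT g c).mono fun _ _ ⟨_, _, ha⟩ => ⟨_, ha⟩

lemma towerShift_mem (n : ℕ) {U : C} {a : (vec A κ).Sec U} (ha : a ∈ (p.towerRelSub hT g).obj U) :
    p.el U ^ (n + 1) • ev towerInc U a ∈ (p.towerSub hT f g (n + 1)).obj U := by
  rw [mem_towerSub, map_smul, ev_towerMap_towerInc]
  exact p.pow_smul_mem_add ha

/-- The morphism `a ↦ (el ^ (n + 1) • a, 0)`. -/
def towerShift (n : ℕ) : (p.towerRelSub hT g).sheaf ⟶ (p.towerSub hT f g (n + 1)).sheaf :=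
  (p.towerSub hT f g (n + 1)).lift ((p.towerRelSub hT g).incl ≫ towerInc ≫ p.mul _ (n + 1))
    fun _ a => p.towerShift_mem hT f g n a.2

lemma ev_towerShift (n : ℕ) {U : C} (a : (p.towerRelSub hT g).sheaf.Sec U) :
    ev (p.towerShift hT f g n ≫ p.towerProj hT f g (n + 1)) U a =
      p.towerMk hT f g (n + 1) (p.el U ^ (n + 1) • ev towerInc U (ev (p.towerRelSub hT g).incl U a))
        (p.towerShift_mem hT f g n ((p.towerRelSub hT g).ev_incl_mem a)) := rfl

variable [Finite ι]

/-- If `a` reduces to zero then locally `a = el b`, and `el^{n+1} a = el^{n+2} b` is one of the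
elements divided out at level `n + 1`. -/
lemma kernel_towerRed_comp (n : ℕ) : kernel.ι (p.towerRed hT g) ≫
    (p.towerShift hT f g n ≫ p.towerProj hT f g (n + 1)) = 0 := hom_ext_ev fun U k => by
  have h1 : p.redVec (ev (p.towerRelSub hT g).incl U (ev (kernel.ι (p.towerRed hT g)) U k)) = 0 := by
    rw [← ev_towerRed, ev_kernel]
    rfl
  refine sec_zero_of_locally _ (Locally.mono (p.mem_pow_of_redVec h1) fun V i ⟨b, hb⟩ => ?_)
  rw [← ev_res, ev_comp, ev_towerShift]
  refine Eq.trans ?_ (p.towerMk_pow_smul hT f g (n + 1) b (p.pow_smul_towerInc_mem hT f g _ b))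
  congr 1
  rw [ev_res, ev_res, ← hb, p.ev_mul, pow_one, map_smul, smul_smul, ← pow_succ]

/-- The inclusion of the kernel of the transition morphism. -/
def towerKer (n : ℕ) : (restrictScalars p.red).obj (p.redRel hT g).sheaf ⟶
    p.towerObj hT f g (n + 1) :=
  Abelian.epiDesc (p.towerRed hT g) (p.towerShift hT f g n ≫ p.towerProj hT f g (n + 1))
    (p.kernel_towerRed_comp hT f g n)

lemma towerRed_towerKer (n : ℕ) : p.towerRed hT g ≫ p.towerKer hT f g n =
    p.towerShift hT f g n ≫ p.towerProj hT f g (n + 1) := Abelian.comp_epiDesc _ _ _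

lemma ev_towerKer (n : ℕ) {U : C} {a : (vec A κ).Sec U} (ha : a ∈ (p.towerRelSub hT g).obj U) :
    ev (p.towerKer hT f g n) U (ev (p.towerRed hT g) U ((p.towerRelSub hT g).mkSec a ha)) =
      p.towerMk hT f g (n + 1) _ (p.towerShift_mem hT f g n ha) := by
  rw [← ev_comp, towerRed_towerKer]
  rfl

lemma towerKer_towerTrans (n : ℕ) : p.towerKer hT f g n ≫ p.towerTrans hT f g n = 0 := by
  rw [← cancel_epi (p.towerRed hT g), comp_zero, ← Category.assoc, towerRed_towerKer]
  refine hom_ext_ev fun U a => ?_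
  rw [ev_comp, ev_towerShift, ev_towerTrans]
  exact p.towerMk_pow_smul hT f g n _ (p.pow_smul_towerInc_mem hT f g n _)

/-- The equality `el^{n+1} a = el^{n+2} b` gives `a = el b`, as `el` is not a zero divisor; so the
reduction of `a` vanishes. -/
lemma mono_towerKer (n : ℕ) : Mono (p.towerKer hT f g n) := by
  refine mono_of_ev _ fun U c hc => sec_zero_of_locally _ ?_
  refine (p.exists_towerRed hT g c).bind fun V i ⟨a, ha, hac⟩ => ?_
  have h0 : p.towerMk hT f g (n + 1) _ (p.towerShift_mem hT f g n ha) = 0 := by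
    rw [← p.ev_towerKer hT f g n ha, hac, ev_res, hc, map_zero]
  refine (p.towerMk_eq_zero hT f g (n + 1) h0).mono fun W j ⟨b, hb⟩ => ?_
  rw [res_smul, p.rres_el_pow, ← ev_res, pow_succ, mul_smul, ← map_smul] at hb
  have h1 := p.vec_smul_injective hb
  rw [← res_comp, ← hac, ← ev_res]
  refine (p.redRel hT g).ev_incl_injective W ?_
  rw [ev_towerRed]
  refine (p.redVec_eq_zero_of_mem (.of_forall fun Z z => ⟨(vec A κ).res z b, ?_⟩)).trans
    (map_zero (ev (p.redRel hT g).incl W)).symm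
  rw [p.ev_mul, pow_one, ← p.rres_el z, ← res_smul]
  congr 1
  refine coord_ext fun k => ?_
  have := congr_fun (congr_arg coord h1) (some k)
  rwa [coord_towerInc_some, coord_towerInc_some] at this

/-- A pair that dies at level `n` is `(el^{n+1} a, 0)`, and belonging to level `n + 1` forces `a·g`
to be divisible by `el`. The kernel is the same `A₀`-module for all `n`, so one vanishing of
cohomology serves the whole tower. -/
lemma exact_towerKer (n : ℕ) : (ShortComplex.mk (p.towerKer hT f g n) (p.towerTrans hT f g n)
    (p.towerKer_towerTrans hT f g n)).Exact := by
  refine exact_of_ev _ fun U e he => ?_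
  refine (p.exists_towerMk hT f g (n + 1) e).bind fun V i ⟨v, hv, hve⟩ => ?_
  have h0 : p.towerMk hT f g n v (p.towerSub_succ_le hT f g hv) = 0 := by
    rw [← p.ev_towerTrans hT f g n v hv, hve, ev_res]
    exact (congr_arg _ he).trans (map_zero _)
  refine (p.towerMk_eq_zero hT f g n h0).mono fun W j ⟨a, ha⟩ => ?_
  have hv' := (p.towerSub hT f g (n + 1)).res_mem j hv
  have hmem : a ∈ (p.towerRelSub hT g).obj W := by
    refine p.vec_mem_pow_of_smul (a := n + 1) ?_
    rw [← ev_towerMap_towerInc hT f g, ← map_smul, ha]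
    exact hv'
  refine ⟨ev (p.towerRed hT g) W ((p.towerRelSub hT g).mkSec a hmem), ?_⟩
  refine (p.ev_towerKer hT f g n hmem).trans ?_
  change _ = (p.towerObj hT f g (n + 1)).res _ e
  rw [← res_comp, ← hve, towerMk_res]
  congr 1

/-- The solvability of the next approximation. -/
def Improvable : Prop :=
  ∀ (U : C) (n : ℕ) (v : (vec A (Option κ)).Sec U) (φ : (vec A ι).Sec U),
    ev (towerMap hT f g) U v = p.el U ^ (n + 1) • φ →
    J.Locally U fun V i => ∃ ψ c, (vec A ι).res i φ = p.el V • ψ + ev (lincomb (vec A ι) hT g) V c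

variable {hT f g}

omit [Finite ι] in
-- If the error of `(a, t)` is `el^{n+1}(el ψ + c·g)`, then `(a - el^{n+1}c, t)` has error
-- `el^{n+2}ψ` and the same class at level `n`.
lemma Improvable.epi_towerTrans (H : p.Improvable hT f g) (n : ℕ) :
    Epi (p.towerTrans hT f g n) := by
  refine epi_of_ev _ fun U e => ?_
  refine (p.exists_towerMk hT f g n e).bind fun V i ⟨v, hv, hve⟩ => ?_
  refine Locally.bind hv fun W j ⟨φ, hφ⟩ => ?_
  rw [← ev_res] at hφ
  refine (H W n _ φ hφ.symm).mono fun Z z ⟨ψ, c, hψ⟩ => ?_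
  have h1 : (vec A (Option κ)).res (z ≫ j) v - p.el Z ^ (n + 1) • ev towerInc Z c ∈
      (p.towerSub hT f g (n + 1)).obj Z := by
    rw [mem_towerSub, map_sub, map_smul, ev_towerMap_towerInc, ← res_comp, ev_res, ← hφ, p.ev_mul,
      res_smul, p.rres_el_pow, hψ, ← smul_sub, add_sub_cancel_right, smul_smul, ← pow_succ]
    exact p.pow_smul_mem _ _
  refine ⟨p.towerMk hT f g (n + 1) _ h1, ?_⟩
  rw [p.ev_towerTrans hT f g n _ h1, ← p.towerMk_sub hT f g n ((p.towerSub hT f g n).res_mem _ hv)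
    (p.pow_smul_towerInc_mem hT f g n c), towerMk_pow_smul, sub_zero, ← p.towerMk_res hT f g n _ v hv,
    hve, res_comp, Category.assoc]

end Tower

/-! ### Exact solutions -/

/-- Compatible sections of the quotients by the powers of `el` come from a section of `A`. -/
structure IsComplete : Prop where
  exists_limit : ∀ (U : C) (Z : ℕ → ∀ V : C, (V ⟶ U) → Set ((unit A).Sec V)),
    (∀ n V (i : V ⟶ U) W (j : W ⟶ V), ∀ a ∈ Z n V i, (unit A).res j a ∈ Z n W (j ≫ i)) →
    (∀ n, J.Locally U fun V i => (Z n V i).Nonempty) →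
    (∀ n V (i : V ⟶ U), ∀ a ∈ Z n V i, ∀ b ∈ Z n V i, a - b ∈ (p.pow (unit A) (n + 1)).obj V) →
    (∀ n V (i : V ⟶ U), Z (n + 1) V i ⊆ Z n V i) →
    ∃ a : (unit A).Sec U, ∀ n V (i : V ⟶ U), ∀ b ∈ Z n V i,
      (unit A).res i a - b ∈ (p.pow (unit A) (n + 1)).obj V
  eq_zero : ∀ (U : C) (a : (unit A).Sec U), (∀ n, a ∈ (p.pow (unit A) (n + 1)).obj U) → a = 0

/-- For towers of extensions by `P`, every section over `T` lifts compatibly over `T'`. -/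
def LiftsTowers (P : SheafOfModules.{u} A₀) {T T' : C} (i : T' ⟶ T) : Prop :=
  ∀ (E : ℕ → SheafOfModules.{u} A) (q : ∀ n, E (n + 1) ⟶ E n)
    (j : ∀ n, (restrictScalars p.red).obj P ⟶ E (n + 1)) (w : ∀ n, j n ≫ q n = 0),
    (∀ n, (ShortComplex.mk (j n) (q n) (w n)).ShortExact) → ∀ e : (E 0).Sec T,
      ∃ e' : ∀ n, (E n).Sec T', e' 0 = (E 0).res i e ∧ ∀ n, ev (q n) T' (e' (n + 1)) = e' n

section Solve

variable {T : C} {hT : IsTerminal T} {ι κ : Type} [Finite ι] [Fintype κ] {f : (vec A ι).Sec T}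
  {g : κ → (vec A ι).Sec T}

-- The hypothesis on `f` says that `(c, 1)` solves the equation modulo `el`. Its class is lifted
-- through the tower over `T'`; the coordinates of the lifts converge by completeness, and the error
-- of the limit lies in every power of `el`, hence is zero.
variable {p} in
lemma IsComplete.exists_lincomb_eq (hp : p.IsComplete) (H : p.Improvable hT f g) {T' : C}
    (i : T' ⟶ T)
    (hL : p.LiftsTowers (p.redRel hT g).sheaf i) {c : (vec A κ).Sec T} {ψ : (vec A ι).Sec T}
    (hf : f = p.el T • ψ + ev (lincomb (vec A ι) hT g) T c) :
    ∃ a : (vec A κ).Sec T', ev (lincomb (vec A ι) hT g) T' a = (vec A ι).res i f := by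
  let c' : (vec A (Option κ)).Sec T := ofCoord fun o => o.elim 1 (coord c)
  have hc' : c' ∈ (p.towerSub hT f g 0).obj T := by
    have : ev (towerMap hT f g) T c' = p.el T ^ (0 + 1) • (-ψ) := by
      rw [ev_towerMap, hT.hom_ext (hT.from T) (𝟙 T), res_id]
      change ev (lincomb (vec A ι) hT g) T c - (1 : A.RSec T) • f = _
      rw [one_smul, zero_add, pow_one, smul_neg]
      rw [sub_eq_iff_eq_add, neg_add_eq_sub]
      exact (sub_eq_of_eq_add' hf).symm
    rw [mem_towerSub, this]
    exact p.pow_smul_mem _ _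
  obtain ⟨e, he0, he⟩ := hL (p.towerObj hT f g) (p.towerTrans hT f g) (p.towerKer hT f g)
    (p.towerKer_towerTrans hT f g) (fun n =>
      { exact := p.exact_towerKer hT f g n
        mono_f := p.mono_towerKer hT f g n
        epi_g := H.epi_towerTrans p n }) (p.towerMk hT f g 0 c' hc')
  have trans : ∀ n {V : C} (j : V ⟶ T') (v : (vec A (Option κ)).Sec V)
      (hv : v ∈ (p.towerSub hT f g (n + 1)).obj V),
      p.towerMk hT f g (n + 1) v hv = (p.towerObj hT f g (n + 1)).res j (e (n + 1)) →
      p.towerMk hT f g n v (p.towerSub_succ_le hT f g hv) =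
        (p.towerObj hT f g n).res j (e n) := by
    intro n V j v hv h
    rw [← p.ev_towerTrans hT f g n v hv, h, ev_res, he]
  have diff : ∀ n {V : C} (j : V ⟶ T') (v w : (vec A (Option κ)).Sec V)
      (hv : v ∈ (p.towerSub hT f g n).obj V) (hw : w ∈ (p.towerSub hT f g n).obj V),
      p.towerMk hT f g n v hv = (p.towerObj hT f g n).res j (e n) →
      p.towerMk hT f g n w hw = (p.towerObj hT f g n).res j (e n) →
      J.Locally V fun W l => ∃ a, p.el W ^ (n + 1) • ev towerInc W a =
        (vec A (Option κ)).res l (v - w) := by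
    intro n V j v w hv hw h h'
    refine p.towerMk_eq_zero hT f g n (hv := Submodule.sub_mem _ hv hw) ?_
    rw [← p.towerMk_sub hT f g n hv hw, h, h', sub_self]
  -- The coordinate `t` remains exactly `1`, not only modulo powers of `el`, because the elements
  -- divided out have `t = 0`.
  have hone : ∀ n {V : C} (j : V ⟶ T') (v : (vec A (Option κ)).Sec V)
      (hv : v ∈ (p.towerSub hT f g n).obj V),
      p.towerMk hT f g n v hv = (p.towerObj hT f g n).res j (e n) → coord v none = 1 := by
    intro n
    induction n with
    | zero =>
      intro V j v hv h
      have h' := diff 0 j v ((vec A (Option κ)).res (j ≫ i) c') hv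
        ((p.towerSub hT f g 0).res_mem _ hc') h (by rw [← towerMk_res, he0, res_comp])
      refine sub_eq_zero.1 ((unit A).sec_zero_of_locally (m := (coord v none - 1 : A.RSec V))
        (h'.mono fun W l ⟨a, ha⟩ => ?_))
      have := congr_fun (congr_arg coord ha) none
      rw [coord_smul, coord_towerInc_none, mul_zero, coord_res, coord_sub, coord_res] at this
      have h1 : A.rres (j ≫ i) (coord c' none) = 1 := map_one _
      rw [h1] at this
      exact this.symm
    | succ n ih => exact fun {V} j v hv h => ih j v _ (trans n j v hv h)
  have hcoord : ∀ k : κ, ∃ a : (unit A).Sec T', ∀ n V (j : V ⟶ T')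
      (v : (vec A (Option κ)).Sec V) (hv : v ∈ (p.towerSub hT f g n).obj V),
      p.towerMk hT f g n v hv = (p.towerObj hT f g n).res j (e n) →
      (unit A).res j a - (id (coord v (some k)) : (unit A).Sec V) ∈
        (p.pow (unit A) (n + 1)).obj V := by
    intro k
    -- The `n`-th set consists of the `k`-th coordinates of all local representatives of `e n`; two
    -- of these differ by a multiple of `el^{n+1}`.
    refine (hp.exists_limit T' (fun n V j => {b | ∃ v hv,
      p.towerMk hT f g n v hv = (p.towerObj hT f g n).res j (e n) ∧ coord v (some k) = b}) ?_ ?_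
      ?_ ?_).imp fun a ha n V j v hv h => ha n V j _ ⟨v, hv, h, rfl⟩
    · rintro n V j W l _ ⟨v, hv, h, rfl⟩
      exact ⟨(vec A (Option κ)).res l v, (p.towerSub hT f g n).res_mem l hv, by
        rw [← p.towerMk_res hT f g n l v hv, h, res_comp], rfl⟩
    · exact fun n => (p.exists_towerMk hT f g n (e n)).mono fun V j ⟨v, hv, h⟩ =>
        ⟨_, v, hv, h, rfl⟩
    · rintro n V j _ ⟨v, hv, h, rfl⟩ _ ⟨w, hw, h', rfl⟩
      refine (diff n j v w hv hw h h').mono fun W l ⟨a, ha⟩ => ⟨(id (coord a k) : A.RSec W), ?_⟩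
      exact congr_fun (congr_arg coord ha) (some k)
    · rintro n V j _ ⟨v, hv, h, rfl⟩
      exact ⟨v, _, trans n j v hv h, rfl⟩
  choose a ha using hcoord
  refine ⟨ofCoord a, sub_eq_zero.1 (coord_ext fun l => hp.eq_zero T' _ fun n => ?_)⟩
  refine p.ev_mem_pow (proj A l) (m := _ - (vec A ι).res i f) ?_
  refine (p.pow _ _).local_mem ((p.exists_towerMk hT f g n (e n)).mono fun V j ⟨v, hv, h⟩ => ?_)
  -- The limit pair `(a, 1)` differs from a representative `v` of `e n` by a multiple of `el^{n+1}`,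
  -- so its error is divisible by `el^{n+1}` as that of `v` is.
  let w : (vec A (Option κ)).Sec V := ofCoord fun o => o.elim 1 fun k => A.rres j (a k)
  have hw : (vec A ι).res j (ev (lincomb (vec A ι) hT g) T' (ofCoord a) - (vec A ι).res i f) =
      ev (towerMap hT f g) V w := by
    rw [ev_towerMap, map_sub, ← ev_res, res_comp, hT.hom_ext (j ≫ i) (hT.from V)]
    change _ = _ - (1 : A.RSec V) • _
    rw [one_smul]
    rfl
  have hwv : w - v ∈ (p.pow (vec A (Option κ)) (n + 1)).obj V := by
    refine p.vec_mem_pow fun o => ?_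
    cases o with
    | none =>
      have : coord (w - v) none = 0 := by
        rw [coord_sub, hone n j v hv h]
        exact sub_self 1
      rw [this]
      exact Submodule.zero_mem _
    | some k => exact ha k n V j v hv h
  have := Submodule.add_mem _ (p.ev_mem_pow (towerMap hT f g) hwv) hv
  rw [map_sub, sub_add_cancel] at this
  rw [hw]
  exact this

end Solve

/-! ### Vanishing of infinitely divisible torsion sections -/

section Torsion

variable {M : SheafOfModules.{u} A} {T : C} (hT : IsTerminal T) {ι κ : Type} [Fintype ι] [Fintype κ]
  {y : ι → M.Sec T} (hy : M.Gen y) {N : ℕ} {g : κ → (vec A ι).Sec T}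
  (hg : M.RelGen (fun i => p.el T ^ N • y i) (fun k => coord (g k)))
  (hN : ∀ r, N ≤ r → ∀ (W : C) (φ : (vec A ι).Sec W), φ ∈ (p.initial (lincomb M hT y) r).obj W →
    φ ∈ (p.initial (lincomb M hT y) N).obj W)

include hy hg hN

/-- Put `s = el^N Yf` and apply `el^N Y` to `a·g - t f = el^{n+1} φ`. The terms in `g` vanish, so
`el^{N+n+1} Yφ = -t s` with `s` infinitely divisible. By stability `φ` lies in `initial N`, whose
elements have the required form. -/
lemma improvable_of_torsion {f : (vec A ι).Sec T}
    (h0 : p.el T • (p.el T ^ N • ev (lincomb M hT y) T f) = 0) : p.Improvable hT f g := by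
  intro U n v φ hφ
  refine p.exists_of_mem_initial hT hy hg (hN (N + n + 1) (by omega) U φ ?_)
  -- Membership in `initial (N + n + 1)` asks for divisibility by `el^{N+n+2}`, hence the choice `n
  -- + 2`.
  have hs := (p.pow M _).res_mem (hT.from U)
    (p.mem_pow_of_torsion hT hy hN (p.pow_smul_mem N _) h0 (n + 2))
  have h1 : p.el U ^ (N + n + 1) • ev (lincomb M hT y) U φ = -(coord v none •
      M.res (hT.from U) (p.el T ^ N • ev (lincomb M hT y) T f)) := by
    rw [add_assoc, pow_add, mul_smul, ← map_smul, ← hφ, ev_towerMap, map_sub, smul_sub,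
      p.pow_smul_lincomb_lincomb hT hg, zero_sub, map_smul, smul_smul, p.pow_central, mul_smul,
      res_smul, p.rres_el_pow, ev_res]
  rw [mem_initial, h1]
  exact Submodule.neg_mem _ (Submodule.smul_mem _ _ hs)

lemma IsComplete.res_torsion_eq_zero (hp : p.IsComplete) {f : (vec A ι).Sec T}
    (h0 : p.el T • (p.el T ^ N • ev (lincomb M hT y) T f) = 0) {T' : C} (i : T' ⟶ T)
    (hL : p.LiftsTowers (p.redRel hT g).sheaf i) {c : (vec A κ).Sec T} {ψ : (vec A ι).Sec T}
    (hf : f = p.el T • ψ + ev (lincomb (vec A ι) hT g) T c) :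
    M.res i (p.el T ^ N • ev (lincomb M hT y) T f) = 0 := by
  obtain ⟨a, ha⟩ := hp.exists_lincomb_eq (p.improvable_of_torsion hT hy hg hN h0) i hL hf
  rw [res_smul, p.rres_el_pow, ← ev_res, ← ha, p.pow_smul_lincomb_lincomb hT hg]

end Torsion

end FormalParameter

end Site
end

noncomputable section
open CategoryTheory.GrothendieckTopology SheafOfModules

/-! ### Restriction of a parameter to an object of the site -/

section Site

variable {C : Type u} [SmallCategory C] {J : GrothendieckTopology C}

namespace FormalParameter

variable {A A₀ : Sheaf J RingCat.{u}} (p : FormalParameter A A₀)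

/-- The restriction of a parameter to an object of the site. -/
def restrict (X : C) : FormalParameter (A.over X) (A₀.over X) where
  red := ((Over.forget X).sheafPushforwardContinuous RingCat.{u} (J.over X) J).map p.red
  el Y := p.el Y.left
  rres_el f := p.rres_el f.left
  central Y a := p.central Y.left a
  eq_zero h := p.eq_zero h
  red_el Y := p.red_el Y.left
  exists_mul {Y a} h := (p.exists_mul (U := Y.left) h).of_cocontinuous (K := J.over X) (Over.forget X)
  exists_red {Y} c := (p.exists_red (U := Y.left) c).of_cocontinuous (K := J.over X) (Over.forget X)

lemma mem_pow_over {X : C} {M : SheafOfModules.{u} A} {n : ℕ} {Y : Over X} {m : M.Sec Y.left}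
    (hm : m ∈ (p.pow M n).obj Y.left) :
    (id m : (M.over X).Sec Y) ∈ ((p.restrict X).pow (M.over X) n).obj Y :=
  Locally.of_cocontinuous (K := J.over X) (Over.forget X) hm

lemma mem_pow_of_over {X : C} {M : SheafOfModules.{u} A} {n : ℕ} {Y : Over X}
    {m : (M.over X).Sec Y} (hm : m ∈ ((p.restrict X).pow (M.over X) n).obj Y) :
    (id m : M.Sec Y.left) ∈ (p.pow M n).obj Y.left :=
  Locally.of_over hm

variable {p}

lemma IsComplete.restrict (hp : p.IsComplete) (X : C) : (p.restrict X).IsComplete where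
  exists_limit Y Z hZ hne hsub hle := by
    have key : ∀ n (V : Over X) (i : V ⟶ Y) (W : C) (j : W ⟶ V.left) (i' : W ⟶ Y.left),
        j ≫ i.left = i' → ∀ a : A.RSec V.left, (id a : (unit (A.over X)).Sec V) ∈ Z n V i →
        (id (A.rres j a) : (unit (A.over X)).Sec (Over.mk (i' ≫ Y.hom))) ∈
          Z n (Over.mk (i' ≫ Y.hom)) (Over.homMk i') := by
      rintro n V i W j i' rfl a ha
      exact hZ n V i (Over.mk ((j ≫ i.left) ≫ Y.hom)) (Over.homMk j (by simp)) a ha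
    have key' : ∀ n (V : Over X) (i : V ⟶ Y) (a : A.RSec V.left),
        (id a : (unit (A.over X)).Sec V) ∈ Z n V i →
        (id a : (unit (A.over X)).Sec (Over.mk (i.left ≫ Y.hom))) ∈
          Z n (Over.mk (i.left ≫ Y.hom)) (Over.homMk i.left) := fun n V i a ha => by
      have := key n V i V.left (𝟙 _) i.left (Category.id_comp _) a ha
      rwa [Sheaf.rres_id] at this
    obtain ⟨a, ha⟩ := hp.exists_limit Y.left
      (fun n V i => Z n (Over.mk (i ≫ Y.hom)) (Over.homMk i))
      (fun n V i W j a ha => key n (Over.mk (i ≫ Y.hom)) (Over.homMk i) W j (j ≫ i) rfl a ha)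
      (fun n => Locally.of_over (Y := Y) ((hne n).mono fun V i ⟨b, hb⟩ => ⟨b, key' n V i b hb⟩))
      (fun n V i a ha b hb => p.mem_pow_of_over (Y := Over.mk (i ≫ Y.hom))
        (hsub n (Over.mk (i ≫ Y.hom)) (Over.homMk i) a ha b hb)) (fun n V i => hle n _ _)
    exact ⟨a, fun n V i b hb => p.mem_pow_over (ha n V.left i.left b (key' n V i b hb))⟩
  eq_zero Y a ha := hp.eq_zero Y.left a fun n => p.mem_pow_of_over (ha n)

end FormalParameter

end Site

/-! ### The parameter of an algebra of formal deformation -/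

section Deformation

variable {X : TopCat.{u}} {A : Sheaf (Opens.grothendieckTopology X) RingCat.{u}}
  {h : CentralSection A}

/-- The morphism of sheaves of rings `A ⟶ A / ħ A`. -/
def redHom (h : CentralSection A) : A ⟶ reduction h where
  hom :=
    { app U := RingCat.ofHom (Ideal.Quotient.mk (hIdeal h U))
      naturality U V f := by
        ext a
        rfl } ≫ CategoryTheory.toSheafify (Opens.grothendieckTopology X) (quotPresheaf h)

lemma redHom_app (U : Opens X) (a : A.RSec U) : ((redHom h).hom.app (op U)).hom a =
    (CategoryTheory.toSheafify (Opens.grothendieckTopology X) (quotPresheaf h)).app (op U)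
      (Ideal.Quotient.mk (hIdeal h (op U)) a) := rfl

/-- The parameter `ħ`. -/
def IsFormalDeformation.parameter (hA : IsFormalDeformation A h) :
    FormalParameter A (reduction h) where
  red := redHom h
  el U := resTop A h.val (op U)
  rres_el f := resTop_map A h.val f.op
  central U a := h.central (op U) a
  eq_zero {U a} ha := by
    have : Mono (hPow h (unit A) 1) := hA.torsionFree
    refine ev_injective (hPow h (unit A) 1) U (a₁ := (a : (unit A).Sec U)) ?_
    refine Eq.trans ?_ (map_zero (ev (hPow h (unit A) 1) U)).symm
    change (resTop A h.val (op U)) ^ 1 * a = 0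
    rwa [pow_one]
  red_el U := by
    have : Ideal.Quotient.mk (hIdeal h (op U)) (resTop A h.val (op U)) = 0 :=
      Ideal.Quotient.eq_zero_iff_mem.2 (Ideal.subset_span (Set.mem_singleton _))
    rw [redHom_app]
    exact (congr_arg _ this).trans (map_zero _)
  exists_mul {U a} ha := by
    rw [redHom_app] at ha
    -- Sheafification is locally injective: a section of `A` vanishing in `A₀` lies locally in the
    -- ideal `ħA(V)` of the presheaf quotient.
    refine ⟨_, Presheaf.equalizerSieve_mem (Opens.grothendieckTopology X)
      (CategoryTheory.toSheafify (Opens.grothendieckTopology X) (quotPresheaf h)) (X := op U)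
      (Ideal.Quotient.mk (hIdeal h (op U)) a : (quotPresheaf h).obj (op U)) 0 ?_, fun V f hf => ?_⟩
    · exact ha.trans (map_zero _).symm
    · have h1 : Ideal.Quotient.mk (hIdeal h (op V)) (A.rres f a) = 0 := hf.trans (map_zero _)
      have h2 : A.rres f a ∈ hIdeal h (op V) := Ideal.Quotient.eq_zero_iff_mem.1 h1
      obtain ⟨b, hb⟩ := Ideal.mem_span_singleton'.1 h2
      exact ⟨b, by rw [← hb, h.central]⟩
  exists_red {U} c := by
    refine ⟨_, Presheaf.imageSieve_mem (Opens.grothendieckTopology X)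
      (CategoryTheory.toSheafify (Opens.grothendieckTopology X) (quotPresheaf h)) (U := op U) c, fun V f hf => ?_⟩
    obtain ⟨t, ht⟩ := hf
    obtain ⟨a, rfl⟩ := Ideal.Quotient.mk_surjective (I := hIdeal h (op V)) t
    exact ⟨a, ht⟩

/-- Compatible sections of the quotients `A / ħ ^ (n + 1) A` come from a section of `A`. -/
lemma IsHComplete.exists_section {M : SheafOfModules.{u} A} (hM : IsHComplete h M) {U : Opens X}
    (z : ∀ n, (hQuot h M n).Sec U) (hz : ∀ n, ev (hTrans h M n) U (z (n + 1)) = z n) :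
    ∃ m : M.Sec U, ∀ n, ev (hProj h M n) U m = z n := by
  obtain ⟨hl⟩ := hM
  let F := Functor.ofOpSequence (hTrans h M)
  let E := SheafOfModules.evaluation.{u} A (op U)
  have hlE : IsLimit (E.mapCone (hCone h M)) := isLimitOfPreserves E hl
  -- A section is the same as a linear map out of `A(U)`, by its value at `1`; a compatible family
  -- of sections becomes a cone.
  let c : Cone (F ⋙ E) :=
    { pt := ModuleCat.of (A.obj.obj (op U)) (A.obj.obj (op U))
      π := NatTrans.ofOpSequence (fun n => ModuleCat.ofHom
        (Y := (hQuot h M n).val.obj (op U)) (LinearMap.toSpanSingleton _ _ (z n))) (fun n => by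
          ext
          change (1 : A.obj.obj (op U)) • z n = E.map (F.map _) ((1 : A.obj.obj (op U)) • z (n + 1))
          rw [Functor.ofOpSequence_map_homOfLE_succ, one_smul, one_smul]
          exact (hz n).symm) }
  refine ⟨hlE.lift c (1 : A.obj.obj (op U)), fun n => ?_⟩
  have := congr($(hlE.fac c (op n)) (1 : A.obj.obj (op U)))
  refine this.trans (one_smul (A.obj.obj (op U)) (z n))

lemma IsHComplete.eq_zero {M : SheafOfModules.{u} A} (hM : IsHComplete h M) {U : Opens X}
    {m : M.Sec U} (hm : ∀ n, ev (hProj h M n) U m = 0) : m = 0 := by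
  obtain ⟨hl⟩ := hM
  let E := SheafOfModules.evaluation.{u} A (op U)
  have hlE : IsLimit (E.mapCone (hCone h M)) := isLimitOfPreserves E hl
  let t : ModuleCat.of (A.obj.obj (op U)) (A.obj.obj (op U)) ⟶ (E.mapCone (hCone h M)).pt :=
    ModuleCat.ofHom (Y := M.val.obj (op U)) (LinearMap.toSpanSingleton _ _ m)
  have : t = 0 := hlE.hom_ext fun n => by
    rw [zero_comp]
    ext
    refine (congr_arg (ev (hProj h M n.unop) U) (one_smul (A.obj.obj (op U)) m)).trans ?_
    exact hm n.unop
  have h1 := congr($this (1 : A.obj.obj (op U)))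
  exact (one_smul (A.obj.obj (op U)) m).symm.trans h1

/-- The members of `Z n` have a well-defined image in `A / ħ^{n+1}A`. These images glue over `U` and
are compatible in `n`, so the limit property of `A` applies. -/
lemma IsFormalDeformation.isComplete (hA : IsFormalDeformation A h) : hA.parameter.IsComplete where
  exists_limit U Z hZ hne hsub hle := by
    have hpow : ∀ {n V} {a : (unit A).Sec V}, a ∈ (hA.parameter.pow (unit A) (n + 1)).obj V →
        ev (hProj h (unit A) n) V a = 0 := fun {n V a} ha =>
      sec_zero_of_locally _ (Locally.mono ha fun W f ⟨x, hx⟩ => by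
        rw [← ev_res, ← hx]
        exact ev_cokernel (hPow h (unit A) (n + 1)) x)
    have hglue : ∀ n, ∃ z : (hQuot h (unit A) n).Sec U, ∀ V (i : V ⟶ U), ∀ a ∈ Z n V i,
        ev (hProj h (unit A) n) V a = (hQuot h (unit A) n).res i z := by
      intro n
      let S : Sieve U :=
        { arrows := fun V i => (Z n V i).Nonempty
          downward_closed := fun {V W i} ⟨a, ha⟩ j => ⟨_, hZ n V i W j a ha⟩ }
      have hS : S ∈ Opens.grothendieckTopology X U := by
        obtain ⟨S', hS', hS''⟩ := hne n
        exact superset_covering _ (fun V i hi => hS'' V i hi) hS'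
      have key : ∀ V (i : V ⟶ U), ∀ a ∈ Z n V i, ∀ b ∈ Z n V i,
          ev (hProj h (unit A) n) V a = ev (hProj h (unit A) n) V b := fun V i a ha b hb => by
        rw [← sub_eq_zero, ← map_sub]
        exact hpow (hsub n V i a ha b hb)
      obtain ⟨z, hz⟩ := sec_glue (hQuot h (unit A) n) hS
        (fun V i hi => ev (hProj h (unit A) n) V hi.some) (fun V W i j hi => by
          rw [← ev_res]
          exact key W (j ≫ i) _ (hZ n V i W j _ hi.some_mem) _ (Set.Nonempty.some_mem _))
      exact ⟨z, fun V i a ha => (key V i a ha _ (Set.Nonempty.some_mem _)).trans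
        (hz V i ⟨a, ha⟩).symm⟩
    choose z hz using hglue
    obtain ⟨a, ha⟩ := hA.complete.exists_section z fun n => by
      refine sec_separated _ ((hne (n + 1)).mono fun V i ⟨a, ha⟩ => ?_)
      rw [← ev_res, ← hz (n + 1) V i a ha, ← hz n V i a (hle n V i ha), ← ev_comp, hProj_hTrans]
    refine ⟨a, fun n V i b hb => ?_⟩
    refine exists_ev_of_cokernel (hPow h (unit A) (n + 1)) ?_
    rw [map_sub, ev_res, sub_eq_zero]
    exact (congr_arg _ (ha n)).trans (hz n V i b hb).symm
  eq_zero U a ha := hA.complete.eq_zero fun n =>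
    sec_zero_of_locally _ (Locally.mono (ha n) fun W f ⟨x, hx⟩ => by
      rw [← ev_res, ← hx]
      exact ev_cokernel (hPow h (unit A) (n + 1)) x)

end Deformation
end

noncomputable section
open CategoryTheory.GrothendieckTopology SheafOfModules

/-! ### Lifting towers of modules by means of acyclicity -/

section Site

variable {C : Type u} [SmallCategory C] {J : GrothendieckTopology C}

/-- The obstruction to lifting a global section lies in `H¹` of the kernel. -/
lemma surjective_of_subsingleton_H_one {T : C} (hT : IsTerminal T)
    {E : ShortComplex (Sheaf J AddCommGrpCat.{u})} (hE : E.ShortExact)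
    [HasExt.{u} (Sheaf J AddCommGrpCat.{u})] (h1 : Subsingleton (E.X₁.H 1)) :
    Function.Surjective (E.g.hom.app (op T)) := by
  intro y
  obtain ⟨x, hx⟩ := Abelian.Ext.covariant_sequence_exact₃ _ hE ((Sheaf.H.equiv₀ E.X₃ hT).symm y)
    (zero_add 1) (Subsingleton.elim _ _)
  refine ⟨Sheaf.H.equiv₀ E.X₂ hT x, ?_⟩
  rw [Sheaf.H.equiv₀_naturality, Sheaf.H.map_apply, hx, AddEquiv.apply_symm_apply]

/-- A sequence lifting a given element along surjective transition maps. -/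
lemma exists_lift_of_surjective {G : ℕ → Type*} (r : ∀ n, G (n + 1) → G n)
    (hr : ∀ n, Function.Surjective (r n)) (g₀ : G 0) :
    ∃ g : ∀ n, G n, g 0 = g₀ ∧ ∀ n, r n (g (n + 1)) = g n :=
  ⟨fun n => Nat.rec g₀ (fun n x => (hr n x).choose) n, rfl, fun n => (hr n _).choose_spec⟩

namespace SheafOfModules

variable {R : Sheaf J RingCat.{u}}

lemma epi_toSheaf {M N : SheafOfModules.{u} R} (φ : M ⟶ N) [Epi φ] :
    Epi ((toSheaf R).map φ) := by
  refine (Sheaf.isLocallySurjective_iff_epi' AddCommGrpCat.{u} ((toSheaf R).map φ)).1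
    ⟨fun {U} s => ?_⟩
  obtain ⟨S, hS, h⟩ := exists_ev_of_epi φ (U := U) s
  exact superset_covering _ (fun V f hf => (h V f hf).imp fun m hm => hm) hS

lemma shortExact_toSheaf {E : ShortComplex (SheafOfModules.{u} R)} (hE : E.ShortExact) :
    (E.map (toSheaf R)).ShortExact := by
  have := hE.mono_f
  have := hE.epi_g
  exact
    { exact := ShortComplex.exact_of_f_is_kernel _
        (KernelFork.mapIsLimit _ hE.fIsKernel (toSheaf R))
      mono_f := inferInstanceAs (Mono ((toSheaf R).map E.f))
      epi_g := epi_toSheaf E.g }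

instance {U V : C} (i : V ⟶ U) : (overMap R i).PreservesZeroMorphisms where
  map_zero _ _ := rfl

lemma shortExact_overMap {U V : C} (i : V ⟶ U) {E : ShortComplex (SheafOfModules.{u} (R.over U))}
    (hE : E.ShortExact) : (E.map (overMap R i)).ShortExact where
  exact := exact_of_ev _ fun Y n hn =>
    (exists_ev_of_exact hE.exact (U := (Over.map i).obj Y) hn).of_cocontinuous
      (K := J.over V) (Over.map i)
  mono_f := by
    have := hE.mono_f
    exact mono_of_ev _ fun Y _ hm => ev_injective E.f ((Over.map i).obj Y)
      (hm.trans (map_zero _).symm)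
  epi_g := by
    have := hE.epi_g
    exact epi_of_ev _ fun Y n => (exists_ev_of_epi E.g (U := (Over.map i).obj Y) n).of_cocontinuous
      (K := J.over V) (Over.map i)

lemma LFG.overMap {U V : C} (i : V ⟶ U) {M : SheafOfModules.{u} (R.over U)} (hM : M.LFG) :
    ((overMap R i).obj M).LFG :=
  hM.pushforward (Over.map i) (Sheaf.pushforwardOverMapIso R i).inv fun _ => Function.bijective_id

lemma RelFG.overMap {U V : C} (i : V ⟶ U) {M : SheafOfModules.{u} (R.over U)} (hM : M.RelFG) :
    ((overMap R i).obj M).RelFG :=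
  hM.pushforward (Over.map i) (Sheaf.pushforwardOverMapIso R i).inv fun _ => Function.bijective_id

lemma _root_.IsCoherentModule.overMap {U V : C} (i : V ⟶ U) {M : SheafOfModules.{u} (R.over U)}
    (hM : IsCoherentModule M) : IsCoherentModule ((overMap R i).obj M) := by
  rw [isCoherentModule_iff] at hM ⊢
  exact ⟨hM.1.overMap i, hM.2.overMap i⟩

end SheafOfModules

namespace FormalParameter

variable {A A₀ : Sheaf J RingCat.{u}} (p : FormalParameter A A₀)

/-- Towers lift if restriction of sections factors through a functor that turns the epimorphisms
whose kernel is a given module into surjections. -/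
lemma LiftsTowers.of_functor {P : SheafOfModules.{u} A₀} {T T' : C} (i : T' ⟶ T)
    (G : SheafOfModules.{u} A ⥤ AddCommGrpCat.{u}) (a : ∀ E : SheafOfModules.{u} A, E.Sec T → G.obj E)
    (b : ∀ E : SheafOfModules.{u} A, G.obj E → E.Sec T')
    (hb : ∀ {E F : SheafOfModules.{u} A} (φ : E ⟶ F) (x : G.obj E), b F (G.map φ x) =
      ev φ T' (b E x)) (hab : ∀ (E : SheafOfModules.{u} A) (e : E.Sec T), b E (a E e) = E.res i e)
    (hG : ∀ {E F : SheafOfModules.{u} A} (f : (restrictScalars p.red).obj P ⟶ E) (g : E ⟶ F)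
      (w : f ≫ g = 0), (ShortComplex.mk f g w).ShortExact → Function.Surjective (G.map g)) :
    p.LiftsTowers P i := by
  intro E q j w hE e
  -- The compatible sequence is chosen inside `G`, where the transition maps are surjective, and
  -- only then mapped to sections over `T'`.
  obtain ⟨g, h0, hg⟩ := exists_lift_of_surjective
    (G := fun n => (G.obj (E n) : Type u)) (fun n => G.map (q n))
    (fun n => hG (j n) (q n) (w n) (hE n)) (a _ e)
  exact ⟨fun n => b _ (g n), (congr_arg _ h0).trans (hab _ _),
    fun n => (hb _ _).symm.trans (congr_arg _ (hg n))⟩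

/-- Take for `G` the sections over `V'`. Restriction of scalars along `A ⟶ A₀` does not alter the
underlying abelian sheaf, so the relevant `H¹` is that of the `A₀`-module `P`. -/
lemma liftsTowers_of_cohomology {V : C} {P : SheafOfModules.{u} (A₀.over V)} {V' : C} (i : V' ⟶ V)
    [HasExt.{u} (Sheaf (J.over V') AddCommGrpCat.{u})]
    (h1 : Subsingleton (((toSheaf (A₀.over V')).obj ((overMap A₀ i).obj P)).H 1)) :
    (p.restrict V).LiftsTowers P (T := Over.mk (𝟙 V)) (T' := (Over.map i).obj (Over.mk (𝟙 V')))
      (Over.mkIdTerminal.from _) := by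
  refine LiftsTowers.of_functor _ _ (overMap A i ⋙ toSheaf (A.over V') ⋙ sheafToPresheaf _ _ ⋙
    (CategoryTheory.evaluation _ _).obj (op (Over.mk (𝟙 V')))) (fun E e => E.res _ e)
    (fun E x => x) (fun _ _ => rfl) (fun _ _ => rfl) fun f g w hE => ?_
  exact surjective_of_subsingleton_H_one Over.mkIdTerminal
    (shortExact_toSheaf (shortExact_overMap i hE)) h1

end FormalParameter

end Site
end

noncomputable section
open CategoryTheory.GrothendieckTopology SheafOfModules

/-! ### Lifting towers over a compact subset -/

section Pullback

variable {C D : Type u} [SmallCategory C] [SmallCategory D] {J : GrothendieckTopology C}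
  {K : GrothendieckTopology D} (F : C ⥤ D) [F.IsContinuous J K] (ρ : D ⥤ C) [ρ.IsContinuous K J]
  (τ : F ⋙ ρ ⟶ 𝟭 C)

/-- Restriction along `τ : F ⋙ ρ ⟶ 𝟭`, as a morphism from a sheaf to the direct image by `F` of
its direct image by `ρ`. -/
def restrictAlong : 𝟭 (Sheaf J AddCommGrpCat.{u}) ⟶
    ρ.sheafPushforwardContinuous AddCommGrpCat.{u} K J ⋙
      F.sheafPushforwardContinuous AddCommGrpCat.{u} J K where
  app G := ⟨{ app Z := G.obj.map (τ.app Z.unop).op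
              naturality Y Z f := by
                change G.obj.map _ ≫ G.obj.map _ = G.obj.map _ ≫ G.obj.map (ρ.map (F.map f.unop)).op
                rw [← G.obj.map_comp, ← G.obj.map_comp]
                congr 1
                exact congr_arg Quiver.Hom.op (τ.naturality f.unop).symm }⟩
  naturality G H φ := by
    ext Z : 3
    exact (φ.hom.naturality _).symm

/-- The morphism from the inverse image by `F` to the direct image by `ρ` given by
`τ : F ⋙ ρ ⟶ 𝟭`. -/
def pullbackTo : F.sheafPullback AddCommGrpCat.{u} J K ⟶
    ρ.sheafPushforwardContinuous AddCommGrpCat.{u} K J :=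
  Functor.whiskerRight (restrictAlong F ρ τ) (F.sheafPullback AddCommGrpCat.{u} J K) ≫
    Functor.whiskerLeft (ρ.sheafPushforwardContinuous AddCommGrpCat.{u} K J)
      (F.sheafAdjunctionContinuous AddCommGrpCat.{u} J K).counit

/-- By construction `pullbackTo` is the adjoint transpose of `restrictAlong`; this is naturality of
the unit and a triangle identity. -/
lemma unit_pullbackTo (G : Sheaf J AddCommGrpCat.{u}) :
    (F.sheafAdjunctionContinuous AddCommGrpCat.{u} J K).unit.app G ≫
      (F.sheafPushforwardContinuous AddCommGrpCat.{u} J K).map ((pullbackTo F ρ τ).app G) =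
    (restrictAlong F ρ τ).app G := by
  simp only [pullbackTo, NatTrans.comp_app, Functor.map_comp, Functor.whiskerRight_app,
    Functor.whiskerLeft_app]
  have h1 := (F.sheafAdjunctionContinuous AddCommGrpCat.{u} J K).unit.naturality
    ((restrictAlong (K := K) F ρ τ).app G)
  have h2 := (F.sheafAdjunctionContinuous AddCommGrpCat.{u} J K).right_triangle_components
    ((ρ.sheafPushforwardContinuous AddCommGrpCat.{u} K J).obj G)
  rw [← Category.assoc]
  refine (congr_arg (· ≫ _) h1.symm).trans ?_
  rw [Category.assoc]
  exact (congr_arg _ h2).trans (Category.comp_id _)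

lemma shortExact_sheafPullback [RepresentablyFlat F] {E : ShortComplex (Sheaf J AddCommGrpCat.{u})}
    (hE : E.ShortExact) [(F.sheafPullback AddCommGrpCat.{u} J K).PreservesZeroMorphisms] :
    (E.map (F.sheafPullback AddCommGrpCat.{u} J K)).ShortExact := by
  have : PreservesColimitsOfSize.{0, 0} (F.sheafPullback AddCommGrpCat.{u} J K) :=
    (F.sheafAdjunctionContinuous AddCommGrpCat.{u} J K).leftAdjoint_preservesColimits
  have : PreservesFiniteColimits (F.sheafPullback AddCommGrpCat.{u} J K) :=
    PreservesColimitsOfSize.preservesFiniteColimits _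
  have : PreservesFiniteLimits (F.sheafPullback AddCommGrpCat.{u} J K) :=
    Functor.SmallCategories.instPreservesFiniteLimitsSheafSheafPullbackOfRepresentablyFlat ..
  exact hE.map_of_exact _

namespace FormalParameter

variable {A A₀ : Sheaf J RingCat.{u}} (p : FormalParameter A A₀)

/-- In the application `G` is the group of sections over a compact `K` of the inverse image, and `ρ`
is intersection with the interior of `K`. Lifting over `K` works by acyclicity, the inverse image
being exact. Sections over `K` extend to neighbourhoods that may depend on `n`, but all of them
restrict to the interior of `K`. -/
lemma liftsTowers_of_pullback {V : C} {P : SheafOfModules.{u} (A₀.over V)}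
    {V' : C} (i : V' ⟶ V) {D : Type u} [SmallCategory D] {K : GrothendieckTopology D}
    (F : Over V' ⥤ D) [F.IsContinuous (J.over V') K] [RepresentablyFlat F]
    (ρ : D ⥤ Over V') [ρ.IsContinuous K (J.over V')] (τ : F ⋙ ρ ⟶ 𝟭 (Over V'))
    (hF : IsTerminal (F.obj (Over.mk (𝟙 V'))))
    [HasExt.{u} (Sheaf K AddCommGrpCat.{u})]
    (h1 : Subsingleton (((F.sheafPullback AddCommGrpCat.{u} (J.over V') K).obj
      ((toSheaf (A₀.over V')).obj ((overMap A₀ i).obj P))).H 1)) :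
    (p.restrict V).LiftsTowers P (T := Over.mk (𝟙 V))
      (T' := (Over.map i).obj (ρ.obj (F.obj (Over.mk (𝟙 V')))))
      (Over.mkIdTerminal.from _) := by
  let L := F.sheafPullback AddCommGrpCat.{u} (J.over V') K
  let t := F.obj (Over.mk (𝟙 V'))
  let t₀ : (Over.map i).obj (Over.mk (𝟙 V')) ⟶ Over.mk (𝟙 V) := Over.mkIdTerminal.from _
  let adj := F.sheafAdjunctionContinuous AddCommGrpCat.{u} (J.over V') K
  let Ψ : SheafOfModules.{u} (A.over V) ⥤ _ := overMap A i ⋙ toSheaf (A.over V')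
  have : PreservesColimitsOfSize.{0, 0} L := adj.leftAdjoint_preservesColimits
  have : L.PreservesZeroMorphisms := Functor.preservesZeroMorphisms_of_preserves_initial_object
  refine LiftsTowers.of_functor _ _ (Ψ ⋙ L ⋙ sheafToPresheaf _ _ ⋙
    (CategoryTheory.evaluation _ _).obj (op t))
    (fun E e => (adj.unit.app (Ψ.obj E)).hom.app (op (Over.mk (𝟙 V'))) (E.res t₀ e))
    (fun E x => ((pullbackTo F ρ τ).app (Ψ.obj E)).hom.app (op t) x) ?_ ?_ ?_
  · intro E G φ x
    have := (pullbackTo (K := K) F ρ τ).naturality (Ψ.map φ)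
    exact congr(($this).hom.app (op t) x)
  · intro E e
    have := unit_pullbackTo (K := K) F ρ τ (Ψ.obj E)
    refine congr(($this).hom.app (op (Over.mk (𝟙 V'))) (E.res t₀ e)).trans ?_
    exact (E.res_comp t₀ ((Over.map i).map (τ.app (Over.mk (𝟙 V')))) e).trans
      (congr_arg (fun f => E.res f e) (Over.mkIdTerminal.hom_ext _ _))
  · intro E G f g w hE
    exact surjective_of_subsingleton_H_one hF
      (shortExact_sheafPullback F (shortExact_toSheaf (shortExact_overMap i hE))) h1

end FormalParameter

end Pullback

/-! ### Inverse image on a subset and restriction to its interior -/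

section Compact

variable {X : TopCat.{u}}

instance (U : Opens X) (Y Z : Over U) : Subsingleton (Y ⟶ Z) :=
  ⟨fun _ _ => Over.OverMorphism.ext (Subsingleton.elim _ _)⟩

/-- The intersection of two open subsets of `U`. -/
def overInf {U : Opens X} (Y Z : Over U) : Over U :=
  Over.mk (homOfLE (inf_le_left.trans Y.hom.le) : Y.left ⊓ Z.left ⟶ U)

/-- Cofilteredness comes from intersections of open subsets of `U`; nonemptiness is the inclusion `K
⊆ U`. -/
lemma representablyFlat_interFunctor {U : Opens X} {K : Set X} (hK : K ⊆ U) :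
    RepresentablyFlat (interFunctor U K) where
  cofiltered W :=
    have : IsCofilteredOrEmpty (StructuredArrow W (interFunctor U K)) :=
      { cone_objs Y Z := ⟨StructuredArrow.mk (Y := overInf Y.right Z.right)
            (homOfLE (le_inf Y.hom.le Z.hom.le) :
              W ⟶ (interFunctor U K).obj (overInf Y.right Z.right)),
          StructuredArrow.homMk (Over.homMk (homOfLE inf_le_left)),
          StructuredArrow.homMk (Over.homMk (homOfLE inf_le_right)), trivial⟩
        cone_maps _ _ _ _ := ⟨_, 𝟙 _, StructuredArrow.hom_ext _ _ (Subsingleton.elim _ _)⟩ }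
    { nonempty := ⟨StructuredArrow.mk (Y := Over.mk (𝟙 U))
        (homOfLE fun y _ => hK y.2 : W ⟶ (interFunctor U K).obj (Over.mk (𝟙 U)))⟩ }

/-- The open subset of `X` which is the intersection of the interior of `K` and an open subset
of `K`. -/
def interInterior {K : Set X} (Z : Opens (subsetSpace K)) : Opens X where
  carrier := {x | ∃ hx : x ∈ interior K, (⟨x, interior_subset hx⟩ : K) ∈ Z.1}
  is_open' := by
    obtain ⟨O, hO, h⟩ := isOpen_induced_iff.1 Z.isOpen
    convert isOpen_interior.inter hO using 1
    ext x
    refine ⟨fun ⟨hx, h'⟩ => ⟨hx, ?_⟩, fun ⟨hx, h'⟩ => ⟨hx, ?_⟩⟩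
    · exact (Set.ext_iff.1 h (⟨x, interior_subset hx⟩ : K)).2 h'
    · exact (Set.ext_iff.1 h (⟨x, interior_subset hx⟩ : K)).1 h'

variable {U : Opens X} {K : Set X} (hK : K ⊆ U)

/-- For `K ⊆ U`, the functor sending an open subset of `K` to its intersection with the interior
of `K`. -/
def interInteriorFunctor : Opens (subsetSpace K) ⥤ Over U where
  obj Z := Over.mk (homOfLE fun _ hx => hK (interior_subset hx.1) : interInterior Z ⟶ U)
  map f := Over.homMk (homOfLE fun _ hx => ⟨hx.1, f.le hx.2⟩)

instance : (interInteriorFunctor hK).IsContinuous (Opens.grothendieckTopology (subsetSpace K))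
    ((Opens.grothendieckTopology X).over U) := by
  apply Functor.isContinuous_of_coverPreserving
  · constructor
    intro P Z T x hx Y₁ Y₂ W f₁ f₂ g₁ g₂ hg₁ hg₂ _
    let f : W ⟶ (interInteriorFunctor hK).obj (Y₁ ⊓ Y₂) :=
      Over.homMk (homOfLE fun w hw => ⟨(f₁.left.le hw).1, (f₁.left.le hw).2, (f₂.left.le hw).2⟩)
    have h₁ : f₁ = f ≫ (interInteriorFunctor hK).map (homOfLE inf_le_left) :=
      Subsingleton.elim _ _
    have h₂ : f₂ = f ≫ (interInteriorFunctor hK).map (homOfLE inf_le_right) :=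
      Subsingleton.elim _ _
    have := congr_arg (P.obj.map f.op) (hx (homOfLE (inf_le_left (a := Y₁) (b := Y₂)))
      (homOfLE inf_le_right) hg₁ hg₂ (Subsingleton.elim _ _))
    rw [h₁, h₂, op_comp, op_comp, P.obj.map_comp, P.obj.map_comp]
    exact this
  · constructor
    intro Z S hS
    rw [mem_over_iff]
    rintro x ⟨hx, hxZ⟩
    obtain ⟨V, i, hi, hxV⟩ := hS _ hxZ
    refine ⟨interInterior V, homOfLE fun _ hx => ⟨hx.1, i.le hx.2⟩, ?_, hx, hxV⟩
    exact (Sieve.overEquiv_iff _ _).2 ⟨V, i, Over.homMk (𝟙 _), hi, Subsingleton.elim _ _⟩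

/-- The intersection of an open subset of `U` and of the interior of `K` is contained in it. -/
def interInteriorHom : interFunctor U K ⋙ interInteriorFunctor hK ⟶ 𝟭 (Over U) where
  app Z := Over.homMk (homOfLE fun _ hx => hx.2)
  naturality _ _ _ := Subsingleton.elim _ _

variable {A : Sheaf (Opens.grothendieckTopology X) RingCat.{u}} {h : CentralSection A}

/-- Over an algebra of formal deformation, towers lift locally. -/
lemma IsFormalDeformation.exists_liftsTowers (hA : IsFormalDeformation A h) {V : Opens X}
    {P : SheafOfModules.{u} ((reduction h).over V)} (hP : IsCoherentModule P) {x : X} (hx : x ∈ V) :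
    ∃ (T : Over V) (i : T ⟶ Over.mk (𝟙 V)), x ∈ T.left ∧
      (hA.parameter.restrict V).LiftsTowers P i := by
  obtain ⟨B, hB, hacyc⟩ | ⟨B, good, hB⟩ := hA.acyclic
  · obtain ⟨_, ⟨W, hW, rfl⟩, hxW, hWV⟩ := hB.exists_subset_of_mem_open (a := x) hx V.isOpen
    exact ⟨_, _, hxW, hA.parameter.liftsTowers_of_cohomology (homOfLE hWV)
      (hacyc W hW _ (hP.overMap _) 1 one_pos)⟩
  · obtain ⟨W, i, hxW, hW⟩ := hB.locally_good V P hP x hx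
    obtain ⟨K, hK, hxK, hKW⟩ := hB.basis x W hxW
    have := representablyFlat_interFunctor hKW
    have ht : IsTerminal ((interFunctor W K).obj (Over.mk (𝟙 W))) :=
      IsTerminal.ofUniqueHom (fun Z => homOfLE fun y _ => hKW y.2) fun _ _ => Subsingleton.elim _ _
    have hxT : x ∈ ((interInteriorFunctor hKW).obj
        ((interFunctor W K).obj (Over.mk (𝟙 W)))).left := ⟨hxK, hxW⟩
    exact ⟨_, _, hxT, hA.parameter.liftsTowers_of_pullback i (interFunctor W K)
      (interInteriorFunctor hKW) (interInteriorHom hKW) ht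
      (hB.acyclic K hK W hKW _ hW 1 one_pos)⟩

end Compact
end

noncomputable section
open CategoryTheory.GrothendieckTopology SheafOfModules

/-! ### Torsion in coherent modules -/

section Site

variable {C : Type u} [SmallCategory C] {J : GrothendieckTopology C}
  {A A₀ : Sheaf J RingCat.{u}} (p : FormalParameter A A₀)

/-- `y` generates `M` over `V`, the relations between the `el ^ N • y i` are generated by `g`, and
`N` is a stable index for the families of initial coefficients. -/
structure FormalParameter.Controls (M : SheafOfModules.{u} A) (N : ℕ) {V : C} {ι κ : Type}
    [Fintype ι] [Fintype κ] (y : ι → M.Sec V) (g : κ → ι → A.RSec V) : Prop where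
  gen : M.Gen y
  rel : M.RelGen (fun i => p.el V ^ N • y i) g
  stable : ∀ r, N ≤ r → ∀ {W : C} (i : W ⟶ V) (a : ι → A.RSec W),
    p.el W ^ r • ∑ k, a k • M.res i (y k) ∈ (p.pow M (r + 1)).obj W →
      p.el W ^ N • ∑ k, a k • M.res i (y k) ∈ (p.pow M (N + 1)).obj W

/-- A section over `V`, as a section over the terminal object of the site over `V`. -/
def overTop {M : SheafOfModules.{u} A} {V : C} (m : M.Sec V) : (M.over V).Sec (Over.mk (𝟙 V)) := m

lemma FormalParameter.LiftsTowers.comp {p : FormalParameter A A₀} {P : SheafOfModules.{u} A₀}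
    {T T' T'' : C} {i : T' ⟶ T} (hi : p.LiftsTowers P i) (j : T'' ⟶ T') :
    p.LiftsTowers P (j ≫ i) := by
  intro E q a w hE e
  obtain ⟨e', h0, he⟩ := hi E q a w hE e
  exact ⟨fun n => (E n).res j (e' n), (congr_arg _ h0).trans (res_comp _ _ _ _),
    fun n => (ev_res (q n) j _).trans (congr_arg _ (he n))⟩

namespace FormalParameter.Controls

variable {p} {M : SheafOfModules.{u} A} {N : ℕ} {V : C} {ι κ : Type} [Fintype ι] [Fintype κ]
  {y : ι → M.Sec V} {g : κ → ι → A.RSec V}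

lemma res (H : p.Controls M N y g) {W : C} (f : W ⟶ V) :
    p.Controls M N (fun i => M.res f (y i)) (fun k i => A.rres f (g k i)) where
  gen := H.gen.res f
  rel := by
    have := H.rel.res f
    simpa only [res_smul, p.rres_el_pow] using this
  stable r hr W' i a h := by
    simp only [res_comp] at h ⊢
    exact H.stable r hr (i ≫ f) a h

protected lemma restrict (H : p.Controls M N y g) :
    (p.restrict V).Controls (M.over V) N (V := Over.mk (𝟙 V)) (fun i => overTop (y i))
      (fun k i => g k i) where
  gen := H.gen.over
  rel := H.rel.over
  stable r hr _ i a h := p.mem_pow_over (H.stable r hr i.left a (p.mem_pow_of_over h))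

section Terminal

variable (hT : IsTerminal V)

lemma initial_stable (H : p.Controls M N y g) (r : ℕ) (hr : N ≤ r) (W : C)
    (φ : (vec A ι).Sec W) (hφ : φ ∈ (p.initial (lincomb M hT y) r).obj W) :
    φ ∈ (p.initial (lincomb M hT y) N).obj W := by
  rw [mem_initial, ev_lincomb] at hφ ⊢
  exact H.stable r hr _ _ hφ

lemma ev_lincomb_ofCoord (f : ι → A.RSec V) :
    ev (lincomb M hT y) V (ofCoord f) = ∑ i, f i • y i := by
  rw [ev_lincomb, hT.hom_ext (hT.from V) (𝟙 V)]
  simp only [res_id, coord_ofCoord]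

include hT in
lemma exists_coeff_of_isTerminal (H : p.Controls M N y g) {f : ι → A.RSec V}
    (hf : p.el V ^ N • ∑ i, f i • y i ∈ (p.pow M (N + 1)).obj V) :
    J.Locally V fun W j => ∃ (ψ : ι → A.RSec W) (c : κ → A.RSec W),
      ∀ i, A.rres j (f i) = p.el W * ψ i + ∑ k, c k * A.rres j (g k i) := by
  refine (p.exists_of_mem_initial hT H.gen (g := fun k => ofCoord (g k)) H.rel (φ := ofCoord f)
    ?_).mono fun W j ⟨ψ, c, h⟩ => ⟨coord ψ, coord c, fun i => ?_⟩
  · rw [mem_initial, ev_lincomb_ofCoord]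
    exact hf
  · have := congr_fun (congr_arg coord h) i
    rw [coord_res, coord_ofCoord, coord_add, coord_smul, ev_lincomb, coord_sum,
      hT.hom_ext (hT.from W) j] at this
    exact this

lemma res_eq_zero_of_isTerminal (H : p.Controls M N y g) (hp : p.IsComplete) {f ψ : ι → A.RSec V}
    {c : κ → A.RSec V} (hf : ∀ i, f i = p.el V * ψ i + ∑ k, c k * g k i)
    (h0 : p.el V • (p.el V ^ N • ∑ i, f i • y i) = 0) {T : C} (i : T ⟶ V)
    (hL : p.LiftsTowers (p.redRel hT fun k => ofCoord (g k)).sheaf i) :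
    M.res i (p.el V ^ N • ∑ i, f i • y i) = 0 := by
  rw [← ev_lincomb_ofCoord hT] at h0 ⊢
  refine IsComplete.res_torsion_eq_zero p hT H.gen (g := fun k => ofCoord (g k)) H.rel
    (H.initial_stable hT) hp h0 i hL (c := ofCoord c) (ψ := ofCoord ψ) (coord_ext fun i => ?_)
  rw [coord_add, coord_smul, ev_lincomb, coord_sum, hT.hom_ext (hT.from V) (𝟙 V)]
  simp only [coord_ofCoord, coord_smul, coord_res, Sheaf.rres_id]
  exact hf i

end Terminal

/-- The coefficients of a section divisible by `el ^ (N + 1)`. -/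
lemma exists_coeff (H : p.Controls M N y g) {f : ι → A.RSec V}
    (hf : p.el V ^ N • ∑ i, f i • y i ∈ (p.pow M (N + 1)).obj V) :
    J.Locally V fun W j => ∃ (ψ : ι → A.RSec W) (c : κ → A.RSec W),
      ∀ i, A.rres j (f i) = p.el W * ψ i + ∑ k, c k * A.rres j (g k i) :=
  Locally.of_over (Y := Over.mk (𝟙 V))
    (H.restrict.exists_coeff_of_isTerminal Over.mkIdTerminal (f := f) (p.mem_pow_over hf))

/-- A section killed by `el` and divisible by `el ^ (N + 1)` vanishes where towers lift. -/
lemma res_eq_zero (H : p.Controls M N y g) (hp : p.IsComplete) {f ψ : ι → A.RSec V}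
    {c : κ → A.RSec V} (hf : ∀ i, f i = p.el V * ψ i + ∑ k, c k * g k i)
    (h0 : p.el V • (p.el V ^ N • ∑ i, f i • y i) = 0) {T : Over V} (i : T ⟶ Over.mk (𝟙 V))
    (hL : (p.restrict V).LiftsTowers ((p.restrict V).redRel Over.mkIdTerminal
      fun k => (ofCoord (g k) : (vec (A.over V) ι).Sec (Over.mk (𝟙 V)))).sheaf i) :
    M.res i.left (p.el V ^ N • ∑ i, f i • y i) = 0 :=
  H.restrict.res_eq_zero_of_isTerminal Over.mkIdTerminal (hp.restrict V) hf h0 i hL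

lemma coherent_redRel {V : C} (hT : IsTerminal V) {k l : ℕ} (hA₀ : IsCoherentModule (unit A₀))
    (g : Fin l → (vec A (Fin k)).Sec V) : IsCoherentModule (p.redRel hT g).sheaf :=
  (vec_coherent hA₀ l).of_mono (kerFamily_lfg vec_lfg
    (isCoherentModule_iff.1 (vec_coherent hA₀ k)).2 _) (p.redRel hT g).incl

/-- If towers lift locally, a section killed by `el` and divisible by `el ^ (N + 1)` vanishes. -/
lemma eq_zero {k l : ℕ} {y : Fin k → M.Sec V} {g : Fin l → Fin k → A.RSec V}
    (H : p.Controls M N y g) (hp : p.IsComplete) (hA₀ : IsCoherentModule (unit A₀))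
    (hL : ∀ (W : C) (P : SheafOfModules.{u} (A₀.over W)), IsCoherentModule P →
      (J.over W).Locally (Over.mk (𝟙 W)) fun _ i => (p.restrict W).LiftsTowers P i)
    {W : C} (j : W ⟶ V) {s : M.Sec W}
    (hs : s ∈ (p.pow M (N + 1)).obj W) (h0 : p.el W • s = 0) : s = 0 := by
  refine M.sec_zero_of_locally (Locally.bind hs fun W₁ j₁ ⟨m, hm⟩ => ?_)
  refine (H.gen W₁ (j₁ ≫ j) m).bind fun W₂ j₂ ⟨f, hf⟩ => ?_
  -- One of the `N + 1` factors `el` goes into the coefficients, which leaves the shape `el^N Yf`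
  -- for which `N` and `g` were chosen.
  have h1 : M.res (j₂ ≫ j₁) s = p.el W₂ ^ N • ∑ i, (p.el W₂ * f i) • M.res (j₂ ≫ j₁ ≫ j) (y i) := by
    rw [← res_comp, ← hm, p.ev_mul, res_smul, p.rres_el_pow, hf]
    simp only [mul_smul, ← Finset.smul_sum]
    rw [smul_smul, ← pow_succ]
  have H₂ := H.res (j₂ ≫ j₁ ≫ j)
  have hs₂ := (p.pow M (N + 1)).res_mem (j₂ ≫ j₁) hs
  have h0₂ := congr_arg (M.res (j₂ ≫ j₁)) h0
  rw [res_smul, p.rres_el, map_zero] at h0₂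
  rw [h1] at hs₂ h0₂
  refine (H₂.exists_coeff hs₂).bind fun W₃ j₃ ⟨ψ, c, h⟩ => ?_
  have H₃ := H₂.res j₃
  have h3 : M.res (j₃ ≫ j₂ ≫ j₁) s = p.el W₃ ^ N • ∑ i, A.rres j₃ (p.el W₂ * f i) •
      M.res j₃ (M.res (j₂ ≫ j₁ ≫ j) (y i)) := by
    rw [← res_comp, h1, res_smul, p.rres_el_pow, res_sum_smul]
  have h0₃ := congr_arg (M.res j₃) h0₂
  rw [← h1, res_smul, res_comp, p.rres_el, map_zero, h3] at h0₃
  have := hL W₃ _ (coherent_redRel (p := p.restrict W₃) Over.mkIdTerminal (hA₀.over W₃)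
    fun k => ofCoord fun i => A.rres j₃ (A.rres (j₂ ≫ j₁ ≫ j) (g k i)))
  refine Locally.of_over (Y := Over.mk (𝟙 W₃)) (this.mono fun T i hi => ?_)
  have := H₃.res_eq_zero hp h h0₃ i hi
  rw [← h3, res_comp] at this
  simpa only [Category.assoc] using this

end FormalParameter.Controls

end Site

/-! ### Separation of torsion over an algebra of formal deformation -/

section Deformation

variable {X : TopCat.{u}}

lemma CategoryTheory.GrothendieckTopology.Locally.exists_mem {U : Opens X}
    {P : ∀ V : Opens X, (V ⟶ U) → Prop} (h : (Opens.grothendieckTopology X).Locally U P) {x : X}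
    (hx : x ∈ U) : ∃ (V : Opens X) (i : V ⟶ U), x ∈ V ∧ P V i := by
  obtain ⟨S, hS, h⟩ := h
  obtain ⟨V, i, hi, hxV⟩ := hS x hx
  exact ⟨V, i, hxV, h V i hi⟩

variable {A : Sheaf (Opens.grothendieckTopology X) RingCat.{u}} {h : CentralSection A}

lemma IsFormalDeformation.locally_liftsTowers (hA : IsFormalDeformation A h) {V : Opens X}
    {P : SheafOfModules.{u} ((reduction h).over V)} (hP : IsCoherentModule P) :
    ((Opens.grothendieckTopology X).over V).Locally (Over.mk (𝟙 V)) fun _ i =>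
      (hA.parameter.restrict V).LiftsTowers P i := by
  refine ⟨{ arrows := fun _ i => (hA.parameter.restrict V).LiftsTowers P i
            downward_closed := fun hi j => hi.comp j }, ?_, fun _ _ hi => hi⟩
  rw [mem_over_iff]
  intro x hx
  obtain ⟨T, i, hxT, hi⟩ := hA.exists_liftsTowers hP hx
  exact ⟨T.left, i.left, (Sieve.overEquiv_iff _ _).2 (hi.comp (Over.homMk (𝟙 _))), hxT⟩

lemma IsFormalDeformation.exists_controls (hA : IsFormalDeformation A h) {M : SheafOfModules.{u} A}
    (hM : IsCoherentModule M) (x : X) : ∃ (V : Opens X) (N k l : ℕ) (y : Fin k → M.Sec V)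
      (g : Fin l → Fin k → A.RSec V), x ∈ V ∧ hA.parameter.Controls M N y g := by
  obtain ⟨hgen, hrel⟩ := isCoherentModule_iff.1 hM
  obtain ⟨V, -, hxV, k, y, hy⟩ := (hgen ⊤).exists_mem (x := x) trivial
  obtain ⟨S, hS, h1⟩ := (hA.parameter.restrict V).stationary_initial
    (lincomb (M.over V) Over.mkIdTerminal fun i => overTop (y i)) (hM.over V)
    (hA.noetherian.vec_isChainNoetherian V k) (Over.mk (𝟙 V))
  obtain ⟨V', j, hj, hxV'⟩ := (mem_over_iff _ S).1 hS x hxV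
  obtain ⟨N, hN⟩ := h1 _ _ ((Sieve.overEquiv_iff S j).1 hj)
  -- The relations are those between the `ħ^N yᵢ`, so they can be chosen only after `N`; the last
  -- shrinking does not disturb stability.
  obtain ⟨V'', j', hxV'', l, g, hg⟩ := (hrel.exists_relGen
    fun i => hA.parameter.el V' ^ N • M.res j (y i)).exists_mem hxV'
  refine ⟨V'', N, k, l, fun i => M.res (j' ≫ j) (y i), g, hxV'', hy.res _, ?_, ?_⟩
  · simpa only [res_smul, hA.parameter.rres_el_pow, res_comp] using hg
  · intro r hr W i a ha
    simp only [res_comp] at ha ⊢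
    exact hA.parameter.mem_pow_of_over (hN r hr (Over.mk (i ≫ j' ≫ j)) (Over.homMk (i ≫ j')) (ofCoord a)
      (hA.parameter.mem_pow_over ha))

lemma IsFormalDeformation.torsionEmbeds (hA : IsFormalDeformation A h) {M : SheafOfModules.{u} A}
    (hM : IsCoherentModule M) : TorsionEmbeds h M := by
  intro x
  obtain ⟨V, N, k, l, y, g, hx, H⟩ := hA.exists_controls hM x
  refine ⟨V, N, hx, fun n => mono_of_ev _ fun W m hm => ?_⟩
  -- A section of `_nM` that dies in `M_N` lies in `ħ^{N+1}M`. Powers of `ħ` are stripped one at a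
  -- time: `ħ^n s` still lies in `ħ^{N+1}M` and is killed by `ħ`, hence is zero. The index `N` is
  -- the same for all `n`.
  have key : ∀ n (s : M.Sec W.left), s ∈ (hA.parameter.pow M (N + 1)).obj W.left →
      hA.parameter.el W.left ^ n • s = 0 → s = 0 := by
    intro n
    induction n with
    | zero => exact fun s _ h0 => by rwa [pow_zero, one_smul] at h0
    | succ n ih =>
      refine fun s hs h0 => ih s hs (H.eq_zero hA.isComplete hA.noetherian.coherent
        (fun V P hP => hA.locally_liftsTowers hP) W.hom (Submodule.smul_mem _ _ hs) ?_)
      rwa [smul_smul, ← pow_succ']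
  refine ev_injective (kernel.ι (hPow h M (n + 1))) W.left ((key (n + 1) _ ?_ ?_).trans
    (map_zero _).symm)
  · exact exists_ev_of_cokernel (hPow h M (N + 1)) hm
  · exact ev_kernel (hPow h M (n + 1)) m

end Deformation

end

theorem propositionL {X : TopCat.{u}} [T2Space X] [LocallyCompactSpace X]
    (A : Sheaf (Opens.grothendieckTopology X) RingCat.{u}) (h : CentralSection A) (hA : IsFormalDeformation A h)
    (S : SerreSubstack A) :
    IsSerreSubcategory (coherentModules A) (modSerre S h) ∧
      ∀ M : SheafOfModules.{u} A, IsCoherentModule M →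
        List.TFAE [modSerre S h M, S.level h 0 (hQuot h M 0),
          ∀ n : ℕ, S.level h n (hQuot h M n)] :=
  have hT : ∀ M : SheafOfModules.{u} A, IsCoherentModule M → TorsionEmbeds h M :=
    fun _ hM => hA.torsionEmbeds hM
  ⟨isSerreSubcategory_modSerre hT S, fun M hM => modSerre_tfae hT S M hM⟩
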